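/- **Setting.** Let $d\ge 0$, let $\mathcal X\subseteq\mathbb B^d(1)$ (the closed Euclidean unit ball) and $\mathcal Z=\mathcal X\times\{-1,1\}$. A (well-specified) linear model $M$ consists of a probability distribution $\mu_M$ on $\mathcal X$ and a parameter $\theta^M\in\mathbb B^d(1)$; under $M$, $x\sim\mu_M$ and $y\in\{-1,1\}$ has conditional mean $\langle x,\theta^M\rangle$. Let $\mathcal M_{\sf Lin}$ be the class of all linear models (no assumption on $\mu_M$). The decisions are estimators $\theta\in\Pi=\mathbb B^d(1)$, with loss the $L_1$ error $L_1(M,\theta)=\mathbb E_{x\sim\mu_M}|\langle x,\theta-\theta^M\rangle|$. *Private PAC-DEC.* Let $\mathcal L$ be the set of measurable $\ell:\mathcal Z\to[0,1]$ and $D_\ell(P,Q)=|\mathbb E_P\ell-\mathbb E_Q\ell|$. Then $$\textsf{p-dec}_\varepsilon(\mathcal M_{\sf Lin})=\sup_{\overline M\in\mathrm{co}(\mathcal M_{\sf Lin})}\ \inf_{p\in\Delta(\Pi),\,q\in\Delta(\Pi\times\mathcal L)}\ \sup_{M\in\mathcal M_{\sf Lin}}\Big\{\mathbb E_{\theta\sim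 p}L_1(M,\theta)\ :\ \mathbb E_{(\pi,\ell)\sim q}D_\ell^2(M,\overline M)\le\varepsilon^2\Big\},$$ where $\mathrm{co}$ denotes all mixtures and the supremum of the empty set is $0$. *$\alpha$-LDP algorithms.* A channel $\mathsf Q$ from $\mathcal Z$ to an observation space $\mathcal O$ is $\alpha$-DP if $\mathsf Q(E|z)\le e^\alpha\mathsf Q(E|z')$ for all $z,z'$ and measurable $E$. A $T$-round $\alpha$-LDP algorithm chooses in each round $t\le T$, at random and depending on the history, a pair $(\pi^t,\mathsf Q^t)$ of a decision and an $\alpha$-DP channel, and observes $o^t\sim\mathsf Q^t(\cdot|z^t)$ with $z^t\sim M^\star$ independent across rounds; after $T$ rounds it outputs an estimator $\hat\theta\in\mathbb B^d(1)$ (possibly at random). $\mathsf Q\circ M$ denotes the law of $o$ when $z\sim M$, $o\sim\mathsf Q(\cdot|z)$. *LDP-ExO.* Take $\mathcal O=\{-1,1\}$, let $\mathcal Q_\alpha$ be the set of all $\alpha$-DP channels $\mathcal Z\to\{-1,1\}$, and fix a nonempty finite $\Theta\subset\mathbb B^d(1)$ and $\gamma>0$. For $w\in\Delta(\Theta)$,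 $p\in\Delta(\Pi)$, $q\in\Delta(\Pi\times\mathcal Q_\alpha)$ and a bounded measurable $\xi:\Theta\times(\Pi\times\mathcal Q_\alpha)\times\mathcal O\to\mathbb R$ let $$\Gamma_{w,\gamma}(p,q,\xi)=\sup_{\substack{\psi\in\Theta,\ M\in\mathcal M_{\sf Lin}\\ \theta^M=\psi}}\Big\{\mathbb E_{\theta\sim p}L_1(M,\theta)-\gamma\,\mathbb E_{(\pi,\mathsf Q)\sim q}\mathbb E_{o\sim\mathsf Q\circ M}\mathbb E_{\psi'\sim w}\big[1-e^{\xi(\psi';\pi,\mathsf Q,o)-\xi(\psi;\pi,\mathsf Q,o)}\big]\Big\}.$$ An LDP-ExO run with parameters $(\Theta,\gamma)$ and optimization tolerance $\eta\ge0$ starts from $w^1=\mathrm{Unif}(\Theta)$; in round $t$ it picks (measurably in the history) $(p^t,q^t,\xi^t)$ with $\Gamma_{w^t,\gamma}(p^t,q^t,\xi^t)\le\inf_{p,q,\xi}\Gamma_{w^t,\gamma}(p,q,\xi)+\eta$, draws $(\pi^t,\mathsf Q^t)\sim q^t$, observes $o^t$, and sets $w^{t+1}(\psi)\propto w^t(\psi)\exp(\xi^t(\psi;\pi^t,\mathsf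 Q^t,o^t))$. It outputs $\hat\theta=\frac1T\sum_{t=1}^T\mathbb E_{\theta\sim p^t}[\theta]$. It is $\alpha$-LDP by construction. **Theorem.** 1. There is a universal constant $C$ such that $\textsf{p-dec}_\varepsilon(\mathcal M_{\sf Lin})\le C\sqrt d\,\varepsilon$ for all $d$, $\mathcal X\subseteq\mathbb B^d(1)$ and $\varepsilon\ge0$. 2. For every $\alpha_0>0$ there is a constant $C=C(\alpha_0)$ such that for all $d$, $\mathcal X\subseteq\mathbb B^d(1)$, $\alpha\in(0,\alpha_0]$, $T\ge1$ and $\delta\in(0,1)$ there are a nonempty finite $\Theta\subset\mathbb B^d(1)$ and $\gamma>0$ such that LDP-ExO runs with parameters $(\Theta,\gamma)$ exist for every tolerance $\eta>0$, and for every $\eta\ge0$, every such run with tolerance $\eta$, and every $M^\star\in\mathcal M_{\sf Lin}$, with probability at least $1-\delta$, $$L_1(M^\star,\hat\theta)\le C\sqrt{\log(eT)}\,\sqrt{\frac{d^2\log(e/\delta)}{\alpha^2T}}+\eta .$$ 3. This is minimax-optimal up to logarithmic factors: for every $\alpha_0>0$ there is $c=c(\alpha_0)>0$ such that for every $d\ge1$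 there is a distribution $\nu$ on $\mathbb B^d(1)$ with the property that, for all $\alpha\in(0,\alpha_0]$ and $T\ge1$, every $T$-round $\alpha$-LDP algorithm (with any observation space) satisfies $$\sup_{\theta^\star\in\mathbb B^d(1)}\mathbb E\,L_1(M_{\nu,\theta^\star},\hat\theta)\ \ge\ c\,\min\Big\{\frac{d}{\alpha\sqrt T},\frac1{\sqrt d}\Big\},$$ where $M_{\nu,\theta^\star}$ is the linear model over $\mathbb B^d(1)$ with covariate distribution $\nu$ and parameter $\theta^\star$. -/

import Mathlib

open MeasureTheory ProbabilityTheory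
open scoped ENNReal

noncomputable section

namespace LDPRegression

/-! ### Queries and the private PAC-DEC of a statistical model class -/

/-- The class of measurable functions `ℓ : Z → [0,1]`. -/
structure Query (Z : Type) [MeasurableSpace Z] where
  toFun : Z → ℝ
  measurable_toFun : Measurable toFun
  mem_unit : ∀ z, toFun z ∈ Set.Icc (0 : ℝ) 1

/-- The smallest σ-algebra on queries for which all expectations `ℓ ↦ E_P[ℓ]` are measurable;
distributions over queries are probability measures on it. -/
instance (Z : Type) [MeasurableSpace Z] : MeasurableSpace (Query Z) :=
  ⨆ P : ProbabilityMeasure Z,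
    (borel ℝ).comap (fun ℓ : Query Z => ∫ z, ℓ.toFun z ∂(P : Measure Z))

/-- The divergence `D_ℓ(P, Q) = |E_P[ℓ] - E_Q[ℓ]|`. -/
def queryDiv {Z : Type} [MeasurableSpace Z] (ℓ : Query Z) (P Q : Measure Z) : ℝ :=
  |∫ z, ℓ.toFun z ∂P - ∫ z, ℓ.toFun z ∂Q|

/-- The private PAC-DEC at a reference model `Mbar`, for models `law i ∈ Δ(Z)` (`i : ι`) that do
not depend on the decision, decisions in `D`, and a nonnegative loss.  The constrained supremum
over an empty set of models is `0`. -/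
def pdecAt {ι Z D : Type} [MeasurableSpace Z] [MeasurableSpace D]
    (law : ι → ProbabilityMeasure Z) (loss : ι → D → ℝ) (ε : ℝ) (Mbar : Measure Z) : ℝ≥0∞ :=
  ⨅ (p : ProbabilityMeasure D) (q : ProbabilityMeasure (D × Query Z)),
    ⨆ (i : ι) (_ : ∫ x, queryDiv x.2 (law i) Mbar ^ 2 ∂(q : Measure (D × Query Z)) ≤ ε ^ 2),
      ∫⁻ a, ENNReal.ofReal (loss i a) ∂(p : Measure D)

/-- The convex hull `co(M)`: all mixtures `E_{M ∼ μ}[M]` of models of the class. -/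
def mixtures {ι Z : Type} [MeasurableSpace Z] (law : ι → ProbabilityMeasure Z) :
    Set (Measure Z) :=
  {P | ∃ μ : ProbabilityMeasure (Measure Z),
    (∀ᵐ m ∂(μ : Measure (Measure Z)), ∃ i, m = (law i : Measure Z)) ∧
      P = Measure.join (μ : Measure (Measure Z))}

/-- The private PAC-DEC of a statistical model class. -/
def pdec {ι Z D : Type} [MeasurableSpace Z] [MeasurableSpace D]
    (law : ι → ProbabilityMeasure Z) (loss : ι → D → ℝ) (ε : ℝ) : ℝ≥0∞ :=
  ⨆ Mbar ∈ mixtures law, pdecAt law loss ε Mbar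

/-! ### Private channels and locally private algorithms -/

/-- `α`-differentially private channels from `Z` to `O`. -/
structure Channel (α : ℝ) (Z O : Type) [MeasurableSpace Z] [MeasurableSpace O] where
  kernel : Kernel Z O
  isMarkov : IsMarkovKernel kernel
  private_le : ∀ (z z' : Z) (E : Set O), MeasurableSet E →
    kernel z E ≤ ENNReal.ofReal (Real.exp α) * kernel z' E

section Protocol

variable {α : ℝ} {Z O D : Type} [MeasurableSpace Z] [MeasurableSpace O] [MeasurableSpace D]

/-- The marginal law `Q ∘ P` of `o` when `z ∼ P` and `o ∼ Q(· | z)`. -/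
def Channel.push (Q : Channel α Z O) (P : ProbabilityMeasure Z) : Measure O :=
  (P : Measure Z).bind Q.kernel

/-- The smallest σ-algebra on channels for which `Q ↦ (Q ∘ P)(E)` is measurable for all `P`, `E`. -/
instance : MeasurableSpace (Channel α Z O) :=
  ⨆ (P : ProbabilityMeasure Z) (E : {E : Set O // MeasurableSet E}),
    (inferInstance : MeasurableSpace ℝ≥0∞).comap
      (fun Q : Channel α Z O => Q.push P (E : Set O))

theorem Channel.measurable_push (P : ProbabilityMeasure Z) :
    Measurable (fun Q : Channel α Z O => Q.push P) := by
  refine Measure.measurable_of_measurable_coe _ (fun E hE => ?_)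
  refine Measurable.of_comap_le ?_
  exact le_iSup_of_le P (le_iSup_of_le (⟨E, hE⟩ : {E : Set O // MeasurableSet E}) le_rfl)

/-- The conditional law of the observation given the channel, when the latent sample has law `P`. -/
def obsKernel (α : ℝ) (O : Type) [MeasurableSpace O] (P : ProbabilityMeasure Z) :
    Kernel (Channel α Z O) O where
  toFun Q := Q.push P
  measurable' := Channel.measurable_push P

instance (P : ProbabilityMeasure Z) : IsMarkovKernel (obsKernel α O P) :=
  ⟨fun Q => by
    have := Q.isMarkov
    show IsProbabilityMeasure ((P : Measure Z).bind Q.kernel)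
    infer_instance⟩

variable (α Z O D) in
/-- Histories of `t` rounds: the chosen (decision, channel) pairs and the observations. -/
abbrev Hist (t : ℕ) : Type := Fin t → (D × Channel α Z O) × O

variable (α Z O D) in
/-- Adaptive randomized choice, in each round, of a decision and an `α`-DP channel. -/
structure Exploration where
  q : ∀ t : ℕ, Kernel (Hist α Z O D t) (D × Channel α Z O)
  isMarkov : ∀ t, IsMarkovKernel (q t)

/-- One round: draw `(π, Q)` given the history, then `o ∼ Q ∘ P`. -/
def Exploration.step (A : Exploration α Z O D) (P : ProbabilityMeasure Z) (t : ℕ) :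
    Kernel (Hist α Z O D t) ((D × Channel α Z O) × O) :=
  (A.q t) ⊗ₖ ((obsKernel α O P).comap
    (fun x : Hist α Z O D t × (D × Channel α Z O) => x.2.2) (by fun_prop))

/-- The law of the history after `t` rounds when the latent samples are i.i.d. from `P`. -/
def Exploration.histLaw (A : Exploration α Z O D) (P : ProbabilityMeasure Z) :
    (t : ℕ) → Measure (Hist α Z O D t)
  | 0 => Measure.dirac (fun i => i.elim0)
  | t + 1 => ((A.histLaw P t) ⊗ₘ (A.step P t)).map
      (fun x => (Fin.snoc x.1 x.2 : Hist α Z O D (t + 1)))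

variable (α Z O D) in
/-- A `T`-round `α`-LDP algorithm: an exploration rule and a randomized output decision. -/
structure Algorithm (T : ℕ) extends Exploration α Z O D where
  out : Kernel (Hist α Z O D T) D
  isMarkov_out : IsMarkovKernel out

/-- The expected loss of the output of an algorithm when the latent samples have law `P`. -/
def Algorithm.risk {T : ℕ} (A : Algorithm α Z O D T) (P : ProbabilityMeasure Z)
    (loss : D → ℝ) : ℝ≥0∞ :=
  ∫⁻ h, ∫⁻ a, ENNReal.ofReal (loss a) ∂(A.out h) ∂(A.toExploration.histLaw P T)

end Protocol

/-! ### Well-specified linear models with the `L₁` estimation error -/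

/-- The closed Euclidean unit ball of `ℝ^d`: the space of parameters and of estimators. -/
abbrev Ball (d : ℕ) : Type := Metric.closedBall (0 : EuclideanSpace ℝ (Fin d)) 1

/-- The law `Rad(m)` of a label in `{-1, 1}` with mean `m`; `true` stands for `1` and `false`
for `-1`. -/
def rad (m : ℝ) : Measure Bool :=
  ENNReal.ofReal ((1 + m) / 2) • Measure.dirac true +
    ENNReal.ofReal ((1 - m) / 2) • Measure.dirac false

theorem isProbabilityMeasure_rad {m : ℝ} (hm : |m| ≤ 1) : IsProbabilityMeasure (rad m) := by
  obtain ⟨h1, h2⟩ := abs_le.mp hm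
  constructor
  simp only [rad, Measure.add_apply, Measure.smul_apply, measure_univ, smul_eq_mul, mul_one]
  rw [← ENNReal.ofReal_add (by linarith) (by linarith), ← ENNReal.ofReal_one]
  congr 1
  ring

section Linear

variable {d : ℕ}

/-- The conditional law of the label: `y | x ∼ Rad(⟨x, θ⟩)`. -/
def labelKernel (X : Set (EuclideanSpace ℝ (Fin d))) (θ : Ball d) : Kernel X Bool where
  toFun x := rad (inner ℝ (x : EuclideanSpace ℝ (Fin d)) (θ : EuclideanSpace ℝ (Fin d)))
  measurable' := by
    refine Measure.measurable_of_measurable_coe _ (fun E hE => ?_)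
    simp only [rad, Measure.add_apply, Measure.smul_apply, smul_eq_mul]
    have hin : Measurable (fun x : X => (inner ℝ (x : EuclideanSpace ℝ (Fin d))
        (θ : EuclideanSpace ℝ (Fin d)) : ℝ)) :=
      (Measurable.inner_const (measurable_subtype_coe))
    exact ((((measurable_const.add hin).div_const 2).ennreal_ofReal).mul_const _).add
      ((((measurable_const.sub hin).div_const 2).ennreal_ofReal).mul_const _)

theorem isMarkovKernel_labelKernel {X : Set (EuclideanSpace ℝ (Fin d))}
    (hX : X ⊆ Metric.closedBall 0 1) (θ : Ball d) : IsMarkovKernel (labelKernel X θ) := by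
  refine ⟨fun x => isProbabilityMeasure_rad ?_⟩
  have h1 : ‖(x : EuclideanSpace ℝ (Fin d))‖ ≤ 1 := mem_closedBall_zero_iff.mp (hX x.2)
  have h2 : ‖(θ : EuclideanSpace ℝ (Fin d))‖ ≤ 1 := mem_closedBall_zero_iff.mp θ.2
  calc |inner ℝ (x : EuclideanSpace ℝ (Fin d)) (θ : EuclideanSpace ℝ (Fin d))|
      ≤ ‖(x : EuclideanSpace ℝ (Fin d))‖ * ‖(θ : EuclideanSpace ℝ (Fin d))‖ :=
        abs_real_inner_le_norm _ _
    _ ≤ 1 := mul_le_one₀ h1 (norm_nonneg _) h2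

/-- A well-specified linear model over the covariate space `X`: a covariate distribution and a
parameter in the unit ball. -/
structure LinModel (X : Set (EuclideanSpace ℝ (Fin d))) where
  cov : ProbabilityMeasure X
  param : Ball d

variable {X : Set (EuclideanSpace ℝ (Fin d))}

/-- The law of `(x, y)` under the model: `x ∼ cov`, `y | x ∼ Rad(⟨x, param⟩)`. -/
def LinModel.law (hX : X ⊆ Metric.closedBall 0 1) (M : LinModel X) :
    ProbabilityMeasure (X × Bool) :=
  ⟨(M.cov : Measure X) ⊗ₘ (labelKernel X M.param), by
    have := isMarkovKernel_labelKernel hX M.param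
    infer_instance⟩

/-- The `L₁` estimation error `L₁(M, θ) = E_{x ∼ M} |⟨x, θ - θ^M⟩|`. -/
def LinModel.lossL1 (M : LinModel X) (θ : Ball d) : ℝ :=
  ∫ x, |inner ℝ (x : EuclideanSpace ℝ (Fin d))
    ((θ : EuclideanSpace ℝ (Fin d)) - (M.param : EuclideanSpace ℝ (Fin d)))| ∂(M.cov : Measure X)

/-! ### The algorithm LDP-ExO for linear models

Exploration-by-optimization (option `pac`) with binary observations, all `α`-DP channels from
`Z = X × {-1, 1}` to `{-1, 1}` as measurements, and the information sets
`M_θ = {M : θ^M = θ}`, `π_θ = θ`, for `θ` in a finite set `Θ` of parameters.  With the value function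
`V^M(π) = -L₁(M, π)`, the loss `V^M(π_θ) - V^M(π)` of the information set `θ` equals `L₁(M, π)` for
every `M ∈ M_θ`. -/

variable (X) in
/-- The pairs (decision, binary channel). -/
abbrev Probe (α : ℝ) : Type := Ball d × Channel α (X × Bool) Bool

variable (X) in
/-- Histories of LDP-ExO. -/
abbrev BinHist (α : ℝ) (t : ℕ) : Type := Hist α (X × Bool) Bool (Ball d) t

/-- Weight functions: measurable and uniformly bounded. -/
def IsWeight {α : ℝ} {Θ : Finset (Ball d)} (ξ : Θ → Probe X α → Bool → ℝ) : Prop :=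
  (∀ ψ, Measurable (fun x : Probe X α × Bool => ξ ψ x.1 x.2)) ∧ ∃ A, ∀ ψ π o, |ξ ψ π o| ≤ A

/-- The exploration-by-optimization objective `Γ_{w,γ}(p, q, ξ; M, ψ)`. -/
def exoObj (hX : X ⊆ Metric.closedBall 0 1) {α : ℝ} {Θ : Finset (Ball d)} (w : Θ → ℝ) (γ : ℝ)
    (p : Measure (Ball d)) (q : Measure (Probe X α)) (ξ : Θ → Probe X α → Bool → ℝ)
    (M : LinModel X) (ψ : Θ) : ℝ :=
  ∫ a, M.lossL1 a ∂p -
    γ * ∫ π, ∫ o, ∑ ψ' : Θ, w ψ' * (1 - Real.exp (ξ ψ' π o - ξ ψ π o)) ∂(π.2.push (M.law hX)) ∂q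

/-- `Γ_{w,γ}(p, q, ξ) = sup_{(M, ψ) : M ∈ M_ψ} Γ_{w,γ}(p, q, ξ; M, ψ)`. -/
def exoSup (hX : X ⊆ Metric.closedBall 0 1) {α : ℝ} {Θ : Finset (Ball d)} (w : Θ → ℝ) (γ : ℝ)
    (p : Measure (Ball d)) (q : Measure (Probe X α)) (ξ : Θ → Probe X α → Bool → ℝ) : EReal :=
  ⨆ (ψ : Θ) (M : LinModel X) (_ : M.param = (ψ : Ball d)),
    ((exoObj hX w γ p q ξ M ψ : ℝ) : EReal)

/-- The optimal value of the exploration-by-optimization problem at the reference distribution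
`w`. -/
def exoVal (hX : X ⊆ Metric.closedBall 0 1) (α : ℝ) {Θ : Finset (Ball d)} (w : Θ → ℝ)
    (γ : ℝ) : EReal :=
  ⨅ (p : ProbabilityMeasure (Ball d)) (q : ProbabilityMeasure (Probe X α))
    (ξ : Θ → Probe X α → Bool → ℝ) (_ : IsWeight ξ),
    exoSup hX w γ (p : Measure (Ball d)) (q : Measure (Probe X α)) ξ

/-- The reference distributions `w^t`: uniform at the start, then
`w^{t+1}(ψ) ∝ w^t(ψ) exp(ξ^t(ψ; π^t, o^t))`. -/
def expWeights {α : ℝ} (Θ : Finset (Ball d))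
    (ξ : (t : ℕ) → BinHist X α t → Θ → Probe X α → Bool → ℝ) :
    (t : ℕ) → BinHist X α t → Θ → ℝ
  | 0, _ => fun _ => 1 / (Θ.card : ℝ)
  | t + 1, h => fun ψ =>
      let u : Θ → ℝ := fun ψ' => expWeights Θ ξ t (Fin.init h) ψ' *
        Real.exp (ξ t (Fin.init h) ψ' (h (Fin.last t)).1 (h (Fin.last t)).2)
      u ψ / ∑ ψ' : Θ, u ψ'

/-- An instance of LDP-ExO with information sets indexed by `Θ`, uniform prior and parameter `γ`:
in round `t`, given the history, it picks `(p^t, q^t, ξ^t)` minimizing the objective at `w^t` up to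
`η` (an exact minimizer for `η = 0`), measurably in the history, and explores with `q^t`. -/
structure LDPExO (hX : X ⊆ Metric.closedBall 0 1) (α : ℝ) (Θ : Finset (Ball d)) (γ η : ℝ)
    extends Exploration α (X × Bool) Bool (Ball d) where
  p : ∀ t : ℕ, Kernel (BinHist X α t) (Ball d)
  isMarkov_p : ∀ t, IsMarkovKernel (p t)
  ξ : (t : ℕ) → BinHist X α t → Θ → Probe X α → Bool → ℝ
  measurable_ξ : ∀ (t : ℕ) (ψ : Θ),
    Measurable (fun x : BinHist X α t × (Probe X α × Bool) => ξ t x.1 ψ x.2.1 x.2.2)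
  bounded_ξ : ∀ (t : ℕ) (h : BinHist X α t), ∃ A, ∀ ψ π o, |ξ t h ψ π o| ≤ A
  optimal : ∀ (t : ℕ) (h : BinHist X α t),
    exoSup hX (expWeights Θ ξ t h) γ (p t h) (q t h) (ξ t h) ≤
      exoVal hX α (expWeights Θ ξ t h) γ + (η : EReal)

/-- The output after `T` rounds: the mean of `(1/T) ∑_t p^t`. -/
def LDPExO.output {hX : X ⊆ Metric.closedBall 0 1} {α : ℝ} {Θ : Finset (Ball d)} {γ η : ℝ}
    (R : LDPExO hX α Θ γ η) (T : ℕ) (h : BinHist X α T) : Ball d :=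
  ⟨(1 / (T : ℝ)) • ∑ t : Fin T, ∫ a, (a : EuclideanSpace ℝ (Fin d))
      ∂(R.p t (fun i => h (Fin.castLE t.isLt.le i))), by
    have hb : ∀ t : Fin T, ‖∫ a, (a : EuclideanSpace ℝ (Fin d))
        ∂(R.p t (fun i => h (Fin.castLE t.isLt.le i)))‖ ≤ 1 := by
      intro t
      have := R.isMarkov_p t
      have h1 := norm_integral_le_of_norm_le_const (μ := R.p t (fun i => h (Fin.castLE t.isLt.le i)))
        (f := fun a : Ball d => (a : EuclideanSpace ℝ (Fin d))) (C := 1)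
        (Filter.Eventually.of_forall (fun a => mem_closedBall_zero_iff.mp a.2))
      simpa using h1
    rw [mem_closedBall_zero_iff, norm_smul]
    have h2 : ‖∑ t : Fin T, ∫ a, (a : EuclideanSpace ℝ (Fin d))
        ∂(R.p t (fun i => h (Fin.castLE t.isLt.le i)))‖ ≤ (T : ℝ) := by
      refine (norm_sum_le _ _).trans ((Finset.sum_le_sum (fun t _ => hb t)).trans ?_)
      simp
    rcases Nat.eq_zero_or_pos T with h0 | h0
    · subst h0
      simp
    · have hT : (0 : ℝ) < T := by exact_mod_cast h0
      rw [Real.norm_of_nonneg (by positivity), one_div, inv_mul_le_iff₀ hT]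
      simpa using h2⟩

end Linear

end LDPRegression

end

/-!
# Linear regression under local differential privacy without assumptions on the covariates

**Estimation from queries.** The difficulty is that the covariate distribution is arbitrary and may
be badly conditioned. It is balanced by a linear change of coordinates `A`, a near-minimizer of
`2 E‖A x‖ + λ² ‖A‖² - 2 log |det A|` (Hilbert–Schmidt norm; `exists_design`), for which
`E[A x (A x)ᵀ / ‖A x‖] + λ² A Aᵀ` is comparable to the identity; hence `E‖A x‖ ≤ 2 d` and
`‖A x‖ ≤ 2 / λ`. The estimator at a reference law `P` is the least-squares estimator over the ball with
the weights `1 / ‖A x‖` (`exists_constrained_leastSquares`). If `v` is a standard Gaussian vector, the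
sign of `⟨A x, v⟩` has correlation `κ ⟨A x, e⟩ / ‖A x‖` with `⟨v, e⟩`
(`integral_sgn_mul_inner_stdGaussian`), so bounded queries built from such signs, averaged over `v`,
recover the weighted correlations of covariates and residuals, and products of two signs recover the
weighted second moments. By Cauchy–Schwarz (`abs_integral_average_sub_le`), a linear model that is
`ε`-close to `P` in mean square under these random queries nearly satisfies the normal equations of the
estimator; with `λ` of order `ε` its `L₁` error is `O(√d ε)` (`exists_estimator_of_query_close`). This
is the bound on the private decision-estimation coefficient (`pdec_le`).

**The value of exploration-by-optimization.** Under a finite prior over models, the estimators at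
the dyadic scales `ε = 2ᵏ S` are chained to an estimator with expected error `O(√d S)`, where `S²` is the
largest mean-square separation that a single query achieves (`exists_estimator_of_prior`). The learner
replies to the prior with that estimator, a binary channel whose bias is `c ≈ α` times the best query,
and halved log-likelihood ratios as weights; the resulting gain is one minus the average of the squared
Bhattacharyya coefficients of the two observations, and at least `c² S² / 4` up to the tolerance in the
choice of the query
(`exists_weight_gain`, `exists_reply`). Since `K S - γ c² S² / 4 ≤ K² / (γ c²)`, every prior has a reply
of value `O(d / (γ α²))`. A finite minimax theorem over a net of covariates
(`exists_mem_convexHull_lt`, `exists_finite_strategy`) turns the replies into one strategy against all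
models, so `exoVal_le` bounds the value of the game uniformly in the reference distribution `w`.

**The guarantee of LDP-ExO.** Along a run, `exp (∑ (loss - V - η) / γ) / w_t(ψ)` is a supermartingale
when `ψ` is the true parameter and `V` bounds the value (`LDPExO.lintegral_exp_excess_le`), so by Markov's
inequality the average loss is at most `V + η + γ log (|Θ| / δ) / T` with high probability, and by
Jensen's inequality the output is at least as good. For `Θ` a net of radius `δ / (2 T)`, replacing the true
parameter by its neighbor in `Θ` changes the law of the history by at most `δ / 2` in total variation
(`LinModel.lintegral_histLaw_le`). The choice of `γ` that balances the terms gives the rate. Runs exist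
because the worst-case objective is upper semicontinuous in `w`: by the Lindelöf property countably many
strategies are near-optimal for all `w`, and the least index of a near-optimal one is measurable
(`nonempty_LDPExO`).

**The lower bound.** The covariates are uniform on the standard basis and the parameters are the
vertices of a cube `{-τ, τ}^d`. Flipping one coordinate changes the observation law of an `α`-private
channel by a factor `1 ± β` with `β = O(α τ / d)` (`push_le_of_flip`). For measures with such a ratio,
`(∫ f dm')² ≤ (1 + β²) ∫ f² dm`, and this inequality is stable under adaptive rounds without any density
(`Exploration.sq_lintegral_histLaw_le`): after `T` rounds the factor is `(1 + β²)^T ≤ 2` when `β ≲ 1 / √T`.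
Assouad's argument concludes (`half_le_iSup_risk`).
-/

namespace LDPRegression

/-! ### Integration against labels, models, channels and histories -/

theorem lintegral_rad (m : ℝ) (f : Bool → ℝ≥0∞) :
    ∫⁻ b, f b ∂(rad m) =
      ENNReal.ofReal ((1 + m) / 2) * f true + ENNReal.ofReal ((1 - m) / 2) * f false := by
  simp [rad, lintegral_add_measure, lintegral_smul_measure]

theorem integral_rad {m : ℝ} (hm : |m| ≤ 1) (f : Bool → ℝ) :
    ∫ b, f b ∂(rad m) = (1 + m) / 2 * f true + (1 - m) / 2 * f false := by
  obtain ⟨h1, h2⟩ := abs_le.mp hm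
  have hi : ∀ b : Bool, ∀ c : ℝ, Integrable f (ENNReal.ofReal c • Measure.dirac b) := fun b c =>
    (integrable_dirac (by simp)).smul_measure ENNReal.ofReal_ne_top
  rw [rad, integral_add_measure (hi _ _) (hi _ _), integral_smul_measure, integral_smul_measure,
    integral_dirac, integral_dirac, ENNReal.toReal_ofReal (by linarith),
    ENNReal.toReal_ofReal (by linarith), smul_eq_mul, smul_eq_mul]

section Histories

variable {α : ℝ} {Z O D : Type} [MeasurableSpace Z] [MeasurableSpace O] [MeasurableSpace D]

theorem lintegral_push (Q : Channel α Z O) (P : ProbabilityMeasure Z) {f : O → ℝ≥0∞}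
    (hf : Measurable f) :
    ∫⁻ o, f o ∂(Q.push P) = ∫⁻ z, ∫⁻ o, f o ∂(Q.kernel z) ∂(P : Measure Z) := by
  rw [Channel.push, Measure.lintegral_bind Q.kernel.measurable.aemeasurable hf.aemeasurable]

instance (Q : Channel α Z O) (P : ProbabilityMeasure Z) : IsProbabilityMeasure (Q.push P) := by
  have := Q.isMarkov
  unfold Channel.push
  infer_instance

theorem Exploration.isMarkovKernel_step (A : Exploration α Z O D) (P : ProbabilityMeasure Z)
    (t : ℕ) : IsMarkovKernel (A.step P t) := by
  have := A.isMarkov t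
  unfold Exploration.step
  infer_instance

theorem measurable_snoc (t : ℕ) :
    Measurable (fun x : Hist α Z O D t × ((D × Channel α Z O) × O) =>
      (Fin.snoc x.1 x.2 : Hist α Z O D (t + 1))) := by
  refine measurable_pi_lambda _ (fun i => ?_)
  refine Fin.lastCases ?_ (fun j => ?_) i
  · simpa using measurable_snd
  · simp only [Fin.snoc_castSucc]
    exact (measurable_pi_apply j).comp measurable_fst

theorem measurable_init (t : ℕ) :
    Measurable (fun h : Hist α Z O D (t + 1) => (Fin.init h : Hist α Z O D t)) :=
  measurable_pi_lambda _ (fun i => measurable_pi_apply (Fin.castSucc i))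

theorem Exploration.isProbabilityMeasure_histLaw (A : Exploration α Z O D)
    (P : ProbabilityMeasure Z) (t : ℕ) : IsProbabilityMeasure (A.histLaw P t) := by
  induction t with
  | zero => unfold Exploration.histLaw; infer_instance
  | succ t ih =>
    have := A.isMarkovKernel_step P t
    unfold Exploration.histLaw
    exact Measure.isProbabilityMeasure_map (measurable_snoc t).aemeasurable

theorem measurable_lintegral_push (P : ProbabilityMeasure Z) {B : Type} [MeasurableSpace B]
    {c : B → Channel α Z O} (hc : Measurable c) {f : B → O → ℝ≥0∞}
    (hf : Measurable (Function.uncurry f)) :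
    Measurable (fun a => ∫⁻ o, f a o ∂((c a).push P)) :=
  Measurable.lintegral_kernel_prod_right (κ := (obsKernel α O P).comap c hc) hf

/-- Unfolding of the last round in the law of the history. -/
theorem Exploration.lintegral_histLaw_succ (A : Exploration α Z O D) (P : ProbabilityMeasure Z)
    (t : ℕ) {f : Hist α Z O D (t + 1) → ℝ≥0∞} (hf : Measurable f) :
    ∫⁻ h, f h ∂(A.histLaw P (t + 1)) =
      ∫⁻ h, ∫⁻ a, ∫⁻ o, f (Fin.snoc h (a, o) : Hist α Z O D (t + 1)) ∂(a.2.push P) ∂(A.q t h)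
        ∂(A.histLaw P t) := by
  have := A.isMarkovKernel_step P t
  have := A.isMarkov t
  have := A.isProbabilityMeasure_histLaw P t
  have hg : Measurable (fun x : Hist α Z O D t × ((D × Channel α Z O) × O) =>
      f (Fin.snoc x.1 x.2 : Hist α Z O D (t + 1))) := hf.comp (measurable_snoc t)
  rw [Exploration.histLaw, lintegral_map hf (measurable_snoc t), Measure.lintegral_compProd hg]
  refine lintegral_congr (fun h => ?_)
  exact Kernel.lintegral_compProd (A.q t) _ h (hg.comp measurable_prodMk_left)

theorem Exploration.measurable_lintegral_step (A : Exploration α Z O D) (P : ProbabilityMeasure Z)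
    (t : ℕ) {f : Hist α Z O D (t + 1) → ℝ≥0∞} (hf : Measurable f) :
    Measurable (fun h => ∫⁻ a, ∫⁻ o, f (Fin.snoc h (a, o) : Hist α Z O D (t + 1)) ∂(a.2.push P)
      ∂(A.q t h)) := by
  have := A.isMarkov t
  have hg : Measurable (fun x : Hist α Z O D t × ((D × Channel α Z O) × O) =>
      f (Fin.snoc x.1 x.2 : Hist α Z O D (t + 1))) := hf.comp (measurable_snoc t)
  refine Measurable.lintegral_kernel_prod_right (κ := A.q t)
    (f := fun h a => ∫⁻ o, f (Fin.snoc h (a, o) : Hist α Z O D (t + 1)) ∂(a.2.push P)) ?_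
  refine measurable_lintegral_push (P := P) (measurable_snd.comp measurable_snd)
    (f := fun (b : Hist α Z O D t × (D × Channel α Z O)) (o : O) =>
      f (Fin.snoc b.1 (b.2, o) : Hist α Z O D (t + 1))) ?_
  exact hg.comp ((measurable_fst.comp measurable_fst).prodMk
    ((measurable_snd.comp measurable_fst).prodMk measurable_snd))

end Histories

section Models

variable {d : ℕ} {X : Set (EuclideanSpace ℝ (Fin d))}

theorem norm_covariate_le (hX : X ⊆ Metric.closedBall 0 1) (x : X) :
    ‖(x : EuclideanSpace ℝ (Fin d))‖ ≤ 1 :=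
  mem_closedBall_zero_iff.mp (hX x.2)

theorem Ball.norm_le (θ : Ball d) : ‖(θ : EuclideanSpace ℝ (Fin d))‖ ≤ 1 :=
  mem_closedBall_zero_iff.mp θ.2

theorem abs_inner_covariate_le (hX : X ⊆ Metric.closedBall 0 1) (x : X)
    (v : EuclideanSpace ℝ (Fin d)) : |inner ℝ (x : EuclideanSpace ℝ (Fin d)) v| ≤ ‖v‖ :=
  (abs_real_inner_le_norm _ _).trans
    (mul_le_of_le_one_left (norm_nonneg _) (norm_covariate_le hX x))

theorem abs_inner_param_le (hX : X ⊆ Metric.closedBall 0 1) (x : X) (θ : Ball d) :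
    |inner ℝ (x : EuclideanSpace ℝ (Fin d)) (θ : EuclideanSpace ℝ (Fin d))| ≤ 1 :=
  (abs_inner_covariate_le hX x _).trans θ.norm_le

theorem measurable_inner_covariate (v : EuclideanSpace ℝ (Fin d)) :
    Measurable (fun x : X => inner ℝ (x : EuclideanSpace ℝ (Fin d)) v) :=
  Measurable.inner_const measurable_subtype_coe

theorem Ball.norm_sub_le (θ θ' : Ball d) :
    ‖(θ : EuclideanSpace ℝ (Fin d)) - (θ' : EuclideanSpace ℝ (Fin d))‖ ≤ 2 :=
  (_root_.norm_sub_le _ _).trans (by linarith [θ.norm_le, θ'.norm_le])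

theorem integrable_of_bounded {Ω : Type*} [MeasurableSpace Ω] {μ : Measure Ω} [IsFiniteMeasure μ]
    {f : Ω → ℝ} (hf : Measurable f) {C : ℝ} (hC : ∀ x, |f x| ≤ C) : Integrable f μ :=
  Integrable.of_bound hf.aestronglyMeasurable C (Filter.Eventually.of_forall hC)

theorem LinModel.lintegral_law (hX : X ⊆ Metric.closedBall 0 1) (M : LinModel X)
    {f : X × Bool → ℝ≥0∞} (hf : Measurable f) :
    ∫⁻ z, f z ∂(M.law hX : Measure (X × Bool)) =
      ∫⁻ x, ∫⁻ b, f (x, b) ∂(rad (inner ℝ (x : EuclideanSpace ℝ (Fin d))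
        (M.param : EuclideanSpace ℝ (Fin d)))) ∂(M.cov : Measure X) := by
  have := isMarkovKernel_labelKernel hX M.param
  show ∫⁻ z, f z ∂((M.cov : Measure X) ⊗ₘ (labelKernel X M.param)) = _
  rw [Measure.lintegral_compProd hf]
  rfl

theorem LinModel.integral_law (hX : X ⊆ Metric.closedBall 0 1) (M : LinModel X)
    {f : X × Bool → ℝ} (hf : Measurable f) {C : ℝ} (hC : ∀ z, |f z| ≤ C) :
    ∫ z, f z ∂(M.law hX : Measure (X × Bool)) =
      ∫ x, ((1 + inner ℝ (x : EuclideanSpace ℝ (Fin d)) (M.param : EuclideanSpace ℝ (Fin d))) / 2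
          * f (x, true) +
        (1 - inner ℝ (x : EuclideanSpace ℝ (Fin d)) (M.param : EuclideanSpace ℝ (Fin d))) / 2
          * f (x, false)) ∂(M.cov : Measure X) := by
  have := isMarkovKernel_labelKernel hX M.param
  have hi : Integrable f ((M.cov : Measure X) ⊗ₘ (labelKernel X M.param)) :=
    integrable_of_bounded hf hC
  show ∫ z, f z ∂((M.cov : Measure X) ⊗ₘ (labelKernel X M.param)) = _
  rw [Measure.integral_compProd hi]
  refine integral_congr_ae (Filter.Eventually.of_forall (fun x => ?_))
  exact integral_rad (abs_inner_param_le hX x M.param) _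

theorem LinModel.lossL1_nonneg (M : LinModel X) (θ : Ball d) : 0 ≤ M.lossL1 θ :=
  integral_nonneg (fun _ => abs_nonneg _)

theorem integrable_abs_inner (hX : X ⊆ Metric.closedBall 0 1) (μ : Measure X) [IsFiniteMeasure μ]
    (v : EuclideanSpace ℝ (Fin d)) :
    Integrable (fun x : X => |inner ℝ (x : EuclideanSpace ℝ (Fin d)) v|) μ :=
  integrable_of_bounded (measurable_inner_covariate v).abs (C := ‖v‖)
    (fun x => by rw [abs_abs]; exact abs_inner_covariate_le hX x v)

theorem LinModel.abs_lossL1_sub_le (hX : X ⊆ Metric.closedBall 0 1) (M : LinModel X)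
    (θ θ' : Ball d) : |M.lossL1 θ - M.lossL1 θ'| ≤
      ‖(θ : EuclideanSpace ℝ (Fin d)) - (θ' : EuclideanSpace ℝ (Fin d))‖ := by
  unfold LinModel.lossL1
  rw [← integral_sub (integrable_abs_inner hX _ _) (integrable_abs_inner hX _ _)]
  refine le_trans (b := ‖(θ : EuclideanSpace ℝ (Fin d)) - (θ' : EuclideanSpace ℝ (Fin d))‖ *
    (M.cov : Measure X).real Set.univ) ?_ (by rw [probReal_univ, mul_one])
  rw [← Real.norm_eq_abs]
  refine norm_integral_le_of_norm_le_const (Filter.Eventually.of_forall (fun x => ?_))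
  refine (abs_abs_sub_abs_le_abs_sub _ _).trans ?_
  rw [← inner_sub_right, sub_sub_sub_cancel_right]
  exact abs_inner_covariate_le hX x _

theorem LinModel.lossL1_le_two (hX : X ⊆ Metric.closedBall 0 1) (M : LinModel X) (θ : Ball d) :
    M.lossL1 θ ≤ 2 := by
  have h0 : M.lossL1 M.param = 0 := by
    simp only [LinModel.lossL1, sub_self, inner_zero_right, abs_zero, integral_zero]
  have h := (abs_le.mp (M.abs_lossL1_sub_le hX θ M.param)).2
  have h2 := θ.norm_sub_le M.param
  linarith

theorem LinModel.measurable_lossL1 (hX : X ⊆ Metric.closedBall 0 1) (M : LinModel X) :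
    Measurable (fun θ : Ball d => M.lossL1 θ) := by
  refine Continuous.measurable ?_
  refine LipschitzWith.continuous (K := 1) (LipschitzWith.of_dist_le_mul (fun θ θ' => ?_))
  rw [Real.dist_eq, NNReal.coe_one, one_mul, Subtype.dist_eq, dist_eq_norm]
  exact M.abs_lossL1_sub_le hX θ θ'

end Models

/-! ### Comparison of the histories of two models with close observation laws -/

/-- A second-moment form of closeness: if the likelihood ratio of `m'` to `m` lies in
`[1 - β, 1 + β]`, then `(∫ f dm')² ≤ (1 + β²) ∫ f² dm`.  Unlike a divergence, this inequality
passes through adaptive rounds without any density. -/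
theorem sq_lintegral_le_of_ratio {Ω : Type*} [MeasurableSpace Ω] {m m' : Measure Ω}
    [IsProbabilityMeasure m] [IsProbabilityMeasure m'] {β : ℝ} (hβ : 0 ≤ β)
    (h1 : m' ≤ m + ENNReal.ofReal β • m) (h2 : m ≤ m' + ENNReal.ofReal β • m)
    {f : Ω → ℝ≥0∞} (hf : Measurable f) (hf1 : ∀ x, f x ≤ 1) :
    (∫⁻ x, f x ∂m') ^ 2 ≤ ENNReal.ofReal (1 + β ^ 2) * ∫⁻ x, f x ^ 2 ∂m := by
  set g : Ω → ℝ := fun x => (f x).toReal with hg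
  have hfg : ∀ x, f x = ENNReal.ofReal (g x) := fun x =>
    (ENNReal.ofReal_toReal (ne_top_of_le_ne_top ENNReal.one_ne_top (hf1 x))).symm
  have hg0 : ∀ x, 0 ≤ g x := fun x => ENNReal.toReal_nonneg
  have hg1 : ∀ x, g x ≤ 1 := fun x => by
    simpa using ENNReal.toReal_mono ENNReal.one_ne_top (hf1 x)
  have hgm : Measurable g := hf.ennreal_toReal
  -- the ratio bounds, tested on nonnegative functions
  have key : ∀ h : Ω → ℝ, Measurable h → (∀ x, 0 ≤ h x) → (∀ x, h x ≤ 1) →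
      ∫ x, h x ∂m' ≤ (1 + β) * ∫ x, h x ∂m ∧ ∫ x, h x ∂m ≤ ∫ x, h x ∂m' + β * ∫ x, h x ∂m := by
    intro h hm h0 h1'
    have hi : ∀ μ : Measure Ω, IsFiniteMeasure μ → Integrable h μ := fun μ _ =>
      integrable_of_bounded hm (C := 1) (fun x => by rw [abs_of_nonneg (h0 x)]; exact h1' x)
    have hfin : IsFiniteMeasure (ENNReal.ofReal β • m) :=
      Measure.smul_finite _ ENNReal.ofReal_ne_top
    have e : ∀ μ : Measure Ω, IsFiniteMeasure μ → ∫ x, h x ∂(μ + ENNReal.ofReal β • m) =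
        ∫ x, h x ∂μ + β * ∫ x, h x ∂m := fun μ hμ => by
      rw [integral_add_measure (hi μ hμ) (hi _ hfin), integral_smul_measure,
        ENNReal.toReal_ofReal hβ, smul_eq_mul]
    have i1 := integral_mono_measure h1 (Filter.Eventually.of_forall h0) (hi _ inferInstance)
    have i2 := integral_mono_measure h2 (Filter.Eventually.of_forall h0) (hi _ inferInstance)
    rw [e _ inferInstance] at i1 i2
    exact ⟨by linarith, i2⟩
  -- With the mean `a` and the mean absolute deviation `b` of `g` under `m`, the ratio bounds on the
  -- positive and negative parts of `g - a` give `∫ g dm' ≤ a + β b`, and `a² + b² ≤ ∫ g² dm`.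
  set a : ℝ := ∫ x, g x ∂m with ha
  have hgi : ∀ μ : Measure Ω, [IsProbabilityMeasure μ] → Integrable g μ := fun μ _ =>
    integrable_of_bounded hgm (C := 1) (fun x => by rw [abs_of_nonneg (hg0 x)]; exact hg1 x)
  have ha0 : 0 ≤ a := integral_nonneg hg0
  have ha1 : a ≤ 1 := by
    have := integral_mono (hgi m) (integrable_const (1 : ℝ)) hg1
    simpa using this
  set b : ℝ := ∫ x, |g x - a| ∂m with hb
  have hpm : Measurable (fun x => max (g x - a) 0) := (hgm.sub_const a).max measurable_const
  have hnm : Measurable (fun x => max (a - g x) 0) := (measurable_const.sub hgm).max measurable_const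
  have hp := (key _ hpm (fun x => le_max_right _ _)
    (fun x => max_le (by linarith [hg1 x]) zero_le_one)).1
  have hn := (key _ hnm (fun x => le_max_right _ _)
    (fun x => max_le (by linarith [hg0 x]) zero_le_one)).2
  have hpi : ∀ μ : Measure Ω, [IsProbabilityMeasure μ] →
      Integrable (fun x => max (g x - a) 0) μ := fun μ _ =>
    ((hgi μ).sub (integrable_const a)).pos_part
  have hni : ∀ μ : Measure Ω, [IsProbabilityMeasure μ] →
      Integrable (fun x => max (a - g x) 0) μ := fun μ _ =>
    ((integrable_const a).sub (hgi μ)).pos_part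
  have hsub : ∀ μ : Measure Ω, [IsProbabilityMeasure μ] →
      ∫ x, g x ∂μ - a = ∫ x, max (g x - a) 0 ∂μ - ∫ x, max (a - g x) 0 ∂μ := fun μ _ => by
    rw [← integral_sub (hpi μ) (hni μ)]
    have : ∫ x, g x ∂μ - a = ∫ x, (g x - a) ∂μ := by
      rw [integral_sub (hgi μ) (integrable_const a)]; simp
    rw [this]
    refine integral_congr_ae (Filter.Eventually.of_forall (fun x => ?_))
    simp only
    rcases le_total (g x) a with h | h
    · rw [max_eq_right (by linarith), max_eq_left (by linarith)]; ring
    · rw [max_eq_left (by linarith), max_eq_right (by linarith)]; ring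
  have hbsum : b = ∫ x, max (g x - a) 0 ∂m + ∫ x, max (a - g x) 0 ∂m := by
    rw [← integral_add (hpi m) (hni m)]
    refine integral_congr_ae (Filter.Eventually.of_forall (fun x => ?_))
    simp only
    rcases le_total (g x) a with h | h
    · rw [max_eq_right (by linarith), max_eq_left (by linarith), abs_of_nonpos (by linarith)]; ring
    · rw [max_eq_left (by linarith), max_eq_right (by linarith), abs_of_nonneg (by linarith)]; ring
  have hsm := hsub m
  have hsm' := hsub m'
  have hmain : ∫ x, g x ∂m' ≤ a + β * b := by
    rw [hbsum]
    nlinarith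
  have hvar : a ^ 2 + b ^ 2 ≤ ∫ x, g x ^ 2 ∂m := by
    have hd : Measurable (fun x => |g x - a|) := (hgm.sub_const a).abs
    have hdi : Integrable (fun x => |g x - a|) m := ((hgi m).sub (integrable_const a)).abs
    have hg2 : Integrable (fun x => g x ^ 2) m :=
      integrable_of_bounded (hgm.pow_const 2) (C := 1) (fun x => by
        rw [abs_of_nonneg (sq_nonneg _)]; nlinarith [hg0 x, hg1 x])
    have hnn : 0 ≤ ∫ x, (|g x - a| - b) ^ 2 ∂m := integral_nonneg (fun _ => sq_nonneg _)
    have hex : ∀ x, (|g x - a| - b) ^ 2 = g x ^ 2 - 2 * a * g x - 2 * b * |g x - a|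
        + (a ^ 2 + b ^ 2) := fun x => by
      rw [sub_sq, sq_abs]; ring
    simp_rw [hex] at hnn
    have i1 : Integrable (fun x => 2 * a * g x) m := (hgi m).const_mul _
    have i2 : Integrable (fun x => 2 * b * |g x - a|) m := hdi.const_mul _
    have i3 : Integrable (fun x => g x ^ 2 - 2 * a * g x) m := hg2.sub i1
    have i4 : Integrable (fun x => g x ^ 2 - 2 * a * g x - 2 * b * |g x - a|) m := i3.sub i2
    rw [integral_add i4 (integrable_const _), integral_sub i3 i2, integral_sub hg2 i1,
      integral_const_mul, integral_const_mul] at hnn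
    rw [← ha, ← hb] at hnn
    simp only [integral_const, probReal_univ, one_smul] at hnn
    nlinarith
  have hb0 : 0 ≤ b := integral_nonneg (fun _ => abs_nonneg _)
  have hfin : (∫ x, g x ∂m') ^ 2 ≤ (1 + β ^ 2) * ∫ x, g x ^ 2 ∂m := by
    have h0 : 0 ≤ ∫ x, g x ∂m' := integral_nonneg hg0
    calc (∫ x, g x ∂m') ^ 2 ≤ (a + β * b) ^ 2 := by gcongr
      _ ≤ (1 + β ^ 2) * (a ^ 2 + b ^ 2) := by nlinarith [sq_nonneg (b - β * a)]
      _ ≤ _ := by gcongr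
  have hl : ∫⁻ x, f x ∂m' = ENNReal.ofReal (∫ x, g x ∂m') := by
    rw [ofReal_integral_eq_lintegral_ofReal (hgi m') (Filter.Eventually.of_forall hg0)]
    exact lintegral_congr hfg
  have hr : ∫⁻ x, f x ^ 2 ∂m = ENNReal.ofReal (∫ x, g x ^ 2 ∂m) := by
    rw [ofReal_integral_eq_lintegral_ofReal _ (Filter.Eventually.of_forall (fun x => sq_nonneg _))]
    · refine lintegral_congr (fun x => ?_)
      rw [hfg x, ENNReal.ofReal_pow (hg0 x), ← hfg x]
    · exact integrable_of_bounded (hgm.pow_const 2) (C := 1) (fun x => by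
        rw [abs_of_nonneg (sq_nonneg _)]; nlinarith [hg0 x, hg1 x])
  rw [hl, hr, ← ENNReal.ofReal_pow (integral_nonneg hg0), ← ENNReal.ofReal_mul (by positivity)]
  exact ENNReal.ofReal_le_ofReal hfin

section Histories

variable {α : ℝ} {Z O D : Type} [MeasurableSpace Z] [MeasurableSpace O] [MeasurableSpace D]

/-- The second-moment comparison for histories: per-round factors multiply. -/
theorem Exploration.sq_lintegral_histLaw_le (A : Exploration α Z O D) (P P' : ProbabilityMeasure Z)
    {β : ℝ} (hβ : 0 ≤ β)
    (h1 : ∀ Q : Channel α Z O, Q.push P' ≤ Q.push P + ENNReal.ofReal β • Q.push P)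
    (h2 : ∀ Q : Channel α Z O, Q.push P ≤ Q.push P' + ENNReal.ofReal β • Q.push P)
    (t : ℕ) (f : Hist α Z O D t → ℝ≥0∞) (hf : Measurable f) (hf1 : ∀ h, f h ≤ 1) :
    (∫⁻ h, f h ∂(A.histLaw P' t)) ^ 2 ≤
      ENNReal.ofReal (1 + β ^ 2) ^ t * ∫⁻ h, f h ^ 2 ∂(A.histLaw P t) := by
  induction t with
  | zero =>
    have : IsProbabilityMeasure (A.histLaw P 0) := A.isProbabilityMeasure_histLaw P 0
    have hh : A.histLaw P' 0 = A.histLaw P 0 := rfl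
    have := sq_lintegral_le_of_ratio (m := A.histLaw P 0) (m' := A.histLaw P 0) le_rfl
      (by simp) (by simp) hf hf1
    simpa [hh] using this
  | succ t ih =>
    have := A.isMarkov t
    have hsn : ∀ h : Hist α Z O D t, Measurable (fun x : (D × Channel α Z O) × O =>
        f (Fin.snoc h x : Hist α Z O D (t + 1))) := fun h =>
      (hf.comp (measurable_snoc t)).comp measurable_prodMk_left
    rw [A.lintegral_histLaw_succ P' t hf, A.lintegral_histLaw_succ P t (hf.pow_const 2)]
    refine (ih _ (A.measurable_lintegral_step P' t hf) (fun h => ?_)).trans ?_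
    · calc _ ≤ ∫⁻ _ : D × Channel α Z O, ∫⁻ _ : O, 1 ∂(_ : Channel α Z O).push P' ∂(A.q t h) :=
            lintegral_mono (fun a => lintegral_mono (fun o => hf1 _))
        _ ≤ 1 := by simp
    rw [pow_succ (ENNReal.ofReal (1 + β ^ 2)) t, mul_assoc, ← lintegral_const_mul' _ _ ENNReal.ofReal_ne_top]
    gcongr with h
    have hmeas : Measurable (fun a : D × Channel α Z O =>
        ∫⁻ o, f (Fin.snoc h (a, o) : Hist α Z O D (t + 1)) ∂(a.2.push P')) :=
      measurable_lintegral_push P' measurable_snd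
        (f := fun a o => f (Fin.snoc h (a, o) : Hist α Z O D (t + 1))) (hsn h)
    -- the choice of the channel does not depend on the model: `β = 0` is Jensen's inequality
    refine (sq_lintegral_le_of_ratio (m := A.q t h) (m' := A.q t h) le_rfl (by simp) (by simp)
      hmeas (fun a => ?_)).trans ?_
    · calc _ ≤ ∫⁻ _ : O, 1 ∂(a.2.push P') := lintegral_mono (fun o => hf1 _)
        _ ≤ 1 := by simp
    simp only [ne_eq, OfNat.ofNat_ne_zero, not_false_eq_true, zero_pow, add_zero,
      ENNReal.ofReal_one, one_mul]
    rw [← lintegral_const_mul' _ _ ENNReal.ofReal_ne_top]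
    refine lintegral_mono (fun a => ?_)
    exact sq_lintegral_le_of_ratio hβ (h1 a.2) (h2 a.2)
      ((hsn h).comp measurable_prodMk_left) (fun o => hf1 _)

end Histories

/-- Two-point testing: under the second-moment comparison with factor `2`, complementary tests
have total error at least `1/2`. -/
theorem half_le_lintegral_add {Ω : Type*} [MeasurableSpace Ω] {μ μ' : Measure Ω}
    [IsProbabilityMeasure μ'] [IsProbabilityMeasure μ]
    (h : ∀ f : Ω → ℝ≥0∞, Measurable f → (∀ x, f x ≤ 1) →
      (∫⁻ x, f x ∂μ') ^ 2 ≤ 2 * ∫⁻ x, f x ^ 2 ∂μ)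
    {φ φ' : Ω → ℝ≥0∞} (hφ : Measurable φ) (hsum : ∀ x, 1 ≤ φ x + φ' x) :
    2⁻¹ ≤ ∫⁻ x, φ x ∂μ + ∫⁻ x, φ' x ∂μ' := by
  -- the comparison concerns `[0, 1]`-valued functions, so the test is truncated
  set f : Ω → ℝ≥0∞ := fun x => min (φ x) 1 with hf
  have hfm : Measurable f := hφ.min measurable_const
  have hf1 : ∀ x, f x ≤ 1 := fun x => min_le_right _ _
  set x : ℝ≥0∞ := ∫⁻ x, f x ∂μ
  set y : ℝ≥0∞ := ∫⁻ x, f x ∂μ'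
  have hx : ∫⁻ x, f x ^ 2 ∂μ ≤ x := lintegral_mono (fun z => by
    simpa [sq] using mul_le_mul_right (hf1 z) (f z))
  have hy1 : y ≤ 1 := by
    calc y ≤ ∫⁻ _, 1 ∂μ' := lintegral_mono hf1
      _ = 1 := by simp
  have hx1 : x ≤ 1 := by
    calc x ≤ ∫⁻ _, 1 ∂μ := lintegral_mono hf1
      _ = 1 := by simp
  have hyx : y ^ 2 ≤ 2 * x := (h f hfm hf1).trans (by gcongr)
  have h1 : 1 ≤ y + ∫⁻ x, φ' x ∂μ' := by
    rw [← lintegral_add_left hfm]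
    calc (1 : ℝ≥0∞) = ∫⁻ _, 1 ∂μ' := by simp
      _ ≤ _ := lintegral_mono (fun z => by
        simp only [hf]
        rcases le_total (φ z) 1 with h' | h'
        · rw [min_eq_left h']; exact hsum z
        · rw [min_eq_right h']; exact le_self_add)
  have hxφ : x ≤ ∫⁻ x, φ x ∂μ := lintegral_mono (fun z => min_le_left _ _)
  have hxt : x ≠ ⊤ := ne_top_of_le_ne_top ENNReal.one_ne_top hx1
  have hyt : y ≠ ⊤ := ne_top_of_le_ne_top ENNReal.one_ne_top hy1
  have hr : 2⁻¹ + y ≤ x + 1 := by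
    clear_value x y
    lift x to NNReal using hxt
    lift y to NNReal using hyt
    have : (y : ℝ) ^ 2 ≤ 2 * x := by exact_mod_cast hyx
    -- `1 + x - y ≥ 1 + y² / 2 - y = 1 / 2 + (1 - y)² / 2`
    have h3 : (2 : ℝ)⁻¹ + y ≤ x + 1 := by nlinarith [sq_nonneg ((y : ℝ) - 1)]
    have e : (2⁻¹ : ℝ≥0∞) = ((2⁻¹ : NNReal) : ℝ≥0∞) := by simp
    rw [e]
    exact_mod_cast h3
  have h4 : 2⁻¹ + y ≤ (∫⁻ x, φ x ∂μ + ∫⁻ x, φ' x ∂μ') + y := by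
    calc 2⁻¹ + y ≤ x + 1 := hr
      _ ≤ ∫⁻ x, φ x ∂μ + (y + ∫⁻ x, φ' x ∂μ') := add_le_add hxφ h1
      _ = _ := by ring
  exact (ENNReal.add_le_add_iff_right hyt).mp h4

/-! ### The minimax lower bound -/

section LowerBound

variable {d : ℕ}

/-- The `i`-th standard basis vector, as a covariate. -/
noncomputable def basisPt (i : Fin d) :
    Metric.closedBall (0 : EuclideanSpace ℝ (Fin d)) 1 :=
  ⟨EuclideanSpace.single i 1, by simp⟩

variable (d) in
/-- The uniform distribution on the standard basis. -/
noncomputable def basisMeasure : Measure (Metric.closedBall (0 : EuclideanSpace ℝ (Fin d)) 1) :=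
  ∑ i : Fin d, ENNReal.ofReal (1 / d) • Measure.dirac (basisPt i)

theorem integral_basisMeasure
    (f : Metric.closedBall (0 : EuclideanSpace ℝ (Fin d)) 1 → ℝ) :
    ∫ x, f x ∂(basisMeasure d) = 1 / d * ∑ i, f (basisPt i) := by
  rw [basisMeasure, integral_finsetSum_measure]
  · simp_rw [integral_smul_measure, integral_dirac]
    rw [Finset.mul_sum]
    simp
  · intro i _
    exact (integrable_dirac (by simp)).smul_measure ENNReal.ofReal_ne_top

theorem isProbabilityMeasure_basisMeasure (hd : 1 ≤ d) :
    IsProbabilityMeasure (basisMeasure d) := by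
  have h : (d : ℝ) ≠ 0 := by positivity
  constructor
  simp only [basisMeasure, Measure.coe_finsetSum, Finset.sum_apply, Measure.smul_apply,
    measure_univ, smul_eq_mul, mul_one, Finset.sum_const, Finset.card_univ, Fintype.card_fin,
    nsmul_eq_mul]
  rw [← ENNReal.ofReal_natCast, ← ENNReal.ofReal_mul (by positivity), mul_one_div_cancel h,
    ENNReal.ofReal_one]

theorem inner_basisPt (i : Fin d) (v : EuclideanSpace ℝ (Fin d)) :
    inner ℝ ((basisPt i : Metric.closedBall (0 : EuclideanSpace ℝ (Fin d)) 1) :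
      EuclideanSpace ℝ (Fin d)) v = v i := by
  simp [basisPt, EuclideanSpace.inner_single_left]

/-- The vertex of the cube `{-τ, τ}^d` with sign pattern `s`. -/
noncomputable def cubeVertex {τ : ℝ} (hτ : d * τ ^ 2 ≤ 1) (s : Fin d → Bool) : Ball d :=
  ⟨WithLp.toLp 2 (fun i => if s i then τ else -τ), by
    rw [mem_closedBall_zero_iff, EuclideanSpace.norm_eq, Real.sqrt_le_one]
    refine le_trans (le_of_eq ?_) hτ
    simp⟩

theorem cubeVertex_apply {τ : ℝ} (hτ : d * τ ^ 2 ≤ 1) (s : Fin d → Bool) (i : Fin d) :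
    (cubeVertex hτ s : EuclideanSpace ℝ (Fin d)) i = if s i then τ else -τ := rfl

theorem lossL1_basis (ν : ProbabilityMeasure (Metric.closedBall (0 : EuclideanSpace ℝ (Fin d)) 1))
    (hν : (ν : Measure _) = basisMeasure d) (θ a : Ball d) :
    (LinModel.mk ν θ).lossL1 a = 1 / d * ∑ i, |(a : EuclideanSpace ℝ (Fin d)) i -
      (θ : EuclideanSpace ℝ (Fin d)) i| := by
  simp only [LinModel.lossL1, hν]
  rw [integral_basisMeasure]
  simp_rw [inner_basisPt]
  rfl

/-- Flipping one coordinate of the parameter changes only the label law at one of the `d` atoms, so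
that an `α`-private view of it changes by a factor `1 ± O(τ α / d)`. -/
theorem abs_integral_sub_le_of_flip (hd : 1 ≤ d)
    (ν : ProbabilityMeasure (Metric.closedBall (0 : EuclideanSpace ℝ (Fin d)) 1))
    (hν : (ν : Measure _) = basisMeasure d) {τ : ℝ} (hτ0 : 0 ≤ τ) (hτ : d * τ ^ 2 ≤ 1)
    (s s' : Fin d → Bool) (i : Fin d) (hs : ∀ j, j ≠ i → s' j = s j) {α : ℝ}
    (K : Metric.closedBall (0 : EuclideanSpace ℝ (Fin d)) 1 × Bool → ℝ) (hK : Measurable K)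
    (hK0 : ∀ z, 0 ≤ K z) (hK1 : ∀ z, K z ≤ 1) (hKα : ∀ z z', K z ≤ Real.exp α * K z') :
    |∫ z, K z ∂((LinModel.mk ν (cubeVertex hτ s')).law subset_rfl : Measure _) -
      ∫ z, K z ∂((LinModel.mk ν (cubeVertex hτ s)).law subset_rfl : Measure _)| ≤
      (τ / d * (Real.exp α - 1) * Real.exp α) *
        ∫ z, K z ∂((LinModel.mk ν (cubeVertex hτ s)).law subset_rfl : Measure _) := by
  have hd' : (0 : ℝ) < d := by positivity
  have hKb : ∀ z, |K z| ≤ 1 := fun z => by rw [abs_of_nonneg (hK0 z)]; exact hK1 z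
  set P := (LinModel.mk ν (cubeVertex hτ s)).law subset_rfl
  -- privacy bounds each value of `K` by its mean
  have hle : ∀ z, K z ≤ Real.exp α * ∫ z, K z ∂(P : Measure _) := by
    intro z
    have h := integral_mono (μ := (P : Measure _)) (integrable_const (K z))
      ((integrable_of_bounded hK hKb).const_mul (Real.exp α)) (fun z' => hKα z z')
    rw [integral_const_mul] at h
    simpa using h
  have hdiff : ∀ b b' : Bool, K (basisPt i, b) - K (basisPt i, b') ≤
      (Real.exp α - 1) * Real.exp α * ∫ z, K z ∂(P : Measure _) := by
    intro b b'
    have hα : 0 ≤ (Real.exp α - 1) * K (basisPt i, b') := by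
      have := hKα (basisPt i, b') (basisPt i, b'); linarith
    rcases (hK0 (basisPt i, b')).eq_or_lt with h0 | h0
    · have h1 := hKα (basisPt i, b) (basisPt i, b')
      have h2 : ∀ z, K z = 0 := fun z => le_antisymm (by
        have := hKα z (basisPt i, b'); rw [← h0, mul_zero] at this; exact this) (hK0 z)
      simp [h2]
    · have hα' : 0 ≤ Real.exp α - 1 := nonneg_of_mul_nonneg_left hα h0
      calc K (basisPt i, b) - K (basisPt i, b') ≤ (Real.exp α - 1) * K (basisPt i, b') := by
            have := hKα (basisPt i, b) (basisPt i, b'); linarith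
        _ ≤ (Real.exp α - 1) * (Real.exp α * ∫ z, K z ∂(P : Measure _)) := by
            gcongr; exact hle _
        _ = _ := by ring
  have hexp : ∀ s : Fin d → Bool,
      ∫ z, K z ∂((LinModel.mk ν (cubeVertex hτ s)).law subset_rfl : Measure _) =
      1 / d * ∑ j, ((1 + if s j then τ else -τ) / 2 * K (basisPt j, true) +
        (1 - if s j then τ else -τ) / 2 * K (basisPt j, false)) := by
    intro s
    rw [LinModel.integral_law _ _ hK hKb]
    simp only [hν]
    rw [integral_basisMeasure]
    simp_rw [inner_basisPt, cubeVertex_apply]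
  have hdec : ∫ z, K z ∂((LinModel.mk ν (cubeVertex hτ s')).law subset_rfl : Measure _) -
      ∫ z, K z ∂(P : Measure _) = 1 / d *
        ((((if s' i then τ else -τ) - if s i then τ else -τ) / 2) *
          (K (basisPt i, true) - K (basisPt i, false))) := by
    rw [hexp, hexp, ← mul_sub, ← Finset.sum_sub_distrib]
    congr 1
    rw [Finset.sum_eq_single i]
    · ring
    · intro j _ hj
      rw [hs j hj]; ring
    · simp
  rw [hdec, abs_mul, abs_mul, abs_of_nonneg (by positivity : (0 : ℝ) ≤ 1 / d)]
  have h1 : |((if s' i then τ else -τ) - if s i then τ else -τ) / 2| ≤ τ := by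
    rw [abs_le]
    constructor <;> split_ifs <;> linarith
  have h2 : |K (basisPt i, true) - K (basisPt i, false)| ≤
      (Real.exp α - 1) * Real.exp α * ∫ z, K z ∂(P : Measure _) :=
    abs_le.mpr ⟨by linarith [hdiff false true], hdiff true false⟩
  calc 1 / (d : ℝ) * (|((if s' i then τ else -τ) - if s i then τ else -τ) / 2| *
        |K (basisPt i, true) - K (basisPt i, false)|)
      ≤ 1 / d * (τ * ((Real.exp α - 1) * Real.exp α * ∫ z, K z ∂(P : Measure _))) := by
        gcongr
    _ = _ := by ring

theorem push_apply_eq_ofReal {α : ℝ} {Z O : Type} [MeasurableSpace Z] [MeasurableSpace O]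
    (Q : Channel α Z O) (P : ProbabilityMeasure Z) {E : Set O} (hE : MeasurableSet E) :
    Q.push P E = ENNReal.ofReal (∫ z, (Q.kernel z E).toReal ∂(P : Measure Z)) := by
  have := Q.isMarkov
  have hm : Measurable (fun z => Q.kernel z E) := Q.kernel.measurable_coe hE
  rw [ofReal_integral_eq_lintegral_ofReal
    (integrable_of_bounded hm.ennreal_toReal (C := 1) (fun z => by
      rw [abs_of_nonneg ENNReal.toReal_nonneg]
      exact measureReal_le_one)) (Filter.Eventually.of_forall (fun _ => ENNReal.toReal_nonneg)),
    Channel.push, Measure.bind_apply hE Q.kernel.measurable.aemeasurable]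
  refine lintegral_congr (fun z => ?_)
  rw [ENNReal.ofReal_toReal (measure_ne_top _ _)]

/-- The flip bound for the observation laws, as the two measure inequalities that the second-moment
comparison of histories needs. -/
theorem push_le_of_flip (hd : 1 ≤ d)
    (ν : ProbabilityMeasure (Metric.closedBall (0 : EuclideanSpace ℝ (Fin d)) 1))
    (hν : (ν : Measure _) = basisMeasure d) {τ : ℝ} (hτ0 : 0 ≤ τ) (hτ : d * τ ^ 2 ≤ 1)
    (s s' : Fin d → Bool) (i : Fin d) (hs : ∀ j, j ≠ i → s' j = s j) {α β : ℝ} (hα : 0 ≤ α)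
    (hβ : τ / d * (Real.exp α - 1) * Real.exp α ≤ β)
    {O : Type} [MeasurableSpace O]
    (Q : Channel α (Metric.closedBall (0 : EuclideanSpace ℝ (Fin d)) 1 × Bool) O) :
    Q.push ((LinModel.mk ν (cubeVertex hτ s')).law subset_rfl) ≤
        Q.push ((LinModel.mk ν (cubeVertex hτ s)).law subset_rfl) +
        ENNReal.ofReal β • Q.push ((LinModel.mk ν (cubeVertex hτ s)).law subset_rfl) ∧
      Q.push ((LinModel.mk ν (cubeVertex hτ s)).law subset_rfl) ≤
        Q.push ((LinModel.mk ν (cubeVertex hτ s')).law subset_rfl) +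
        ENNReal.ofReal β • Q.push ((LinModel.mk ν (cubeVertex hτ s)).law subset_rfl) := by
  have := Q.isMarkov
  have hβ0 : 0 ≤ β := le_trans (by
    have : 0 ≤ Real.exp α - 1 := by linarith [Real.add_one_le_exp α]
    positivity) hβ
  set P := (LinModel.mk ν (cubeVertex hτ s)).law subset_rfl with hP
  set P' := (LinModel.mk ν (cubeVertex hτ s')).law subset_rfl with hP'
  have key : ∀ E : Set O, MeasurableSet E →
      |∫ z, (Q.kernel z E).toReal ∂(P' : Measure _) - ∫ z, (Q.kernel z E).toReal ∂(P : Measure _)| ≤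
        β * ∫ z, (Q.kernel z E).toReal ∂(P : Measure _) := by
    intro E hE
    refine (abs_integral_sub_le_of_flip hd ν hν hτ0 hτ s s' i hs (α := α) _
      (Q.kernel.measurable_coe hE).ennreal_toReal (fun _ => ENNReal.toReal_nonneg)
      (fun _ => measureReal_le_one) (fun z z' => ?_)).trans ?_
    · have h := ENNReal.toReal_mono (by finiteness) (Q.private_le z z' E hE)
      rwa [ENNReal.toReal_mul, ENNReal.toReal_ofReal (Real.exp_pos _).le] at h
    · exact mul_le_mul_of_nonneg_right hβ (integral_nonneg (fun _ => ENNReal.toReal_nonneg))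
  have hnn : ∀ (E : Set O) (R : ProbabilityMeasure
      (Metric.closedBall (0 : EuclideanSpace ℝ (Fin d)) 1 × Bool)),
      0 ≤ ∫ z, (Q.kernel z E).toReal ∂(R : Measure _) :=
    fun E R => integral_nonneg (fun _ => ENNReal.toReal_nonneg)
  constructor <;>
  · refine Measure.le_iff.mpr (fun E hE => ?_)
    have h := abs_le.mp (key E hE)
    rw [Measure.add_apply, Measure.smul_apply, smul_eq_mul, push_apply_eq_ofReal Q P hE,
      push_apply_eq_ofReal Q P' hE, ← ENNReal.ofReal_mul hβ0,
      ← ENNReal.ofReal_add (hnn _ _) (mul_nonneg hβ0 (hnn _ _))]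
    exact ENNReal.ofReal_le_ofReal (by linarith)

/-- Assouad's argument over the cube `{-τ, τ}^d`: if flips of one coordinate cannot be told apart
after `T` rounds, the worst-case risk is at least `τ / 2`. -/
theorem half_le_iSup_risk (hd : 1 ≤ d)
    (ν : ProbabilityMeasure (Metric.closedBall (0 : EuclideanSpace ℝ (Fin d)) 1))
    (hν : (ν : Measure _) = basisMeasure d) {τ : ℝ} (hτ0 : 0 < τ) (hτ : d * τ ^ 2 ≤ 1)
    {α β : ℝ} (hα : 0 ≤ α) (hβ : τ / d * (Real.exp α - 1) * Real.exp α ≤ β) {T : ℕ}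
    (hT : (1 + β ^ 2) ^ T ≤ 2) {O : Type} [MeasurableSpace O]
    (A : Algorithm α (Metric.closedBall (0 : EuclideanSpace ℝ (Fin d)) 1 × Bool) O (Ball d) T) :
    ENNReal.ofReal (τ / 2) ≤ ⨆ θ : Ball d, A.risk ((LinModel.mk ν θ).law subset_rfl)
      (LinModel.mk ν θ).lossL1 := by
  have hd' : (0 : ℝ) < d := by positivity
  have := A.isMarkov_out
  have hβ0 : 0 ≤ β := le_trans (by
    have : 0 ≤ Real.exp α - 1 := by linarith [Real.add_one_le_exp α]
    positivity) hβ
  set μ : (Fin d → Bool) → Measure (Hist α _ O (Ball d) T) := fun s =>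
    A.toExploration.histLaw ((LinModel.mk ν (cubeVertex hτ s)).law subset_rfl) T with hμ
  have hprob : ∀ s, IsProbabilityMeasure (μ s) := fun s =>
    A.toExploration.isProbabilityMeasure_histLaw _ _
  -- `u i b a` is the error of `a` in coordinate `i` when the sign is `b`, in units of the gap `2 τ`;
  -- by the triangle inequality the errors for the two signs add up to at least one
  set u : Fin d → Bool → Ball d → ℝ≥0∞ := fun i b a =>
    ENNReal.ofReal (|(a : EuclideanSpace ℝ (Fin d)) i - if b then τ else -τ| / (2 * τ)) with hu
  have hum : ∀ i b, Measurable (u i b) := fun i b => by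
    have : Continuous (fun a : Ball d => (a : EuclideanSpace ℝ (Fin d)) i) := by fun_prop
    exact (((this.measurable.sub_const _).abs).div_const _).ennreal_ofReal
  set φ : Fin d → Bool → Hist α _ O (Ball d) T → ℝ≥0∞ := fun i b h =>
    ∫⁻ a, u i b a ∂(A.out h) with hφ
  have hφm : ∀ i b, Measurable (φ i b) := fun i b => (hum i b).lintegral_kernel
  have hφsum : ∀ i b h, 1 ≤ φ i b h + φ i (!b) h := by
    intro i b h
    rw [hφ]
    simp only
    rw [← lintegral_add_left (hum i b)]
    calc (1 : ℝ≥0∞) = ∫⁻ _, 1 ∂(A.out h) := by simp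
      _ ≤ _ := lintegral_mono (fun a => by
        simp only [hu]
        rw [← ENNReal.ofReal_add (by positivity) (by positivity), ← ENNReal.ofReal_one]
        refine ENNReal.ofReal_le_ofReal ?_
        rw [← add_div, le_div_iff₀ (by positivity)]
        have h4 := abs_sub ((a : EuclideanSpace ℝ (Fin d)) i - if b then τ else -τ)
          ((a : EuclideanSpace ℝ (Fin d)) i - if !b then τ else -τ)
        refine le_trans ?_ h4
        cases b <;> simp [abs_of_pos hτ0, ← two_mul, le_abs])
  have hpair : ∀ (s : Fin d → Bool) (i : Fin d),
      2⁻¹ ≤ ∫⁻ h, φ i (s i) h ∂(μ s) +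
        ∫⁻ h, φ i (!(s i)) h ∂(μ (Function.update s i (!(s i)))) := by
    intro s i
    have hfl : ∀ j, j ≠ i → Function.update s i (!(s i)) j = s j := fun j hj => by simp [hj]
    refine half_le_lintegral_add (fun f hf hf1 => ?_) (hφm i (s i)) (fun h => hφsum i (s i) h)
    have h := A.toExploration.sq_lintegral_histLaw_le
      ((LinModel.mk ν (cubeVertex hτ s)).law subset_rfl)
      ((LinModel.mk ν (cubeVertex hτ (Function.update s i (!(s i))))).law subset_rfl) hβ0
      (fun Q => (push_le_of_flip hd ν hν hτ0.le hτ s _ i hfl hα hβ Q).1)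
      (fun Q => (push_le_of_flip hd ν hν hτ0.le hτ s _ i hfl hα hβ Q).2) T f hf hf1
    refine h.trans ?_
    gcongr
    rw [← ENNReal.ofReal_pow (by positivity)]
    simpa using ENNReal.ofReal_le_ofReal hT
  have hrisk : ∀ s, A.risk ((LinModel.mk ν (cubeVertex hτ s)).law subset_rfl)
      (LinModel.mk ν (cubeVertex hτ s)).lossL1 =
      ∑ i, ENNReal.ofReal (2 * τ / d) * ∫⁻ h, φ i (s i) h ∂(μ s) := by
    intro s
    unfold Algorithm.risk
    have hl : ∀ a : Ball d, ENNReal.ofReal ((LinModel.mk ν (cubeVertex hτ s)).lossL1 a) =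
        ∑ i, ENNReal.ofReal (2 * τ / d) * u i (s i) a := by
      intro a
      rw [lossL1_basis ν hν, Finset.mul_sum, ENNReal.ofReal_sum_of_nonneg (fun _ _ => by positivity)]
      refine Finset.sum_congr rfl (fun i _ => ?_)
      simp only [hu]
      rw [← ENNReal.ofReal_mul (by positivity), cubeVertex_apply]
      congr 1
      field_simp
    simp_rw [hl]
    have h1 : ∀ h, ∫⁻ a, ∑ i, ENNReal.ofReal (2 * τ / d) * u i (s i) a ∂(A.out h) =
        ∑ i, ENNReal.ofReal (2 * τ / d) * φ i (s i) h := by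
      intro h
      rw [lintegral_finsetSum _ (fun i _ => (hum i (s i)).const_mul _)]
      refine Finset.sum_congr rfl (fun i _ => ?_)
      rw [lintegral_const_mul _ (hum i (s i))]
    simp_rw [h1]
    rw [lintegral_finsetSum _ (fun i _ => (hφm i (s i)).const_mul _)]
    refine Finset.sum_congr rfl (fun i _ => ?_)
    rw [lintegral_const_mul _ (hφm i (s i))]
  set R := ⨆ θ : Ball d, A.risk ((LinModel.mk ν θ).law subset_rfl) (LinModel.mk ν θ).lossL1
    with hR
  have hsumR : ∑ s : Fin d → Bool, (∑ i, ENNReal.ofReal (2 * τ / d) * ∫⁻ h, φ i (s i) h ∂(μ s)) ≤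
      (2 ^ d : ℕ) * R := by
    calc _ ≤ ∑ _s : Fin d → Bool, R := Finset.sum_le_sum (fun s _ => by
          rw [← hrisk]
          exact le_iSup (fun θ : Ball d => A.risk ((LinModel.mk ν θ).law subset_rfl)
            (LinModel.mk ν θ).lossL1) (cubeVertex hτ s))
      _ = _ := by simp
  -- flipping the sign of coordinate `i` is an involution of the cube, so averaging pairs each vertex
  -- with its neighbor
  have hflip : ∀ i : Fin d, (2 ^ d : ℕ) * 2⁻¹ ≤
      2 * ∑ s : Fin d → Bool, ∫⁻ h, φ i (s i) h ∂(μ s) := by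
    intro i
    have hinv : ∑ s : Fin d → Bool,
        ∫⁻ h, φ i (!(s i)) h ∂(μ (Function.update s i (!(s i)))) =
        ∑ s : Fin d → Bool, ∫⁻ h, φ i (s i) h ∂(μ s) := by
      refine Finset.sum_bij' (fun s _ => Function.update s i (!(s i)))
        (fun s _ => Function.update s i (!(s i))) ?_ ?_ ?_ ?_ ?_ <;> simp
    calc ((2 ^ d : ℕ) : ℝ≥0∞) * 2⁻¹ = ∑ _s : Fin d → Bool, (2⁻¹ : ℝ≥0∞) := by simp
      _ ≤ ∑ s : Fin d → Bool, (∫⁻ h, φ i (s i) h ∂(μ s) +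
          ∫⁻ h, φ i (!(s i)) h ∂(μ (Function.update s i (!(s i))))) :=
          Finset.sum_le_sum (fun s _ => hpair s i)
      _ = _ := by rw [Finset.sum_add_distrib, hinv, two_mul]
  have hfinal : ENNReal.ofReal (2 * τ / d) * (d * ((2 ^ d : ℕ) * 2⁻¹)) ≤ 2 * ((2 ^ d : ℕ) * R) := by
    calc ENNReal.ofReal (2 * τ / d) * (d * ((2 ^ d : ℕ) * 2⁻¹))
        = ENNReal.ofReal (2 * τ / d) * ∑ _i : Fin d, ((2 ^ d : ℕ) : ℝ≥0∞) * 2⁻¹ := by simp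
      _ ≤ ENNReal.ofReal (2 * τ / d) *
          ∑ i : Fin d, 2 * ∑ s : Fin d → Bool, ∫⁻ h, φ i (s i) h ∂(μ s) :=
          mul_le_mul_right (Finset.sum_le_sum (fun i _ => hflip i)) _
      _ = 2 * ∑ s : Fin d → Bool,
          (∑ i, ENNReal.ofReal (2 * τ / d) * ∫⁻ h, φ i (s i) h ∂(μ s)) := by
          simp_rw [← Finset.mul_sum]
          rw [Finset.sum_comm]
          ring
      _ ≤ _ := by gcongr
  have h2d : ((2 ^ d : ℕ) : ℝ≥0∞) * 2 ≠ 0 := by simp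
  have h2d' : ((2 ^ d : ℕ) : ℝ≥0∞) * 2 ≠ ⊤ := by finiteness
  refine (ENNReal.mul_le_mul_iff_right h2d h2d').mp ?_
  refine le_trans (le_of_eq ?_) (hfinal.trans (le_of_eq (by ring)))
  have e1 : (2⁻¹ : ℝ≥0∞) = ENNReal.ofReal (1 / 2) := by
    rw [one_div, ENNReal.ofReal_inv_of_pos (by norm_num)]; simp
  have e2 : (2 : ℝ≥0∞) = ENNReal.ofReal 2 := by simp
  rw [e1, e2, ← ENNReal.ofReal_natCast, ← ENNReal.ofReal_natCast,
    ← ENNReal.ofReal_mul (by positivity), ← ENNReal.ofReal_mul (by positivity),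
    ← ENNReal.ofReal_mul (by positivity), ← ENNReal.ofReal_mul (by positivity),
    ← ENNReal.ofReal_mul (by positivity)]
  congr 1
  field_simp

/-- The minimax lower bound: the covariates are uniform on the standard basis. The cube has half-width
`τ = c' min (d / (α √T)) (1 / √d)`, which keeps it inside the ball and makes the per-round factor
`1 + β²` with `β ≤ 1 / (2 √T)`. -/
theorem exists_minimax_lower_bound {α₀ : ℝ} (hα₀ : 0 < α₀) : ∃ c : ℝ, 0 < c ∧
    ∀ d : ℕ, 1 ≤ d → ∃ ν : ProbabilityMeasure (Metric.closedBall (0 : EuclideanSpace ℝ (Fin d)) 1),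
      ∀ (α : ℝ), 0 < α → α ≤ α₀ → ∀ T : ℕ, 1 ≤ T → ∀ (O : Type) [MeasurableSpace O]
        (A : Algorithm α (Metric.closedBall (0 : EuclideanSpace ℝ (Fin d)) 1 × Bool) O
          (Ball d) T),
        ENNReal.ofReal (c * min (d / (α * Real.sqrt T)) (1 / Real.sqrt d)) ≤
          ⨆ θ : Ball d, A.risk ((LinModel.mk ν θ).law subset_rfl)
            (LinModel.lossL1 (LinModel.mk ν θ)) := by
  set c' : ℝ := Real.exp (-(2 * α₀)) / 2 with hc'
  have hc0 : 0 < c' := by positivity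
  have hc1 : c' ≤ 1 := by
    have : Real.exp (-(2 * α₀)) ≤ 1 := Real.exp_le_one_iff.mpr (by linarith)
    linarith
  refine ⟨c' / 2, by positivity, fun d hd => ?_⟩
  have := isProbabilityMeasure_basisMeasure hd
  refine ⟨⟨basisMeasure d, this⟩, fun α hα hαα T hT O _ A => ?_⟩
  have hd' : (0 : ℝ) < d := by positivity
  have hT' : (0 : ℝ) < T := by positivity
  set m := min (d / (α * Real.sqrt T)) (1 / Real.sqrt d) with hm
  have hm0 : 0 < m := by
    have : 0 < Real.sqrt T := Real.sqrt_pos.mpr hT'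
    have : 0 < Real.sqrt d := Real.sqrt_pos.mpr hd'
    exact lt_min (by positivity) (by positivity)
  have hm1 : m ≤ 1 / Real.sqrt d := min_le_right _ _
  have hm2 : m ≤ d / (α * Real.sqrt T) := min_le_left _ _
  have hτ : d * (c' * m) ^ 2 ≤ 1 := by
    have h1 : (c' * m) ≤ 1 / Real.sqrt d :=
      (mul_le_of_le_one_left hm0.le hc1).trans hm1
    calc d * (c' * m) ^ 2 ≤ d * (1 / Real.sqrt d) ^ 2 := by gcongr
      _ = 1 := by rw [div_pow, Real.sq_sqrt hd'.le, one_pow]; field_simp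
  have hβ : c' * m / d * (Real.exp α - 1) * Real.exp α ≤ 1 / (2 * Real.sqrt T) := by
    have hsT : 0 < Real.sqrt T := Real.sqrt_pos.mpr hT'
    have h1 : Real.exp α - 1 ≤ α * Real.exp α := by
      have h := Real.add_one_le_exp (-α)
      have h2 : Real.exp α * Real.exp (-α) = 1 := by rw [← Real.exp_add]; simp
      nlinarith [Real.exp_pos α]
    have h2 : Real.exp α * Real.exp α ≤ Real.exp (2 * α₀) := by
      rw [← Real.exp_add]; exact Real.exp_le_exp.mpr (by linarith)
    have h3 : Real.exp (-(2 * α₀)) * Real.exp (2 * α₀) = 1 := by rw [← Real.exp_add]; simp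
    have h4 : 0 ≤ Real.exp α - 1 := by linarith [Real.add_one_le_exp α]
    calc c' * m / d * (Real.exp α - 1) * Real.exp α
        ≤ c' * (d / (α * Real.sqrt T)) / d * (α * Real.exp α) * Real.exp α := by gcongr
      _ = c' * (Real.exp α * Real.exp α) / Real.sqrt T := by field_simp
      _ ≤ c' * Real.exp (2 * α₀) / Real.sqrt T := by gcongr
      _ = 1 / (2 * Real.sqrt T) := by
        rw [hc', div_mul_eq_mul_div, h3]; field_simp
  have hpow : (1 + (1 / (2 * Real.sqrt T)) ^ 2) ^ T ≤ 2 := by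
    have h1 : (1 / (2 * Real.sqrt T)) ^ 2 = 1 / (4 * T) := by
      rw [div_pow, mul_pow, Real.sq_sqrt hT'.le]; norm_num
    have h2 : 1 + 1 / (4 * (T : ℝ)) ≤ Real.exp (1 / (4 * T)) := by
      linarith [Real.add_one_le_exp (1 / (4 * (T : ℝ)))]
    rw [h1]
    calc (1 + 1 / (4 * (T : ℝ))) ^ T ≤ Real.exp (1 / (4 * T)) ^ T := by gcongr
      _ = Real.exp (1 / 4) := by rw [← Real.exp_nat_mul]; congr 1; field_simp
      _ ≤ Real.exp (Real.log 2) := Real.exp_le_exp.mpr (by linarith [Real.log_two_gt_d9])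
      _ = 2 := Real.exp_log (by norm_num)
  have h := half_le_iSup_risk hd ⟨basisMeasure d, this⟩ rfl (by positivity) hτ hα.le hβ hpow A
  rwa [show c' * m / 2 = c' / 2 * m by ring] at h

end LowerBound

/-! ### Random sign queries -/

/-- The sign of a real number, with `sgn 0 = 1`. -/
noncomputable def sgn (t : ℝ) : ℝ := if 0 ≤ t then 1 else -1

theorem measurable_sgn : Measurable sgn :=
  Measurable.ite measurableSet_Ici measurable_const measurable_const

theorem abs_sgn (t : ℝ) : |sgn t| = 1 := by
  unfold sgn; split_ifs <;> simp

theorem sgn_mul_self (t : ℝ) : sgn t * t = |t| := by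
  unfold sgn; split_ifs with h
  · rw [one_mul, abs_of_nonneg h]
  · rw [abs_of_neg (not_le.mp h)]; ring

/-- The first absolute moment of the standard normal distribution. -/
noncomputable def absGauss : ℝ := ∫ t, |t| ∂(gaussianReal 0 1)

theorem absGauss_pos : 0 < absGauss := by
  have hi : Integrable (fun t : ℝ => |t|) (gaussianReal 0 1) :=
    (memLp_id_gaussianReal 1).integrable le_rfl |>.abs
  refine (integral_pos_iff_support_of_nonneg (fun t => abs_nonneg t) hi).mpr ?_
  have hs : Function.support (fun t : ℝ => |t|) = {0}ᶜ := by
    ext t; simp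
  rw [hs]
  have := nullSingletonClass_gaussianReal (μ := 0) (v := 1) one_ne_zero
  rw [prob_compl_eq_one_sub (measurableSet_singleton 0), measure_singleton]
  simp

theorem absGauss_le_one : absGauss ≤ 1 := by
  have hi : Integrable (fun t : ℝ => |t|) (gaussianReal 0 1) :=
    (memLp_id_gaussianReal 1).integrable le_rfl |>.abs
  have h2 : Integrable (fun t : ℝ => t ^ 2) (gaussianReal 0 1) :=
    (memLp_id_gaussianReal 2).integrable_sq
  have hv : ∫ t, t ^ 2 ∂(gaussianReal 0 1) = 1 := by
    have h := variance_id_gaussianReal (μ := 0) (v := 1)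
    rw [variance_of_integral_eq_zero aemeasurable_id (by simp)] at h
    simpa using h
  have h3 : absGauss ≤ ∫ t, (1 + t ^ 2) / 2 ∂(gaussianReal 0 1) := by
    refine integral_mono hi (((integrable_const 1).add h2).div_const 2) (fun t => ?_)
    simp only
    nlinarith [sq_nonneg (|t| - 1), sq_abs t]
  rw [integral_div, integral_add (integrable_const 1) h2, hv] at h3
  simp at h3
  linarith

section Gaussian

variable {E : Type*} [NormedAddCommGroup E] [InnerProductSpace ℝ E] [FiniteDimensional ℝ E]
  [MeasurableSpace E] [BorelSpace E]

theorem map_inner_stdGaussian {w : E} (hw : ‖w‖ = 1) :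
    (stdGaussian E).map (fun v => inner ℝ w v) = gaussianReal 0 1 := by
  have h := IsGaussian.map_eq_gaussianReal (μ := stdGaussian E) (innerSL ℝ w)
  rw [integral_strongDual_stdGaussian, variance_dual_stdGaussian, innerSL_apply_norm, hw] at h
  simpa using h

theorem integrable_inner_stdGaussian (w : E) :
    Integrable (fun v => inner ℝ w v) (stdGaussian E) :=
  (innerSL ℝ w).integrable_comp IsGaussian.integrable_id

theorem integral_inner_stdGaussian (w : E) : ∫ v, inner ℝ w v ∂(stdGaussian E) = 0 :=
  integral_strongDual_stdGaussian (innerSL ℝ w)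

theorem integral_inner_sq_stdGaussian (w : E) :
    ∫ v, (inner ℝ w v) ^ 2 ∂(stdGaussian E) = ‖w‖ ^ 2 := by
  have h := variance_dual_stdGaussian (innerSL ℝ w : StrongDual ℝ E)
  rw [variance_of_integral_eq_zero (by fun_prop) (integral_strongDual_stdGaussian _),
    innerSL_apply_norm] at h
  simpa using h

theorem integrable_inner_sq_stdGaussian (w : E) :
    Integrable (fun v => (inner ℝ w v) ^ 2) (stdGaussian E) := by
  have h := IsGaussian.memLp_dual (stdGaussian E) (innerSL ℝ w) 2 (by simp)
  exact h.integrable_sq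

theorem integrable_sgn_mul_inner_stdGaussian (w e : E) :
    Integrable (fun v => sgn (inner ℝ w v) * inner ℝ e v) (stdGaussian E) := by
  refine (integrable_inner_stdGaussian e).bdd_mul (c := 1) ?_
    (Filter.Eventually.of_forall (fun v => by rw [Real.norm_eq_abs, abs_sgn]))
  exact (measurable_sgn.comp (by fun_prop)).aestronglyMeasurable

/-- The sign of a Gaussian projection onto `w` is correlated with the projection onto `e` exactly
as `w` is with `e`. -/
theorem integral_sgn_mul_inner_stdGaussian {w : E} (hw : ‖w‖ = 1) (e : E) :
    ∫ v, sgn (inner ℝ w v) * inner ℝ e v ∂(stdGaussian E) = absGauss * inner ℝ w e := by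
  have hpar : ∫ v, sgn (inner ℝ w v) * inner ℝ w v ∂(stdGaussian E) = absGauss := by
    simp_rw [sgn_mul_self]
    rw [absGauss, ← map_inner_stdGaussian hw, integral_map (by fun_prop) (by fun_prop)]
  -- the reflection in the line of `w` preserves the Gaussian and negates the orthogonal part
  set ρ := (Submodule.span ℝ {w}).reflection with hρ
  have hρw : ρ w = w :=
    Submodule.reflection_mem_subspace_eq_self (Submodule.mem_span_singleton_self w)
  set f : E := e - (inner ℝ w e : ℝ) • w with hf
  have hwf : inner ℝ w f = 0 := by
    rw [hf, inner_sub_right, inner_smul_right, real_inner_self_eq_norm_sq, hw]; ring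
  have hρf : ρ f = -f := by
    refine Submodule.reflection_mem_subspace_orthogonalComplement_eq_neg ?_
    rw [Submodule.mem_orthogonal_singleton_iff_inner_right]
    exact hwf
  have hadj : ∀ u v : E, inner ℝ u (ρ v) = inner ℝ (ρ u) v := fun u v => by
    rw [← ρ.inner_map_map u (ρ v), hρ, Submodule.reflection_reflection]
  have horth : ∫ v, sgn (inner ℝ w v) * inner ℝ f v ∂(stdGaussian E) = 0 := by
    have h : ∫ v, sgn (inner ℝ w v) * inner ℝ f v ∂(stdGaussian E) =
        ∫ v, sgn (inner ℝ w (ρ v)) * inner ℝ f (ρ v) ∂(stdGaussian E) := by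
      conv_lhs => rw [← stdGaussian_map ρ]
      rw [integral_map ρ.continuous.aemeasurable]
      exact ((measurable_sgn.comp (by fun_prop)).mul (by fun_prop)).aestronglyMeasurable
    simp_rw [hadj, hρw, hρf, inner_neg_left, mul_neg] at h
    rw [integral_neg] at h
    linarith
  have hsplit : ∀ v, sgn (inner ℝ w v) * inner ℝ e v =
      sgn (inner ℝ w v) * inner ℝ f v + inner ℝ w e * (sgn (inner ℝ w v) * inner ℝ w v) := by
    intro v
    rw [hf, inner_sub_left, real_inner_smul_left]; ring
  simp_rw [hsplit]
  rw [integral_add (integrable_sgn_mul_inner_stdGaussian w f)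
    ((integrable_sgn_mul_inner_stdGaussian w w).const_mul _), integral_const_mul, hpar, horth]
  ring

end Gaussian

/-- Cauchy–Schwarz for averaged queries: if random queries `ℓ_v` cannot tell `P` from `Q` in mean
square, then neither can their averages `∫ τ(v) ℓ_v dm(v)` against square-integrable weights. -/
theorem abs_integral_average_sub_le {V Z : Type*} [MeasurableSpace V] [MeasurableSpace Z]
    (m : Measure V) [IsProbabilityMeasure m] (P Q : Measure Z) [IsProbabilityMeasure P]
    [IsProbabilityMeasure Q] {f : V → Z → ℝ} (hf : Measurable (Function.uncurry f))
    {C : ℝ} (hC : ∀ v z, |f v z| ≤ C) {τ : V → ℝ} (hτ : Integrable τ m)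
    (hτ2 : Integrable (fun v => τ v ^ 2) m) {b η : ℝ} (hb : 0 ≤ b) (hη : 0 ≤ η)
    (hτb : ∫ v, τ v ^ 2 ∂m ≤ b ^ 2)
    (hD : ∫ v, (∫ z, f v z ∂P - ∫ z, f v z ∂Q) ^ 2 ∂m ≤ η ^ 2) :
    |∫ z, (∫ v, τ v * f v z ∂m) ∂P - ∫ z, (∫ v, τ v * f v z ∂m) ∂Q| ≤ b * η := by
  set F : V → ℝ := fun v => ∫ z, f v z ∂P - ∫ z, f v z ∂Q with hF
  have hmeas : ∀ ν : Measure Z, [IsProbabilityMeasure ν] → Measurable (fun v => ∫ z, f v z ∂ν) :=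
    fun ν _ => (hf.stronglyMeasurable.integral_prod_right).measurable
  have hbd : ∀ ν : Measure Z, [IsProbabilityMeasure ν] →
      ∀ v, abs (∫ z, f v z ∂ν) ≤ C := fun ν _ v => by
    have := norm_integral_le_of_norm_le_const (μ := ν) (f := f v) (C := C)
      (Filter.Eventually.of_forall (hC v))
    simpa using this
  have hFm : Measurable F := (hmeas P).sub (hmeas Q)
  have hFb : ∀ v, |F v| ≤ 2 * C := fun v => by
    have h1 := abs_sub (∫ z, f v z ∂P) (∫ z, f v z ∂Q)
    have := hbd P v; have := hbd Q v
    linarith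
  have hswap : ∀ ν : Measure Z, [IsProbabilityMeasure ν] →
      ∫ z, (∫ v, τ v * f v z ∂m) ∂ν = ∫ v, τ v * (∫ z, f v z ∂ν) ∂m := by
    intro ν _
    rw [integral_integral_swap]
    · refine integral_congr_ae (Filter.Eventually.of_forall (fun v => ?_))
      exact integral_const_mul _ _
    · refine (hτ.comp_snd ν).mul_bdd (c := C) ?_ (Filter.Eventually.of_forall (fun x => hC _ _))
      exact (hf.comp measurable_swap).aestronglyMeasurable
  have hi : ∀ ν : Measure Z, [IsProbabilityMeasure ν] →
      Integrable (fun v => τ v * ∫ z, f v z ∂ν) m := fun ν _ =>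
    hτ.mul_bdd (c := C) (hmeas ν).aestronglyMeasurable (Filter.Eventually.of_forall (hbd ν))
  rw [hswap P, hswap Q, ← integral_sub (hi P) (hi Q)]
  simp_rw [← mul_sub]
  have hτF : Integrable (fun v => τ v * F v) m :=
    hτ.mul_bdd (c := 2 * C) hFm.aestronglyMeasurable (Filter.Eventually.of_forall hFb)
  have hF2 : Integrable (fun v => F v ^ 2) m :=
    integrable_of_bounded (hFm.pow_const 2) (C := (2 * C) ^ 2) (fun v => by
      rw [abs_pow]; exact pow_le_pow_left₀ (abs_nonneg _) (hFb v) 2)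
  set x := ∫ v, τ v * F v ∂m with hx
  -- the quadratic form `∫ (s τ - r F)²` is nonnegative for all `s, r`
  have hquad : ∀ s r : ℝ, 2 * (s * r) * x ≤ s ^ 2 * b ^ 2 + r ^ 2 * η ^ 2 := by
    intro s r
    have hnn : 0 ≤ ∫ v, (s * τ v - r * F v) ^ 2 ∂m := integral_nonneg (fun _ => sq_nonneg _)
    have hex : ∀ v, (s * τ v - r * F v) ^ 2 =
        s ^ 2 * τ v ^ 2 + r ^ 2 * F v ^ 2 - 2 * (s * r) * (τ v * F v) := fun v => by ring
    simp_rw [hex] at hnn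
    have i1 : Integrable (fun v => s ^ 2 * τ v ^ 2) m := hτ2.const_mul _
    have i2 : Integrable (fun v => r ^ 2 * F v ^ 2) m := hF2.const_mul _
    have i3 : Integrable (fun v => 2 * (s * r) * (τ v * F v)) m := hτF.const_mul _
    have i4 : Integrable (fun v => s ^ 2 * τ v ^ 2 + r ^ 2 * F v ^ 2) m := i1.add i2
    rw [integral_sub i4 i3, integral_add i1 i2, integral_const_mul, integral_const_mul,
      integral_const_mul] at hnn
    have h1 : s ^ 2 * ∫ v, τ v ^ 2 ∂m ≤ s ^ 2 * b ^ 2 := by gcongr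
    have h2 : r ^ 2 * ∫ v, F v ^ 2 ∂m ≤ r ^ 2 * η ^ 2 := by gcongr
    linarith
  have hle : ∀ y : ℝ, (∀ s r : ℝ, 2 * (s * r) * y ≤ s ^ 2 * b ^ 2 + r ^ 2 * η ^ 2) → y ≤ b * η := by
    intro y hy
    by_contra hlt
    push Not at hlt
    have hbη : 0 ≤ b * η := mul_nonneg hb hη
    rcases hb.eq_or_lt with h0 | h0
    · subst h0
      have := hy ((η ^ 2 + 1) / y) 1
      have hy0 : 0 < y := by linarith
      rw [mul_one, mul_assoc, div_mul_cancel₀ _ hy0.ne'] at this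
      nlinarith [sq_nonneg η]
    · rcases hη.eq_or_lt with h1 | h1
      · subst h1
        have := hy 1 ((b ^ 2 + 1) / y)
        have hy0 : 0 < y := by linarith
        rw [one_mul, mul_assoc, div_mul_cancel₀ _ hy0.ne'] at this
        nlinarith [sq_nonneg b]
      · have := hy η b
        nlinarith [mul_pos h0 h1]
  refine abs_le.mpr ⟨?_, hle x hquad⟩
  have := hle (-x) (fun s r => by have := hquad (-s) r; nlinarith)
  linarith

/-! ### A linear change of coordinates that balances the covariates -/

section Design

variable {d : ℕ} {Ω : Type*} [MeasurableSpace Ω]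

/-- The objective `2 E‖A x‖ + λ² ∑ᵢ ‖A eᵢ‖² - 2 log |det A|`, whose near-minimizers are the balancing
changes of coordinates. -/
noncomputable def designObj (P : Measure Ω) (x : Ω → EuclideanSpace ℝ (Fin d)) (lam : ℝ)
    (A : EuclideanSpace ℝ (Fin d) →ₗ[ℝ] EuclideanSpace ℝ (Fin d)) : ℝ :=
  2 * ∫ ω, ‖A (x ω)‖ ∂P + lam ^ 2 * ∑ i, ‖A (EuclideanSpace.basisFun (Fin d) ℝ i)‖ ^ 2 -
    2 * Real.log (LinearMap.det A)

theorem measurable_linearMap_comp {x : Ω → EuclideanSpace ℝ (Fin d)} (hx : Measurable x)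
    (A : EuclideanSpace ℝ (Fin d) →ₗ[ℝ] EuclideanSpace ℝ (Fin d)) :
    Measurable (fun ω => A (x ω)) :=
  (A.continuous_of_finiteDimensional.measurable).comp hx

theorem exists_norm_linearMap_le {Ω : Type*} {x : Ω → EuclideanSpace ℝ (Fin d)} (hx1 : ∀ ω, ‖x ω‖ ≤ 1)
    (A : EuclideanSpace ℝ (Fin d) →ₗ[ℝ] EuclideanSpace ℝ (Fin d)) : ∃ C, ∀ ω, ‖A (x ω)‖ ≤ C := by
  refine ⟨‖LinearMap.toContinuousLinearMap A‖, fun ω => ?_⟩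
  have h := (LinearMap.toContinuousLinearMap A).le_opNorm (x ω)
  simp only [LinearMap.coe_toContinuousLinearMap'] at h
  exact h.trans (mul_le_of_le_one_right (norm_nonneg _) (hx1 ω))

theorem integrable_norm_linearMap (P : Measure Ω) [IsProbabilityMeasure P]
    {x : Ω → EuclideanSpace ℝ (Fin d)} (hx : Measurable x) (hx1 : ∀ ω, ‖x ω‖ ≤ 1)
    (A : EuclideanSpace ℝ (Fin d) →ₗ[ℝ] EuclideanSpace ℝ (Fin d)) :
    Integrable (fun ω => ‖A (x ω)‖) P := by
  obtain ⟨C, hC⟩ := exists_norm_linearMap_le hx1 A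
  exact integrable_of_bounded (measurable_linearMap_comp hx A).norm (C := C)
    (fun ω => by rw [abs_norm]; exact hC ω)

theorem inner_sq_div_norm_le {E : Type*} [NormedAddCommGroup E] [InnerProductSpace ℝ E] (u w : E) :
    (inner ℝ u w) ^ 2 / ‖w‖ ≤ ‖u‖ ^ 2 * ‖w‖ := by
  rcases (norm_nonneg w).eq_or_lt with h | h
  · simp [← h]
  · rw [div_le_iff₀ h]
    have := abs_real_inner_le_norm u w
    calc (inner ℝ u w) ^ 2 = |inner ℝ u w| ^ 2 := (sq_abs _).symm
      _ ≤ (‖u‖ * ‖w‖) ^ 2 := by gcongr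
      _ = _ := by ring

theorem integrable_inner_sq_div_norm (P : Measure Ω) [IsProbabilityMeasure P]
    {x : Ω → EuclideanSpace ℝ (Fin d)} (hx : Measurable x) (hx1 : ∀ ω, ‖x ω‖ ≤ 1)
    (A : EuclideanSpace ℝ (Fin d) →ₗ[ℝ] EuclideanSpace ℝ (Fin d))
    (u : EuclideanSpace ℝ (Fin d)) :
    Integrable (fun ω => (inner ℝ u (A (x ω))) ^ 2 / ‖A (x ω)‖) P := by
  obtain ⟨C, hC⟩ := exists_norm_linearMap_le hx1 A
  have hm := measurable_linearMap_comp hx A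
  refine integrable_of_bounded (((Measurable.const_inner hm).pow_const 2).div hm.norm)
    (C := ‖u‖ ^ 2 * C) (fun ω => ?_)
  rw [abs_of_nonneg (by positivity)]
  exact (inner_sq_div_norm_le _ _).trans (by gcongr; exact hC ω)

/-- The determinant is controlled by the Hilbert–Schmidt norm, so the objective is bounded below. -/
theorem bddBelow_designObj (hd : 1 ≤ d) (P : Measure Ω) (x : Ω → EuclideanSpace ℝ (Fin d))
    {lam : ℝ} (hlam : 0 < lam) :
    BddBelow (designObj P x lam '' {A | LinearMap.det A ≠ 0}) := by
  have hd' : (0 : ℝ) < d := by positivity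
  refine ⟨-(2 * Real.log (d.factorial) + d * (Real.log (d / lam ^ 2) - 1)), ?_⟩
  rintro _ ⟨A, hA, rfl⟩
  set b := EuclideanSpace.basisFun (Fin d) ℝ
  set r := ∑ i, ‖A (b i)‖ ^ 2 with hr
  have hr0 : 0 ≤ r := Finset.sum_nonneg (fun _ _ => by positivity)
  have hent : ∀ i j, |LinearMap.toMatrix b.toBasis b.toBasis A i j| ≤ Real.sqrt r := by
    intro i j
    rw [LinearMap.toMatrix_apply]
    simp only [OrthonormalBasis.coe_toBasis, OrthonormalBasis.coe_toBasis_repr_apply]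
    rw [b.repr_apply_apply]
    refine (abs_real_inner_le_norm _ _).trans ?_
    rw [b.norm_eq_one, one_mul]
    refine Real.le_sqrt_of_sq_le ?_
    exact Finset.single_le_sum (f := fun i => ‖A (b i)‖ ^ 2) (fun _ _ => by positivity)
      (Finset.mem_univ j)
  have hdet : |LinearMap.det A| ≤ d.factorial * Real.sqrt r ^ d := by
    have h := Matrix.det_le (abv := AbsoluteValue.abs) (A := LinearMap.toMatrix b.toBasis b.toBasis A)
      (x := Real.sqrt r) hent
    rw [LinearMap.det_toMatrix] at h
    simpa using h
  have hr1 : 0 < Real.sqrt r := by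
    rcases (Real.sqrt_nonneg r).eq_or_lt with h | h
    · rw [← h, zero_pow (by omega), mul_zero] at hdet
      exact absurd (abs_nonpos_iff.mp hdet) hA
    · exact h
  have hrpos : 0 < r := Real.sqrt_pos.mp hr1
  have hlog : Real.log (LinearMap.det A) ≤ Real.log d.factorial + d * (Real.log r / 2) := by
    rw [← Real.log_abs]
    refine (Real.log_le_log (abs_pos.mpr hA) hdet).trans ?_
    rw [Real.log_mul (by positivity) (by positivity), Real.log_pow, Real.log_sqrt hr0]
  have hlr : Real.log r ≤ lam ^ 2 * r / d - 1 + Real.log (d / lam ^ 2) := by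
    have h := Real.log_le_sub_one_of_pos (show 0 < lam ^ 2 * r / d by positivity)
    have h2 : Real.log r = Real.log (lam ^ 2 * r / d) + Real.log (d / lam ^ 2) := by
      rw [← Real.log_mul (by positivity) (by positivity)]
      congr 1; field_simp
    linarith
  have hlr' : d * Real.log r ≤ lam ^ 2 * r + d * (Real.log (d / lam ^ 2) - 1) := by
    have := mul_le_mul_of_nonneg_left hlr hd'.le
    have e : (d : ℝ) * (lam ^ 2 * r / d - 1 + Real.log (d / lam ^ 2)) =
      lam ^ 2 * r + d * (Real.log (d / lam ^ 2) - 1) := by field_simp; ring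
    linarith
  have hint : 0 ≤ ∫ ω, ‖A (x ω)‖ ∂P := integral_nonneg (fun _ => norm_nonneg _)
  unfold designObj
  linarith

/-- First-order effect on a norm of stretching the direction `u` by the factor `1 + t`. -/
theorem norm_add_smul_le {E : Type*} [NormedAddCommGroup E] [InnerProductSpace ℝ E] {u : E}
    (hu : ‖u‖ = 1) (w : E) (t : ℝ) :
    2 * ‖w + (t * inner ℝ u w) • u‖ ≤
      2 * ‖w‖ + ((1 + t) ^ 2 - 1) * ((inner ℝ u w) ^ 2 / ‖w‖) := by
  have hsq : ‖w + (t * inner ℝ u w) • u‖ ^ 2 = ‖w‖ ^ 2 + ((1 + t) ^ 2 - 1) * (inner ℝ u w) ^ 2 := by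
    rw [norm_add_sq_real, norm_smul, hu, inner_smul_right, real_inner_comm, mul_one,
      Real.norm_eq_abs, sq_abs]
    ring
  rcases (norm_nonneg w).eq_or_lt with h | h
  · have : w = 0 := norm_eq_zero.mp h.symm
    simp [this]
  · have e : ((1 + t) ^ 2 - 1) * ((inner ℝ u w) ^ 2 / ‖w‖) =
      (‖w + (t * inner ℝ u w) • u‖ ^ 2 - ‖w‖ ^ 2) / ‖w‖ := by rw [hsq]; ring
    rw [e, ← sub_nonneg]
    have : 2 * ‖w‖ + (‖w + (t * inner ℝ u w) • u‖ ^ 2 - ‖w‖ ^ 2) / ‖w‖ -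
        2 * ‖w + (t * inner ℝ u w) • u‖ = (‖w + (t * inner ℝ u w) • u‖ - ‖w‖) ^ 2 / ‖w‖ := by
      field_simp; ring
    rw [this]; positivity

theorem norm_add_smul_sq {E : Type*} [NormedAddCommGroup E] [InnerProductSpace ℝ E] {u : E}
    (hu : ‖u‖ = 1) (w : E) (t : ℝ) :
    ‖w + (t * inner ℝ u w) • u‖ ^ 2 = ‖w‖ ^ 2 + ((1 + t) ^ 2 - 1) * (inner ℝ u w) ^ 2 := by
  rw [norm_add_sq_real, norm_smul, hu, inner_smul_right, real_inner_comm, mul_one,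
    Real.norm_eq_abs, sq_abs]
  ring

/-- Every distribution of bounded covariates admits a change of coordinates `A` in which the second
moments weighted by `1 / ‖A x‖`, regularized by `λ² A Aᵀ`, are comparable to the identity. An exact
minimizer of `designObj` would make their sum equal to the identity; a near-minimizer, tested against
finite stretches of single directions, makes it so up to constants and exists without compactness. -/
theorem exists_design (hd : 1 ≤ d) (P : Measure Ω) [IsProbabilityMeasure P]
    {x : Ω → EuclideanSpace ℝ (Fin d)} (hx : Measurable x) (hx1 : ∀ ω, ‖x ω‖ ≤ 1)
    {lam : ℝ} (hlam : 0 < lam) :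
    ∃ A : EuclideanSpace ℝ (Fin d) →ₗ[ℝ] EuclideanSpace ℝ (Fin d), LinearMap.det A ≠ 0 ∧
      ∀ e, 2 / 5 * ‖e‖ ^ 2 ≤ ∫ ω, (inner ℝ e (A (x ω))) ^ 2 / ‖A (x ω)‖ ∂P +
          lam ^ 2 * ∑ i, (inner ℝ e (A (EuclideanSpace.basisFun (Fin d) ℝ i))) ^ 2 ∧
        ∫ ω, (inner ℝ e (A (x ω))) ^ 2 / ‖A (x ω)‖ ∂P +
          lam ^ 2 * ∑ i, (inner ℝ e (A (EuclideanSpace.basisFun (Fin d) ℝ i))) ^ 2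
            ≤ 2 * ‖e‖ ^ 2 := by
  have hne : (designObj P x lam '' {A | LinearMap.det A ≠ 0}).Nonempty :=
    ⟨_, LinearMap.id, by simp, rfl⟩
  obtain ⟨_, ⟨A, hA, rfl⟩, hlt⟩ := Real.lt_sInf_add_pos hne (ε := 1 / 10) (by norm_num)
  have hmin : ∀ B : EuclideanSpace ℝ (Fin d) →ₗ[ℝ] EuclideanSpace ℝ (Fin d),
      LinearMap.det B ≠ 0 → designObj P x lam A ≤ designObj P x lam B + 1 / 10 := fun B hB => by
    have := csInf_le (bddBelow_designObj hd P x hlam) ⟨B, hB, rfl⟩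
    linarith
  refine ⟨A, hA, ?_⟩
  set a : EuclideanSpace ℝ (Fin d) → ℝ := fun u =>
    ∫ ω, (inner ℝ u (A (x ω))) ^ 2 / ‖A (x ω)‖ ∂P +
      lam ^ 2 * ∑ i, (inner ℝ u (A (EuclideanSpace.basisFun (Fin d) ℝ i))) ^ 2 with ha
  -- comparison of `A` with `A` stretched by `1 + t` in the direction `u`
  have hstretch : ∀ u : EuclideanSpace ℝ (Fin d), ‖u‖ = 1 → ∀ t : ℝ, -1 < t →
      2 * Real.log (1 + t) ≤ ((1 + t) ^ 2 - 1) * a u + 1 / 10 := by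
    intro u hu t ht
    set B := (LinearMap.transvection (t • (innerₗ _ u)) u).comp A with hB
    have hBx : ∀ z, B z = A z + (t * inner ℝ u (A z)) • u := fun z => by
      simp [hB, LinearMap.transvection.apply]
    have hdet : LinearMap.det B = (1 + t) * LinearMap.det A := by
      rw [hB, LinearMap.det_comp, LinearMap.transvection.det]
      simp [hu]
    have h1t : 1 + t ≠ 0 := by linarith
    have h := hmin B (by rw [hdet]; exact mul_ne_zero h1t hA)
    have hB2 : ∑ i, ‖B (EuclideanSpace.basisFun (Fin d) ℝ i)‖ ^ 2 =
        ∑ i, ‖A (EuclideanSpace.basisFun (Fin d) ℝ i)‖ ^ 2 + ((1 + t) ^ 2 - 1) *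
          ∑ i, (inner ℝ u (A (EuclideanSpace.basisFun (Fin d) ℝ i))) ^ 2 := by
      rw [Finset.mul_sum, ← Finset.sum_add_distrib]
      exact Finset.sum_congr rfl (fun i _ => by rw [hBx, norm_add_smul_sq hu])
    have hB1 : 2 * ∫ ω, ‖B (x ω)‖ ∂P ≤ 2 * ∫ ω, ‖A (x ω)‖ ∂P + ((1 + t) ^ 2 - 1) *
        ∫ ω, (inner ℝ u (A (x ω))) ^ 2 / ‖A (x ω)‖ ∂P := by
      rw [← integral_const_mul, ← integral_const_mul, ← integral_const_mul,
        ← integral_add ((integrable_norm_linearMap P hx hx1 A).const_mul _)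
          ((integrable_inner_sq_div_norm P hx hx1 A u).const_mul _)]
      refine integral_mono ((integrable_norm_linearMap P hx hx1 B).const_mul _)
        (((integrable_norm_linearMap P hx hx1 A).const_mul _).add
          ((integrable_inner_sq_div_norm P hx hx1 A u).const_mul _)) (fun ω => ?_)
      simp only [hBx]
      exact norm_add_smul_le hu _ t
    unfold designObj at h
    rw [hdet, Real.log_mul h1t hA, hB2] at h
    simp only [ha]
    nlinarith
  -- `t = 1` gives `2 log 2 ≤ 3 a + 1 / 10`, and `t = -1 / 2` gives `3 a / 4 ≤ 2 log 2 + 1 / 10`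
  have hunit : ∀ u : EuclideanSpace ℝ (Fin d), ‖u‖ = 1 → 2 / 5 ≤ a u ∧ a u ≤ 2 := by
    intro u hu
    have h1 := hstretch u hu 1 (by norm_num)
    have h2 := hstretch u hu (-(1 / 2)) (by norm_num)
    have l2 := Real.log_two_gt_d9
    have l2' := Real.log_two_lt_d9
    have l3 : Real.log (1 / 2) = -Real.log 2 := by rw [one_div, Real.log_inv]
    norm_num at h1 h2 l3
    constructor <;> linarith
  intro e
  rcases eq_or_ne e 0 with rfl | he
  · simp
  have hen : 0 < ‖e‖ := norm_pos_iff.mpr he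
  set u := (‖e‖⁻¹ : ℝ) • e with hu
  have hu1 : ‖u‖ = 1 := by rw [hu, norm_smul, norm_inv, norm_norm, inv_mul_cancel₀ hen.ne']
  have heu : ∀ w, inner ℝ e w = ‖e‖ * inner ℝ u w := fun w => by
    rw [hu, real_inner_smul_left, ← mul_assoc, mul_inv_cancel₀ hen.ne', one_mul]
  have hscale : a e = ‖e‖ ^ 2 * a u := by
    simp only [ha]
    simp_rw [heu, mul_pow, mul_div_assoc]
    rw [integral_const_mul, ← Finset.mul_sum]
    ring
  have h := hunit u hu1
  show 2 / 5 * ‖e‖ ^ 2 ≤ a e ∧ a e ≤ 2 * ‖e‖ ^ 2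
  rw [hscale]
  constructor <;> nlinarith [sq_nonneg ‖e‖]

end Design

/-! ### Random queries -/

section Queries

variable {Z : Type} [MeasurableSpace Z]

theorem Query.abs_le_one (ℓ : Query Z) (z : Z) : |ℓ.toFun z| ≤ 1 :=
  abs_le.mpr ⟨by linarith [(ℓ.mem_unit z).1], (ℓ.mem_unit z).2⟩

theorem Query.integrable (ℓ : Query Z) (P : Measure Z) [IsFiniteMeasure P] :
    Integrable ℓ.toFun P := integrable_of_bounded ℓ.measurable_toFun ℓ.abs_le_one

theorem Query.abs_integral_le_one (ℓ : Query Z) (P : Measure Z) [IsProbabilityMeasure P] :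
    |∫ z, ℓ.toFun z ∂P| ≤ 1 := by
  have := norm_integral_le_of_norm_le_const (μ := P) (f := ℓ.toFun) (C := 1)
    (Filter.Eventually.of_forall ℓ.abs_le_one)
  simpa using this

theorem Query.measurable_integral (P : ProbabilityMeasure Z) :
    Measurable (fun ℓ : Query Z => ∫ z, ℓ.toFun z ∂(P : Measure Z)) := by
  refine Measurable.of_comap_le ?_
  rw [BorelSpace.measurable_eq (α := ℝ)]
  exact le_iSup (fun P : ProbabilityMeasure Z =>
    (borel ℝ).comap (fun ℓ : Query Z => ∫ z, ℓ.toFun z ∂(P : Measure Z))) P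

theorem measurable_queryDiv_sq (P Q : ProbabilityMeasure Z) :
    Measurable (fun ℓ : Query Z => queryDiv ℓ (P : Measure Z) (Q : Measure Z) ^ 2) :=
  (((Query.measurable_integral P).sub (Query.measurable_integral Q)).abs).pow_const 2

theorem queryDiv_sq_le (ℓ : Query Z) (P Q : Measure Z) [IsProbabilityMeasure P]
    [IsProbabilityMeasure Q] : queryDiv ℓ P Q ^ 2 ≤ 4 := by
  have h1 := abs_sub (∫ z, ℓ.toFun z ∂P) (∫ z, ℓ.toFun z ∂Q)
  have h2 := ℓ.abs_integral_le_one P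
  have h3 := ℓ.abs_integral_le_one Q
  have h4 : queryDiv ℓ P Q ≤ 2 := by unfold queryDiv; linarith
  have h5 : 0 ≤ queryDiv ℓ P Q := abs_nonneg _
  nlinarith

theorem integrable_queryDiv_sq (P Q : ProbabilityMeasure Z) (q : Measure (Query Z))
    [IsFiniteMeasure q] :
    Integrable (fun ℓ : Query Z => queryDiv ℓ (P : Measure Z) (Q : Measure Z) ^ 2) q :=
  integrable_of_bounded (measurable_queryDiv_sq P Q) (C := 4) (fun ℓ => by
    rw [abs_of_nonneg (sq_nonneg _)]; exact queryDiv_sq_le ℓ _ _)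

/-- A jointly measurable family of functions with values in `[0, 1]`, drawn at random, is a random
query. -/
theorem exists_randomQuery {V : Type*} [MeasurableSpace V] (m : Measure V) [IsProbabilityMeasure m]
    {f : V → Z → ℝ} (hf : Measurable (Function.uncurry f))
    (h01 : ∀ v z, f v z ∈ Set.Icc (0 : ℝ) 1) :
    ∃ q : Measure (Query Z), IsProbabilityMeasure q ∧ ∀ P Q : ProbabilityMeasure Z,
      ∫ ℓ, queryDiv ℓ (P : Measure Z) (Q : Measure Z) ^ 2 ∂q =
        ∫ v, (∫ z, f v z ∂(P : Measure Z) - ∫ z, f v z ∂(Q : Measure Z)) ^ 2 ∂m := by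
  set g : V → Query Z := fun v => ⟨f v, hf.of_uncurry_left, h01 v⟩ with hg
  have hgm : Measurable g := by
    refine measurable_iff_le_map.mpr (iSup_le (fun P => ?_))
    rw [MeasurableSpace.comap_le_iff_le_map, MeasurableSpace.map_comp]
    refine measurable_iff_le_map.mp ?_
    rw [← BorelSpace.measurable_eq (α := ℝ)]
    exact (hf.stronglyMeasurable.integral_prod_right (ν := (P : Measure Z))).measurable
  refine ⟨m.map g, Measure.isProbabilityMeasure_map hgm.aemeasurable, fun P Q => ?_⟩
  rw [integral_map hgm.aemeasurable (measurable_queryDiv_sq P Q).aestronglyMeasurable]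
  simp only [queryDiv, sq_abs, hg]

/-- The uniform mixture of three random queries. -/
theorem exists_mixture_three (q₁ q₂ q₃ : Measure (Query Z)) [IsProbabilityMeasure q₁]
    [IsProbabilityMeasure q₂] [IsProbabilityMeasure q₃] :
    ∃ q : ProbabilityMeasure (Query Z), ∀ (P Q : ProbabilityMeasure Z) (ε : ℝ),
      ∫ ℓ, queryDiv ℓ (P : Measure Z) (Q : Measure Z) ^ 2 ∂(q : Measure (Query Z)) ≤ ε ^ 2 →
      ∫ ℓ, queryDiv ℓ (P : Measure Z) (Q : Measure Z) ^ 2 ∂q₁ ≤ (2 * ε) ^ 2 ∧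
      ∫ ℓ, queryDiv ℓ (P : Measure Z) (Q : Measure Z) ^ 2 ∂q₂ ≤ (2 * ε) ^ 2 ∧
      ∫ ℓ, queryDiv ℓ (P : Measure Z) (Q : Measure Z) ^ 2 ∂q₃ ≤ (2 * ε) ^ 2 := by
  have hp : IsProbabilityMeasure (ENNReal.ofReal (1 / 3) • (q₁ + q₂ + q₃)) := by
    constructor
    simp only [Measure.smul_apply, Measure.add_apply, measure_univ, smul_eq_mul]
    rw [show (1 + 1 + 1 : ℝ≥0∞) = ENNReal.ofReal 3 by norm_num, ← ENNReal.ofReal_mul (by norm_num)]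
    norm_num
  refine ⟨⟨_, hp⟩, fun P Q ε h => ?_⟩
  have hi : ∀ q : Measure (Query Z), [IsFiniteMeasure q] → Integrable (fun ℓ : Query Z =>
    queryDiv ℓ (P : Measure Z) (Q : Measure Z) ^ 2) q := fun q _ => integrable_queryDiv_sq P Q q
  have h0 : ∀ q : Measure (Query Z),
      0 ≤ ∫ ℓ, queryDiv ℓ (P : Measure Z) (Q : Measure Z) ^ 2 ∂q :=
    fun q => integral_nonneg (fun _ => sq_nonneg _)
  simp only [ProbabilityMeasure.coe_mk] at h
  rw [integral_smul_measure, integral_add_measure (hi _) (hi _), integral_add_measure (hi _) (hi _),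
    ENNReal.toReal_ofReal (by norm_num), smul_eq_mul] at h
  have h1 := h0 q₁
  have h2 := h0 q₂
  have h3 := h0 q₃
  refine ⟨?_, ?_, ?_⟩ <;> nlinarith [sq_nonneg ε]

end Queries

/-! ### A least-squares estimator constrained to the ball -/

/-- The minimizer over the ball of a weighted least-squares objective satisfies the first-order
variational inequality. -/
theorem exists_constrained_leastSquares {d : ℕ} {Ω : Type*} [MeasurableSpace Ω] (P : Measure Ω)
    [IsProbabilityMeasure P] {x : Ω → EuclideanSpace ℝ (Fin d)} {r y : Ω → ℝ}
    (hx : Measurable x) (hr : Measurable r) (hy : Measurable y) (hx1 : ∀ ω, ‖x ω‖ ≤ 1)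
    {B : ℝ} (hB : ∀ ω, ‖r ω • x ω‖ ≤ B) (hy1 : ∀ ω, |y ω| ≤ 1) :
    ∃ θ : Ball d, ∀ θ' : Ball d,
      ∫ ω, r ω * inner ℝ (x ω) ((θ : EuclideanSpace ℝ (Fin d)) - θ') *
        (inner ℝ (x ω) (θ : EuclideanSpace ℝ (Fin d)) - y ω) ∂P ≤ 0 := by
  have hux : ∀ (ω : Ω) (v : EuclideanSpace ℝ (Fin d)), |r ω * inner ℝ (x ω) v| ≤ B * ‖v‖ := by
    intro ω v
    rw [← real_inner_smul_left]
    exact (abs_real_inner_le_norm _ _).trans (mul_le_mul_of_nonneg_right (hB ω) (norm_nonneg _))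
  have hxx : ∀ (ω : Ω) (v : EuclideanSpace ℝ (Fin d)), |inner ℝ (x ω) v| ≤ ‖v‖ := fun ω v =>
    (abs_real_inner_le_norm _ _).trans (mul_le_of_le_one_left (norm_nonneg _) (hx1 ω))
  have hm1 : ∀ v, Measurable (fun ω => r ω * inner ℝ (x ω) v) := fun v =>
    hr.mul (Measurable.inner_const hx)
  have hm2 : ∀ v, Measurable (fun ω => inner ℝ (x ω) v) := fun v => Measurable.inner_const hx
  -- the weighted squared error without its constant term `r y²`, which need not be integrable
  set φ : EuclideanSpace ℝ (Fin d) → ℝ := fun v =>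
    ∫ ω, (r ω * inner ℝ (x ω) v) * (inner ℝ (x ω) v - 2 * y ω) ∂P with hφ
  have hint : ∀ (v w : EuclideanSpace ℝ (Fin d)) (c : ℝ),
      Integrable (fun ω => (r ω * inner ℝ (x ω) v) * (inner ℝ (x ω) w - c * y ω)) P := by
    intro v w c
    refine integrable_of_bounded ((hm1 v).mul ((hm2 w).sub (measurable_const.mul hy)))
      (C := (B * ‖v‖) * (‖w‖ + |c|)) (fun ω => ?_)
    rw [abs_mul]
    refine mul_le_mul (hux ω v) ?_ (abs_nonneg _) ((abs_nonneg _).trans (hux ω v))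
    refine (abs_sub _ _).trans (add_le_add (hxx ω w) ?_)
    rw [abs_mul]
    exact mul_le_of_le_one_right (abs_nonneg _) (hy1 ω)
  have hcont : ContinuousOn φ (Metric.closedBall 0 1) := by
    refine continuousOn_of_dominated (bound := fun _ => |B| * 3) ?_ ?_ (integrable_const _) ?_
    · intro v _
      exact (hint v v 2).aestronglyMeasurable
    · intro v hv
      have hv1 : ‖v‖ ≤ 1 := mem_closedBall_zero_iff.mp hv
      refine Filter.Eventually.of_forall (fun ω => ?_)
      rw [Real.norm_eq_abs, abs_mul]
      refine mul_le_mul ((hux ω v).trans ?_) ?_ (abs_nonneg _) (abs_nonneg _)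
      · calc B * ‖v‖ ≤ |B| * ‖v‖ := mul_le_mul_of_nonneg_right (le_abs_self B) (norm_nonneg _)
          _ ≤ |B| := mul_le_of_le_one_right (abs_nonneg _) hv1
      · refine (abs_sub _ _).trans ?_
        rw [abs_mul, abs_two]
        linarith [hxx ω v, hy1 ω]
    · exact Filter.Eventually.of_forall (fun ω => by fun_prop)
  obtain ⟨θ, hθ, hmin⟩ := (isCompact_closedBall (0 : EuclideanSpace ℝ (Fin d)) 1).exists_isMinOn
    ⟨0, by simp⟩ hcont
  refine ⟨⟨θ, hθ⟩, fun θ' => ?_⟩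
  simp only
  set Δ := θ - (θ' : EuclideanSpace ℝ (Fin d)) with hΔ
  set I := ∫ ω, r ω * inner ℝ (x ω) Δ * (inner ℝ (x ω) θ - y ω) ∂P with hI
  set J := ∫ ω, r ω * inner ℝ (x ω) Δ * (inner ℝ (x ω) Δ) ∂P with hJ
  have hi1 : Integrable (fun ω => r ω * inner ℝ (x ω) Δ * (inner ℝ (x ω) θ - y ω)) P := by
    simpa using hint Δ θ 1
  have hi2 : Integrable (fun ω => r ω * inner ℝ (x ω) Δ * (inner ℝ (x ω) Δ)) P := by
    simpa using hint Δ Δ 0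
  -- moving from the minimizer towards `θ'`
  have hexp : ∀ t : ℝ, φ (θ - t • Δ) = φ θ - 2 * t * I + t ^ 2 * J := by
    intro t
    simp only [hφ, hI, hJ]
    have j1 : Integrable (fun ω => 2 * t *
        (r ω * inner ℝ (x ω) Δ * (inner ℝ (x ω) θ - y ω))) P := hi1.const_mul _
    have j2 : Integrable (fun ω => t ^ 2 * (r ω * inner ℝ (x ω) Δ * (inner ℝ (x ω) Δ))) P :=
      hi2.const_mul _
    have j3 : Integrable (fun ω => r ω * inner ℝ (x ω) θ * (inner ℝ (x ω) θ - 2 * y ω) -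
        2 * t * (r ω * inner ℝ (x ω) Δ * (inner ℝ (x ω) θ - y ω))) P := (hint θ θ 2).sub j1
    rw [← integral_const_mul, ← integral_const_mul, ← integral_sub (hint θ θ 2) j1,
      ← integral_add j3 j2]
    refine integral_congr_ae (Filter.Eventually.of_forall (fun ω => ?_))
    simp only [inner_sub_right, inner_smul_right]
    ring
  have hineq : ∀ t : ℝ, 0 < t → t ≤ 1 → 2 * I ≤ t * J := by
    intro t ht0 ht1
    have hmem : θ - t • Δ ∈ Metric.closedBall (0 : EuclideanSpace ℝ (Fin d)) 1 := by
      have e : θ - t • Δ = (1 - t) • θ + t • (θ' : EuclideanSpace ℝ (Fin d)) := by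
        rw [hΔ, smul_sub, sub_smul, one_smul]; abel
      rw [e]
      exact (convex_closedBall (0 : EuclideanSpace ℝ (Fin d)) 1) hθ θ'.2 (by linarith) ht0.le
        (by ring)
    have h : φ θ ≤ φ (θ - t • Δ) := hmin hmem
    rw [hexp t] at h
    nlinarith
  by_contra hpos
  push Not at hpos
  have hJ0 : 0 < |J| + 1 := by positivity
  have ht : 0 < min 1 (I / (|J| + 1)) := lt_min one_pos (by positivity)
  have h := hineq _ ht (min_le_left _ _)
  have h2 : min 1 (I / (|J| + 1)) * J ≤ I / (|J| + 1) * (|J| + 1) := by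
    calc min 1 (I / (|J| + 1)) * J ≤ min 1 (I / (|J| + 1)) * (|J| + 1) := by
          gcongr; linarith [le_abs_self J]
      _ ≤ _ := by gcongr; exact min_le_right _ _
  rw [div_mul_cancel₀ _ hJ0.ne'] at h2
  linarith

/-! ### Estimation of linear models from private queries -/

/-- The label as a real number in `{-1, 1}`. -/
def label (b : Bool) : ℝ := if b then 1 else -1

theorem abs_label (b : Bool) : |label b| = 1 := by
  cases b <;> simp [label]

section Signs

variable {d : ℕ}

theorem integral_sgn_inner_mul_inner (a e : EuclideanSpace ℝ (Fin d)) :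
    ∫ v, inner ℝ e v * sgn (inner ℝ a v) ∂(stdGaussian (EuclideanSpace ℝ (Fin d))) =
      absGauss * (inner ℝ e a / ‖a‖) := by
  rcases eq_or_ne a 0 with rfl | ha
  · simp [sgn, integral_inner_stdGaussian]
  have hn : 0 < ‖a‖ := norm_pos_iff.mpr ha
  have hw : ‖(‖a‖⁻¹ : ℝ) • a‖ = 1 := by
    rw [norm_smul, norm_inv, norm_norm, inv_mul_cancel₀ hn.ne']
  have hs : ∀ v, sgn (inner ℝ a v) = sgn (inner ℝ ((‖a‖⁻¹ : ℝ) • a) v) := fun v => by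
    rw [real_inner_smul_left]
    unfold sgn
    congr 1
    rw [eq_iff_iff]
    constructor
    · intro h; positivity
    · intro h
      exact nonneg_of_mul_nonneg_right (by linarith) (inv_pos.mpr hn)
  simp_rw [hs, mul_comm (inner ℝ e _)]
  rw [integral_sgn_mul_inner_stdGaussian hw, real_inner_smul_left, real_inner_comm]
  ring

end Signs

section Core

variable {d : ℕ} {X : Set (EuclideanSpace ℝ (Fin d))}

/-- Weighted Cauchy–Schwarz for the `L₁` error, in the form of the arithmetic–geometric mean. -/
theorem integral_abs_le_of_weight {Ω : Type*} [MeasurableSpace Ω] {μ : Measure Ω} {c n : Ω → ℝ}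
    (hn : ∀ ω, 0 ≤ n ω) (hcn : ∀ ω, n ω = 0 → c ω = 0) (hc : Integrable (fun ω => |c ω|) μ)
    (hni : Integrable n μ) (hci : Integrable (fun ω => c ω ^ 2 / n ω) μ) {s : ℝ} (hs : 0 < s) :
    2 * ∫ ω, |c ω| ∂μ ≤ s * ∫ ω, c ω ^ 2 / n ω ∂μ + s⁻¹ * ∫ ω, n ω ∂μ := by
  rw [← integral_const_mul, ← integral_const_mul, ← integral_const_mul,
    ← integral_add (hci.const_mul _) (hni.const_mul _)]
  refine integral_mono (hc.const_mul _) ((hci.const_mul _).add (hni.const_mul _)) (fun ω => ?_)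
  simp only
  rcases (hn ω).eq_or_lt with h | h
  · simp [← h, hcn ω h.symm]
  · have e : s * (c ω ^ 2 / n ω) + s⁻¹ * n ω - 2 * |c ω| = (s * |c ω| - n ω) ^ 2 / (s * n ω) := by
      rw [← sq_abs (c ω)]
      field_simp
      ring
    have : 0 ≤ (s * |c ω| - n ω) ^ 2 / (s * n ω) := by positivity
    linarith

/-- The constant in the bound on the private decision-estimation coefficient: the error is at most
`5 / 2 · √d λ` with the regularization `λ = 40 ε / κ²`, where `κ` is `absGauss`. -/
noncomputable def decConst : ℝ := 100 / absGauss ^ 2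

theorem decConst_pos : 0 < decConst := by
  have := absGauss_pos
  unfold decConst; positivity

/-- The balancing change of coordinates, in the form in which it is used: `‖A x‖ ≤ 2 / λ` on the unit
ball, `E‖A x‖ ≤ 2 d`, and each linear functional `⟨·, Δ⟩` is `⟨e, A ·⟩` for a vector `e` whose norm is
controlled by the weighted second moment, up to the regularization. -/
theorem exists_balanced_coordinates (hd : 1 ≤ d) {Ω : Type*} [MeasurableSpace Ω] (P : Measure Ω)
    [IsProbabilityMeasure P] {x : Ω → EuclideanSpace ℝ (Fin d)} (hx : Measurable x)
    (hx1 : ∀ ω, ‖x ω‖ ≤ 1) {lam : ℝ} (hlam : 0 < lam) :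
    ∃ A : EuclideanSpace ℝ (Fin d) →ₗ[ℝ] EuclideanSpace ℝ (Fin d),
      (∀ v, ‖v‖ ≤ 1 → lam * ‖A v‖ ≤ 2) ∧ (∃ B : ℝ, 0 ≤ B ∧ ∀ v, ‖v‖ ≤ B * ‖A v‖) ∧
      ∫ ω, ‖A (x ω)‖ ∂P ≤ 2 * d ∧
      ∀ Δ, ∃ e, (∀ v, inner ℝ e (A v) = inner ℝ v Δ) ∧
        2 / 5 * ‖e‖ ^ 2 - lam ^ 2 * ‖Δ‖ ^ 2 ≤
          ∫ ω, (inner ℝ e (A (x ω))) ^ 2 / ‖A (x ω)‖ ∂P := by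
  obtain ⟨A, hA, hdes⟩ := exists_design hd P hx hx1 hlam
  set A' := LinearEquiv.ofIsUnitDet (f := A) (v := (EuclideanSpace.basisFun (Fin d) ℝ).toBasis)
    (v' := (EuclideanSpace.basisFun (Fin d) ℝ).toBasis)
    (by rw [LinearMap.det_toMatrix]; exact isUnit_iff_ne_zero.mpr hA) with hA'
  have hAA : ∀ v, A' v = A v := fun v => rfl
  set Ainv : EuclideanSpace ℝ (Fin d) →ₗ[ℝ] EuclideanSpace ℝ (Fin d) := A'.symm.toLinearMap
    with hAinv
  have hAi : ∀ v, Ainv (A v) = v := fun v => by rw [← hAA, hAinv]; simp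
  refine ⟨A, ?_, ?_, ?_, ?_⟩
  · intro v hv
    have h1 := (hdes (A v)).2
    have h0 : 0 ≤ ∫ ω, (inner ℝ (A v) (A (x ω))) ^ 2 / ‖A (x ω)‖ ∂P :=
      integral_nonneg (fun _ => by positivity)
    have h2 : ∑ i, (inner ℝ (A v) (A (EuclideanSpace.basisFun (Fin d) ℝ i))) ^ 2 =
        ‖LinearMap.adjoint A (A v)‖ ^ 2 := by
      rw [← (EuclideanSpace.basisFun (Fin d) ℝ).sum_sq_norm_inner_left]
      refine Finset.sum_congr rfl (fun i _ => ?_)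
      rw [LinearMap.adjoint_inner_left, Real.norm_eq_abs, sq_abs]
    -- the upper bound at `e = A v`, where `‖A v‖² = ⟨Aᵀ A v, v⟩`
    have h3 : ‖A v‖ ^ 2 ≤ ‖LinearMap.adjoint A (A v)‖ := by
      rw [← real_inner_self_eq_norm_sq, ← LinearMap.adjoint_inner_left]
      exact (real_inner_le_norm _ _).trans (mul_le_of_le_one_right (norm_nonneg _) hv)
    rw [h2] at h1
    have h4 : lam ^ 2 * (‖A v‖ ^ 2) ^ 2 ≤ 2 * ‖A v‖ ^ 2 := by
      calc lam ^ 2 * (‖A v‖ ^ 2) ^ 2 ≤ lam ^ 2 * ‖LinearMap.adjoint A (A v)‖ ^ 2 := by gcongr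
        _ ≤ _ := by linarith
    rcases (norm_nonneg (A v)).eq_or_lt with h | h
    · rw [← h]; norm_num
    · have h5 : (lam * ‖A v‖) ^ 2 ≤ 2 := by
        have h6 : (lam * ‖A v‖) ^ 2 * ‖A v‖ ^ 2 ≤ 2 * ‖A v‖ ^ 2 := by nlinarith
        exact le_of_mul_le_mul_right h6 (by positivity)
      nlinarith [mul_pos hlam h]
  · refine ⟨‖LinearMap.toContinuousLinearMap Ainv‖, norm_nonneg _, fun v => ?_⟩
    have h := (LinearMap.toContinuousLinearMap Ainv).le_opNorm (A v)
    simpa only [LinearMap.coe_toContinuousLinearMap', hAi] using h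
  -- `‖A x‖` is the trace of the weighted second moment
  · have h1 : ∀ ω, ‖A (x ω)‖ = ∑ i, (inner ℝ (EuclideanSpace.basisFun (Fin d) ℝ i)
        (A (x ω))) ^ 2 / ‖A (x ω)‖ := by
      intro ω
      rw [← Finset.sum_div]
      have h := (EuclideanSpace.basisFun (Fin d) ℝ).sum_sq_norm_inner_right (A (x ω))
      simp only [Real.norm_eq_abs, sq_abs] at h
      rw [h]
      rcases (norm_nonneg (A (x ω))).eq_or_lt with h | h
      · rw [← h]; simp
      · field_simp
    have h2 : ∀ i, ∫ ω, (inner ℝ (EuclideanSpace.basisFun (Fin d) ℝ i) (A (x ω))) ^ 2 /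
        ‖A (x ω)‖ ∂P ≤ 2 := by
      intro i
      have h := (hdes (EuclideanSpace.basisFun (Fin d) ℝ i)).2
      rw [(EuclideanSpace.basisFun (Fin d) ℝ).norm_eq_one] at h
      have h0 : 0 ≤ lam ^ 2 * ∑ j, (inner ℝ (EuclideanSpace.basisFun (Fin d) ℝ i)
        (A (EuclideanSpace.basisFun (Fin d) ℝ j))) ^ 2 := by positivity
      linarith
    rw [integral_congr_ae (Filter.Eventually.of_forall h1), integral_finsetSum _
      (fun i _ => integrable_inner_sq_div_norm _ hx hx1 A _)]
    calc _ ≤ ∑ _i : Fin d, (2 : ℝ) := Finset.sum_le_sum (fun i _ => h2 i)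
      _ = 2 * d := by simp [mul_comm]
  · intro Δ
    have heA : ∀ v, inner ℝ (LinearMap.adjoint Ainv Δ) (A v) = inner ℝ v Δ := fun v => by
      rw [LinearMap.adjoint_inner_left, hAi, real_inner_comm]
    refine ⟨LinearMap.adjoint Ainv Δ, heA, ?_⟩
    have h1 := (hdes (LinearMap.adjoint Ainv Δ)).1
    have h2 : ∑ i, (inner ℝ (LinearMap.adjoint Ainv Δ)
        (A (EuclideanSpace.basisFun (Fin d) ℝ i))) ^ 2 = ‖Δ‖ ^ 2 := by
      rw [← (EuclideanSpace.basisFun (Fin d) ℝ).sum_sq_norm_inner_right]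
      refine Finset.sum_congr rfl (fun i _ => ?_)
      rw [heA, Real.norm_eq_abs, sq_abs]
    rw [h2] at h1
    linarith

set_option maxHeartbeats 1000000 in
/-- The bound on the private decision-estimation coefficient at an arbitrary reference law `P`: an
estimator and a distribution over queries such that any linear model `ε`-close to `P` under the
queries has `L₁` error `O(√d ε)`.

In the coordinates `A` balancing the covariates of `P`, random signs `sgn ⟨A x, v⟩` of Gaussian
projections serve as instruments: against the residual they estimate `E[(A x / ‖A x‖) ⟨x, Δ⟩]`, and in
pairs, weighted by `‖A x‖`, they verify that the model has second moments similar to those of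
`P`. -/
theorem exists_estimator_of_query_close (hd : 1 ≤ d) (hX : X ⊆ Metric.closedBall 0 1)
    (P : ProbabilityMeasure (X × Bool)) {ε : ℝ} (hε : 0 < ε) :
    ∃ (θ : Ball d) (q : ProbabilityMeasure (Query (X × Bool))), ∀ M : LinModel X,
      ∫ ℓ, queryDiv ℓ (M.law hX : Measure (X × Bool)) (P : Measure (X × Bool)) ^ 2
        ∂(q : Measure (Query (X × Bool))) ≤ ε ^ 2 →
      M.lossL1 θ ≤ decConst * Real.sqrt d * ε := by
  have hd' : (1 : ℝ) ≤ d := by exact_mod_cast hd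
  have hκ := absGauss_pos
  have hκ1 := absGauss_le_one
  set κ := absGauss with hκdef
  set lam : ℝ := 40 * ε / κ ^ 2 with hlamdef
  have hlam : 0 < lam := by positivity
  set G := stdGaussian (EuclideanSpace ℝ (Fin d)) with hG
  set xv : X × Bool → EuclideanSpace ℝ (Fin d) := fun z => (z.1 : EuclideanSpace ℝ (Fin d)) with hxv
  have hxm : Measurable xv := measurable_subtype_coe.comp measurable_fst
  have hx1 : ∀ z, ‖xv z‖ ≤ 1 := fun z => norm_covariate_le hX z.1
  obtain ⟨A, hAn, ⟨B, hB0, hB⟩, hnP, hfun⟩ :=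
    exists_balanced_coordinates hd (P : Measure (X × Bool)) hxm hx1 hlam
  have hBA : ∀ z, ‖‖A (xv z)‖⁻¹ • xv z‖ ≤ B := fun z => by
    rw [norm_smul, norm_inv, norm_norm]
    rcases (norm_nonneg (A (xv z))).eq_or_lt with h | h
    · rw [← h]; simpa using hB0
    · rw [inv_mul_le_iff₀ h, mul_comm]
      exact hB _
  have hlab : Measurable (fun z : X × Bool => label z.2) :=
    (measurable_of_finite label).comp measurable_snd
  have hAxm : Measurable (fun z => A (xv z)) := measurable_linearMap_comp hxm A
  obtain ⟨θ, hθ⟩ := exists_constrained_leastSquares (P : Measure (X × Bool)) (x := xv)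
    (r := fun z => ‖A (xv z)‖⁻¹) (y := fun z => label z.2) hxm hAxm.norm.inv hlab hx1 (B := B) hBA
    (fun z => (abs_label z.2).le)
  -- The queries, shifted and scaled into `[0, 1]`: `f₁` is the residual times a random sign, `f₂` is
  -- `λ ‖A x‖` times a product of two independent random signs, and `f₃` is `λ ‖A x‖` itself.
  set res : X × Bool → ℝ := fun z => inner ℝ (xv z) (θ : EuclideanSpace ℝ (Fin d)) - label z.2
    with hres
  have hresm : Measurable res := (Measurable.inner_const hxm).sub hlab
  have hresb : ∀ z, |res z| ≤ 2 := fun z => by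
    refine (abs_sub _ _).trans ?_
    have := abs_inner_param_le hX z.1 θ
    have := abs_label z.2
    simp only [hxv]
    linarith
  have hn0 : ∀ z, 0 ≤ lam * ‖A (xv z)‖ := fun z => by positivity
  have hn2 : ∀ z, lam * ‖A (xv z)‖ ≤ 2 := fun z => hAn _ (hx1 z)
  set f₁ : EuclideanSpace ℝ (Fin d) → X × Bool → ℝ := fun v z =>
    1 / 2 + sgn (inner ℝ (A (xv z)) v) * (res z / 4) with hf₁
  set f₂ : EuclideanSpace ℝ (Fin d) × EuclideanSpace ℝ (Fin d) → X × Bool → ℝ := fun v z =>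
    1 / 2 + sgn (inner ℝ (A (xv z)) v.1) * sgn (inner ℝ (A (xv z)) v.2) *
      (lam * ‖A (xv z)‖ / 4) with hf₂
  set f₃ : Unit → X × Bool → ℝ := fun _ z => lam * ‖A (xv z)‖ / 2 with hf₃
  have hm₁ : Measurable (Function.uncurry f₁) := by
    refine measurable_const.add (Measurable.mul ?_ ((hresm.comp measurable_snd).div_const 4))
    exact measurable_sgn.comp (Measurable.inner (hAxm.comp measurable_snd) measurable_fst)
  have hm₂ : Measurable (Function.uncurry f₂) := by
    refine measurable_const.add (Measurable.mul (Measurable.mul ?_ ?_)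
      (((hAxm.comp measurable_snd).norm.const_mul lam).div_const 4))
    · exact measurable_sgn.comp (Measurable.inner (hAxm.comp measurable_snd)
        (measurable_fst.comp measurable_fst))
    · exact measurable_sgn.comp (Measurable.inner (hAxm.comp measurable_snd)
        (measurable_snd.comp measurable_fst))
  have hm₃ : Measurable (Function.uncurry f₃) :=
    ((hAxm.comp measurable_snd).norm.const_mul lam).div_const 2
  have hsgn1 : ∀ t c : ℝ, |sgn t * c| = |c| := fun t c => by rw [abs_mul, abs_sgn, one_mul]
  have h01₁ : ∀ v z, f₁ v z ∈ Set.Icc (0 : ℝ) 1 := by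
    intro v z
    have h := abs_le.mp ((hsgn1 (inner ℝ (A (xv z)) v) (res z / 4)).le)
    have h2 : |res z / 4| ≤ 1 / 2 := by
      rw [abs_div, abs_of_pos (by norm_num : (0 : ℝ) < 4)]; linarith [hresb z]
    constructor <;> simp only [hf₁] <;> linarith [h.1, h.2]
  have h01₂ : ∀ v z, f₂ v z ∈ Set.Icc (0 : ℝ) 1 := by
    intro v z
    have h := abs_le.mp (show |sgn (inner ℝ (A (xv z)) v.1) * sgn (inner ℝ (A (xv z)) v.2) *
      (lam * ‖A (xv z)‖ / 4)| ≤ 1 / 2 by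
        rw [mul_assoc, hsgn1, hsgn1, abs_of_nonneg (by linarith [hn0 z])]
        linarith [hn2 z])
    constructor <;> simp only [hf₂] <;> linarith [h.1, h.2]
  have h01₃ : ∀ v z, f₃ v z ∈ Set.Icc (0 : ℝ) 1 := fun v z =>
    ⟨by have := hn0 z; simp only [hf₃]; linarith, by have := hn2 z; simp only [hf₃]; linarith⟩
  obtain ⟨q₁, hq₁, hD₁⟩ := exists_randomQuery G hm₁ h01₁
  obtain ⟨q₂, hq₂, hD₂⟩ := exists_randomQuery (G.prod G) hm₂ h01₂
  obtain ⟨q₃, hq₃, hD₃⟩ := exists_randomQuery (Measure.dirac ()) hm₃ h01₃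
  obtain ⟨q, hq⟩ := exists_mixture_three q₁ q₂ q₃
  refine ⟨θ, q, fun M hM => ?_⟩
  obtain ⟨hM₁, hM₂, hM₃⟩ := hq (M.law hX) P ε hM
  rw [hD₁] at hM₁
  rw [hD₂] at hM₂
  rw [hD₃] at hM₃
  set m : Measure (X × Bool) := (M.law hX : Measure (X × Bool)) with hm
  set Δ : EuclideanSpace ℝ (Fin d) :=
    (θ : EuclideanSpace ℝ (Fin d)) - (M.param : EuclideanSpace ℝ (Fin d)) with hΔ
  have hΔ2 : ‖Δ‖ ≤ 2 := θ.norm_sub_le M.param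
  obtain ⟨e, heA, hdes⟩ := hfun Δ
  -- Averaging `f₁` against `⟨e, v⟩` recovers, up to a positive factor, the derivative of the
  -- least-squares objective in the direction `Δ`; it is nonpositive under `P`, and under the model it
  -- is `I`.
  have hk₁ : ∀ z, ∫ v, inner ℝ e v * f₁ v z ∂G =
      κ / 4 * (‖A (xv z)‖⁻¹ * inner ℝ (xv z) Δ * res z) := by
    intro z
    have i1 : Integrable (fun v => inner ℝ e v * (1 / 2)) G :=
      (integrable_inner_stdGaussian e).mul_const _
    have i2 : Integrable (fun v => inner ℝ e v * sgn (inner ℝ (A (xv z)) v) * (res z / 4)) G := by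
      have h := (integrable_sgn_mul_inner_stdGaussian (A (xv z)) e).mul_const (res z / 4)
      simpa only [mul_comm (sgn _)] using h
    have hsp : ∀ v, inner ℝ e v * f₁ v z = inner ℝ e v * (1 / 2) +
        inner ℝ e v * sgn (inner ℝ (A (xv z)) v) * (res z / 4) := fun v => by
      simp only [hf₁]; ring
    simp_rw [hsp]
    rw [integral_add i1 i2, integral_mul_const, integral_mul_const, integral_inner_stdGaussian,
      integral_sgn_inner_mul_inner, heA]
    ring
  have hT₁ := abs_integral_average_sub_le G m (P : Measure (X × Bool)) hm₁ (C := 1)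
    (fun v z => abs_le.mpr ⟨by linarith [(h01₁ v z).1], (h01₁ v z).2⟩)
    (τ := fun v => inner ℝ e v) (integrable_inner_stdGaussian e) (integrable_inner_sq_stdGaussian e)
    (norm_nonneg e) (by positivity : (0 : ℝ) ≤ 2 * ε) (integral_inner_sq_stdGaussian e).le hM₁
  simp_rw [hk₁] at hT₁
  rw [integral_const_mul, integral_const_mul] at hT₁
  set I := ∫ x, (inner ℝ (x : EuclideanSpace ℝ (Fin d)) Δ) ^ 2 /
    ‖A (x : EuclideanSpace ℝ (Fin d))‖ ∂(M.cov : Measure X) with hI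
  have hB' : ∀ z : X × Bool, |‖A (xv z)‖⁻¹ * inner ℝ (xv z) Δ| ≤ B * ‖Δ‖ := by
    intro z
    rw [← real_inner_smul_left]
    exact (abs_real_inner_le_norm _ _).trans (mul_le_mul_of_nonneg_right (hBA z) (norm_nonneg _))
  have hIm : ∫ z, ‖A (xv z)‖⁻¹ * inner ℝ (xv z) Δ * res z ∂m = I := by
    rw [hm, M.integral_law hX (f := fun z => ‖A (xv z)‖⁻¹ * inner ℝ (xv z) Δ * res z)
      (C := B * ‖Δ‖ * 2)
      ((hAxm.norm.inv.mul (Measurable.inner_const hxm)).mul hresm) (fun z => by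
        rw [abs_mul]
        exact mul_le_mul (hB' z) (hresb z) (abs_nonneg _) (by positivity))]
    refine integral_congr_ae (Filter.Eventually.of_forall (fun x => ?_))
    simp only [hxv, hres, label, hΔ, inner_sub_right]
    simp
    ring
  have hIP := hθ M.param
  rw [hIm] at hT₁
  have hI1 : I ≤ lam / 5 * ‖e‖ := by
    have h1 := (abs_le.mp hT₁).2
    have h2 : κ / 4 * ∫ z, ‖A (xv z)‖⁻¹ * inner ℝ (xv z) Δ * res z ∂(P : Measure (X × Bool)) ≤ 0 :=
      mul_nonpos_of_nonneg_of_nonpos (by positivity) hIP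
    have h3 : κ * I ≤ 8 * ε * ‖e‖ := by linarith
    have h4 : κ * (lam / 5 * ‖e‖) = 8 * ε * ‖e‖ / κ := by
      rw [hlamdef]; field_simp; ring
    have h5 : 8 * ε * ‖e‖ ≤ 8 * ε * ‖e‖ / κ := by
      rw [le_div_iff₀ hκ]
      exact mul_le_of_le_one_right (by positivity) hκ1
    exact le_of_mul_le_mul_left (by linarith) hκ
  -- Averaging `f₂` against `⟨e, v₁⟩ ⟨e, v₂⟩` recovers the weighted second moment of `⟨e, A x⟩`, which is
  -- again `I` under the model, and bounded below under `P` by the choice of `A`.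
  have hk₂ : ∀ z, ∫ v, (inner ℝ e v.1 * inner ℝ e v.2) * f₂ v z ∂(G.prod G) =
      lam * κ ^ 2 / 4 * ((inner ℝ e (A (xv z))) ^ 2 / ‖A (xv z)‖) := by
    intro z
    have i1 : Integrable (fun v : EuclideanSpace ℝ (Fin d) × EuclideanSpace ℝ (Fin d) =>
        inner ℝ e v.1 * inner ℝ e v.2 * (1 / 2)) (G.prod G) :=
      ((integrable_inner_stdGaussian e).mul_prod (integrable_inner_stdGaussian e)).mul_const _
    have hs : Integrable (fun v => inner ℝ e v * sgn (inner ℝ (A (xv z)) v)) G := by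
      have h := integrable_sgn_mul_inner_stdGaussian (A (xv z)) e
      simpa only [mul_comm (sgn _)] using h
    have i2 : Integrable (fun v : EuclideanSpace ℝ (Fin d) × EuclideanSpace ℝ (Fin d) =>
        (inner ℝ e v.1 * sgn (inner ℝ (A (xv z)) v.1)) *
        (inner ℝ e v.2 * sgn (inner ℝ (A (xv z)) v.2)) * (lam * ‖A (xv z)‖ / 4)) (G.prod G) :=
      (hs.mul_prod hs).mul_const _
    have hsp : ∀ v : EuclideanSpace ℝ (Fin d) × EuclideanSpace ℝ (Fin d),
        (inner ℝ e v.1 * inner ℝ e v.2) * f₂ v z = inner ℝ e v.1 * inner ℝ e v.2 * (1 / 2) +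
        (inner ℝ e v.1 * sgn (inner ℝ (A (xv z)) v.1)) *
        (inner ℝ e v.2 * sgn (inner ℝ (A (xv z)) v.2)) * (lam * ‖A (xv z)‖ / 4) := fun v => by
      simp only [hf₂]; ring
    simp_rw [hsp]
    rw [integral_add i1 i2, integral_mul_const, integral_mul_const,
      integral_prod_mul (fun v => inner ℝ e v) (fun v => inner ℝ e v),
      integral_prod_mul (fun v => inner ℝ e v * sgn (inner ℝ (A (xv z)) v))
        (fun v => inner ℝ e v * sgn (inner ℝ (A (xv z)) v)),
      integral_inner_stdGaussian, integral_sgn_inner_mul_inner]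
    rcases (norm_nonneg (A (xv z))).eq_or_lt with h | h
    · rw [← h]; simp
    · field_simp
      ring
  have hτ₂ : ∫ v, (inner ℝ e v.1 * inner ℝ e v.2) ^ 2 ∂(G.prod G) = (‖e‖ ^ 2) ^ 2 := by
    simp_rw [mul_pow]
    rw [integral_prod_mul (fun v => (inner ℝ e v) ^ 2) (fun v => (inner ℝ e v) ^ 2),
      integral_inner_sq_stdGaussian]
    ring
  have hT₂ := abs_integral_average_sub_le (G.prod G) m (P : Measure (X × Bool)) hm₂ (C := 1)
    (fun v z => abs_le.mpr ⟨by linarith [(h01₂ v z).1], (h01₂ v z).2⟩)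
    (τ := fun v => inner ℝ e v.1 * inner ℝ e v.2)
    ((integrable_inner_stdGaussian e).mul_prod (integrable_inner_stdGaussian e))
    (by
      simp_rw [mul_pow]
      exact (integrable_inner_sq_stdGaussian e).mul_prod (integrable_inner_sq_stdGaussian e))
    (by positivity : 0 ≤ ‖e‖ ^ 2) (by positivity : (0 : ℝ) ≤ 2 * ε) hτ₂.le hM₂
  simp_rw [hk₂] at hT₂
  rw [integral_const_mul, integral_const_mul] at hT₂
  obtain ⟨CA, hCA⟩ := exists_norm_linearMap_le (Ω := X × Bool) hx1 A
  have hmI : ∫ z, (inner ℝ e (A (xv z))) ^ 2 / ‖A (xv z)‖ ∂m = I := by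
    rw [hm, M.integral_law hX (f := fun z => (inner ℝ e (A (xv z))) ^ 2 / ‖A (xv z)‖)
      (C := ‖e‖ ^ 2 * CA)
      (((Measurable.const_inner hAxm).pow_const 2).div hAxm.norm) (fun z => by
        rw [abs_of_nonneg (by positivity)]
        exact (inner_sq_div_norm_le _ _).trans (by gcongr; exact hCA z))]
    refine integral_congr_ae (Filter.Eventually.of_forall (fun x => ?_))
    simp only [hxv, heA]
    ring
  rw [hmI] at hT₂
  set IP := ∫ z, (inner ℝ e (A (xv z))) ^ 2 / ‖A (xv z)‖ ∂(P : Measure (X × Bool)) with hIPdef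
  have hI2 : IP - ‖e‖ ^ 2 / 5 ≤ I := by
    have h1 := (abs_le.mp hT₂).1
    have h2 : lam * κ ^ 2 = 40 * ε := by rw [hlamdef]; field_simp
    rw [h2] at h1
    have h3 : 10 * ε * (IP - ‖e‖ ^ 2 / 5) ≤ 10 * ε * I := by nlinarith
    exact le_of_mul_le_mul_left h3 (by positivity)
  have hI3 : 2 / 5 * ‖e‖ ^ 2 - 4 * lam ^ 2 ≤ IP := by
    have h3 : lam ^ 2 * ‖Δ‖ ^ 2 ≤ lam ^ 2 * 2 ^ 2 := by gcongr
    linarith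
  -- the lower bound `‖e‖² / 5 - 4 λ²` and the upper bound `λ ‖e‖ / 5` on `I` bound `‖e‖`, hence `I`
  have he6 : ‖e‖ ≤ 6 * lam := by
    by_contra hlt
    push Not at hlt
    nlinarith [norm_nonneg e]
  have hI4 : I ≤ 2 * lam ^ 2 := by nlinarith
  -- `f₃` transfers the bound on `E‖A x‖` from `P` to the model
  have hM₃' : lam / 2 * (∫ z, ‖A (xv z)‖ ∂m - ∫ z, ‖A (xv z)‖ ∂(P : Measure (X × Bool))) ≤
      2 * ε := by
    rw [integral_dirac] at hM₃
    have h := abs_le_of_sq_le_sq' hM₃ (by positivity)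
    have e1 : ∀ ν : Measure (X × Bool), ∫ z, f₃ () z ∂ν = lam / 2 * ∫ z, ‖A (xv z)‖ ∂ν := by
      intro ν
      rw [← integral_const_mul]
      exact integral_congr_ae (Filter.Eventually.of_forall (fun z => by simp only [hf₃]; ring))
    rw [e1, e1] at h
    linarith [h.2]
  have hn3 : ∫ z, ‖A (xv z)‖ ∂m ≤ 3 * d := by
    have h1 : ∫ z, ‖A (xv z)‖ ∂m - ∫ z, ‖A (xv z)‖ ∂(P : Measure (X × Bool)) ≤ 1 := by
      have h2 : lam / 2 * (∫ z, ‖A (xv z)‖ ∂m - ∫ z, ‖A (xv z)‖ ∂(P : Measure (X × Bool))) ≤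
          lam / 2 * 1 := by
        refine hM₃'.trans ?_
        rw [hlamdef, mul_one, div_div, le_div_iff₀ (by positivity)]
        nlinarith [mul_le_mul hκ1 hκ1 hκ.le zero_le_one]
      exact le_of_mul_le_mul_left h2 (by positivity)
    linarith
  have hnM : ∫ z, ‖A (xv z)‖ ∂m = ∫ x, ‖A (x : EuclideanSpace ℝ (Fin d))‖ ∂(M.cov : Measure X) := by
    rw [hm, M.integral_law hX (C := CA) hAxm.norm (fun z => by rw [abs_norm]; exact hCA z)]
    refine integral_congr_ae (Filter.Eventually.of_forall (fun x => ?_))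
    simp only [hxv]
    ring
  rw [hnM] at hn3
  have hxX1 : ∀ x : X, ‖(x : EuclideanSpace ℝ (Fin d))‖ ≤ 1 := norm_covariate_le hX
  have hsd : 0 < Real.sqrt d := Real.sqrt_pos.mpr (by linarith)
  -- Cauchy–Schwarz with the weight `‖A x‖`, whose two factors are at most `2 λ²` and `3 d`
  have hfin := integral_abs_le_of_weight (μ := (M.cov : Measure X))
    (c := fun x : X => inner ℝ (x : EuclideanSpace ℝ (Fin d)) Δ)
    (n := fun x : X => ‖A (x : EuclideanSpace ℝ (Fin d))‖) (fun x => norm_nonneg _)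
    (fun x hx => by
      have h := hB (x : EuclideanSpace ℝ (Fin d))
      rw [hx, mul_zero] at h
      simp [norm_le_zero_iff.mp h])
    (integrable_abs_inner hX _ Δ) (integrable_norm_linearMap _ measurable_subtype_coe hxX1 A)
    (by
      have h := integrable_inner_sq_div_norm (M.cov : Measure X) measurable_subtype_coe hxX1 A e
      simpa only [heA] using h)
    (s := Real.sqrt d / lam) (by positivity)
  have hloss : M.lossL1 θ = ∫ x, |inner ℝ (x : EuclideanSpace ℝ (Fin d)) Δ| ∂(M.cov : Measure X) :=
    rfl
  rw [← hloss] at hfin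
  have hb1 : Real.sqrt d / lam * I ≤ 2 * Real.sqrt d * lam := by
    calc Real.sqrt d / lam * I ≤ Real.sqrt d / lam * (2 * lam ^ 2) := by gcongr
      _ = _ := by field_simp
  have hb2 : (Real.sqrt d / lam)⁻¹ *
      ∫ x, ‖A (x : EuclideanSpace ℝ (Fin d))‖ ∂(M.cov : Measure X) ≤ 3 * Real.sqrt d * lam := by
    calc _ ≤ (Real.sqrt d / lam)⁻¹ * (3 * d) := by gcongr
      _ = (Real.sqrt d / lam)⁻¹ * (3 * (Real.sqrt d * Real.sqrt d)) := by
        rw [Real.mul_self_sqrt (by linarith)]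
      _ = _ := by field_simp
  have hlast : M.lossL1 θ ≤ 5 / 2 * (Real.sqrt d * lam) := by
    have : Real.sqrt d / lam * I + (Real.sqrt d / lam)⁻¹ *
        ∫ x, ‖A (x : EuclideanSpace ℝ (Fin d))‖ ∂(M.cov : Measure X) ≤
        5 * (Real.sqrt d * lam) := by linarith
    linarith
  refine hlast.trans (le_of_eq ?_)
  rw [hlamdef, decConst, ← hκdef]
  field_simp
  ring

end Core

/-! ### The private decision-estimation coefficient -/

section Pdec

variable {d : ℕ} {X : Set (EuclideanSpace ℝ (Fin d))}

theorem LinModel.lossL1_of_dim_zero {X : Set (EuclideanSpace ℝ (Fin 0))} (M : LinModel X)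
    (θ : Ball 0) : M.lossL1 θ = 0 := by
  have h : ∀ x : X, inner ℝ (x : EuclideanSpace ℝ (Fin 0))
      ((θ : EuclideanSpace ℝ (Fin 0)) - (M.param : EuclideanSpace ℝ (Fin 0))) = 0 := fun x => by
    rw [Subsingleton.elim ((θ : EuclideanSpace ℝ (Fin 0)) - _) 0, inner_zero_right]
  simp only [LinModel.lossL1, h, abs_zero, integral_zero]

theorem isProbabilityMeasure_of_mem_mixtures {ι Z : Type} [MeasurableSpace Z]
    {law : ι → ProbabilityMeasure Z} {P : Measure Z} (hP : P ∈ mixtures law) :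
    IsProbabilityMeasure P := by
  obtain ⟨μ, hμ, rfl⟩ := hP
  constructor
  rw [Measure.join_apply MeasurableSet.univ]
  have : ∀ᵐ m ∂(μ : Measure (Measure Z)), m Set.univ = 1 := by
    filter_upwards [hμ] with m hm
    obtain ⟨i, rfl⟩ := hm
    exact measure_univ
  rw [lintegral_congr_ae this]
  simp

/-- The slack `ε < ε'` makes the radius positive, as the estimator at a fixed reference law needs. -/
theorem pdecAt_le_of_pos (hX : X ⊆ Metric.closedBall 0 1)
    (P : ProbabilityMeasure (X × Bool)) {ε ε' : ℝ} (hε : 0 ≤ ε) (hε' : ε < ε') :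
    pdecAt (fun M : LinModel X => M.law hX) (fun M θ => M.lossL1 θ) ε (P : Measure (X × Bool)) ≤
      ENNReal.ofReal (decConst * Real.sqrt d * ε') := by
  rcases Nat.eq_zero_or_pos d with h0 | h0
  · subst h0
    set ℓ₀ : Query (X × Bool) := ⟨fun _ => 0, measurable_const, fun _ => by simp⟩
    refine (iInf_le_of_le ⟨Measure.dirac ⟨0, by simp⟩, inferInstance⟩ (iInf_le_of_le
      ⟨Measure.dirac (⟨0, by simp⟩, ℓ₀), inferInstance⟩ ?_))
    refine iSup₂_le (fun M _ => ?_)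
    simp only [LinModel.lossL1_of_dim_zero]
    simp
  obtain ⟨θ, q, hq⟩ := exists_estimator_of_query_close h0 hX P (hε.trans_lt hε')
  have hmk : Measurable (fun ℓ : Query (X × Bool) => (θ, ℓ)) := measurable_prodMk_left
  refine (iInf_le_of_le ⟨Measure.dirac θ, inferInstance⟩ (iInf_le_of_le
    ⟨(q : Measure (Query (X × Bool))).map (fun ℓ => (θ, ℓ)),
      Measure.isProbabilityMeasure_map hmk.aemeasurable⟩ ?_))
  refine iSup₂_le (fun M hM => ?_)
  simp only [ProbabilityMeasure.coe_mk] at hM ⊢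
  rw [lintegral_dirac]
  refine ENNReal.ofReal_le_ofReal (hq M ?_)
  rw [integral_map hmk.aemeasurable] at hM
  · refine hM.trans (by gcongr)
  · exact ((measurable_queryDiv_sq (M.law hX) P).comp measurable_snd).aestronglyMeasurable

/-- The private decision-estimation coefficient of linear models is at most of order `√d ε`. -/
theorem pdec_le (hX : X ⊆ Metric.closedBall 0 1) {ε : ℝ} (hε : 0 ≤ ε) :
    pdec (fun M : LinModel X => M.law hX) (fun M θ => M.lossL1 θ) ε ≤
      ENNReal.ofReal (decConst * Real.sqrt d * ε) := by
  refine iSup₂_le (fun P hP => ?_)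
  have := isProbabilityMeasure_of_mem_mixtures hP
  -- `ε = 0` is allowed, so the bound is obtained in the limit from larger radii
  have ht : Filter.Tendsto (fun ε' : ℝ => ENNReal.ofReal (decConst * Real.sqrt d * ε'))
      (nhdsWithin ε (Set.Ioi ε)) (nhds (ENNReal.ofReal (decConst * Real.sqrt d * ε))) :=
    ENNReal.tendsto_ofReal
      (((continuous_const.mul continuous_id).tendsto ε).mono_left nhdsWithin_le_nhds)
  refine ge_of_tendsto ht ?_
  filter_upwards [self_mem_nhdsWithin] with ε' hε'
  exact pdecAt_le_of_pos hX ⟨P, this⟩ hε hε'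

end Pdec

/-! ### Estimation under a finitely supported prior -/

section Prior

variable {d : ℕ} {X : Set (EuclideanSpace ℝ (Fin d))} {ι : Type} [Fintype ι]

theorem sum_le_of_markov {ι : Type*} [Fintype ι] {m g : ι → ℝ} (hm0 : ∀ i, 0 ≤ m i)
    (hg : ∀ i, 0 ≤ g i) {S : ℝ} (h : ∑ i, m i * g i ≤ S) {c : ℝ} (hc : 0 < c) {s : Finset ι}
    (hs : ∀ i ∈ s, c ≤ g i) : ∑ i ∈ s, m i ≤ S / c := by
  rw [le_div_iff₀ hc, Finset.sum_mul]
  calc ∑ i ∈ s, m i * c ≤ ∑ i ∈ s, m i * g i :=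
        Finset.sum_le_sum (fun i hi => mul_le_mul_of_nonneg_left (hs i hi) (hm0 i))
    _ ≤ ∑ i, m i * g i := Finset.sum_le_univ_sum_of_nonneg (fun i => mul_nonneg (hm0 i) (hg i))
    _ ≤ S := h

theorem sum_union_le_add {ι : Type*} [DecidableEq ι] {m : ι → ℝ} (hm0 : ∀ i, 0 ≤ m i)
    (s t : Finset ι) : ∑ i ∈ s ∪ t, m i ≤ ∑ i ∈ s, m i + ∑ i ∈ t, m i := by
  have h := Finset.sum_union_inter (s₁ := s) (s₂ := t) (f := m)
  have h0 : 0 ≤ ∑ i ∈ s ∩ t, m i := Finset.sum_nonneg (fun i _ => hm0 i)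
  linarith

theorem decConst_ge_one : 1 ≤ decConst := by
  have h := absGauss_pos
  have h1 := absGauss_le_one
  rw [decConst, le_div_iff₀ (by positivity)]
  nlinarith

/-- The query `|⟨x, θ - θ'⟩| / 2`, which compares two estimators. -/
noncomputable def compareQuery (hX : X ⊆ Metric.closedBall 0 1) (θ θ' : Ball d) :
    Query (X × Bool) where
  toFun z := |inner ℝ (z.1 : EuclideanSpace ℝ (Fin d))
    ((θ : EuclideanSpace ℝ (Fin d)) - (θ' : EuclideanSpace ℝ (Fin d)))| / 2
  measurable_toFun := (((measurable_inner_covariate _).comp measurable_fst).abs).div_const 2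
  mem_unit z := ⟨by positivity, by
    have h1 := abs_inner_covariate_le hX z.1
      ((θ : EuclideanSpace ℝ (Fin d)) - (θ' : EuclideanSpace ℝ (Fin d)))
    have h2 := θ.norm_sub_le θ'
    linarith⟩

theorem integral_compareQuery (hX : X ⊆ Metric.closedBall 0 1) (θ θ' : Ball d) (M : LinModel X) :
    2 * ∫ z, (compareQuery hX θ θ').toFun z ∂(M.law hX : Measure (X × Bool)) =
      ∫ x, |inner ℝ (x : EuclideanSpace ℝ (Fin d))
        ((θ : EuclideanSpace ℝ (Fin d)) - (θ' : EuclideanSpace ℝ (Fin d)))|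
        ∂(M.cov : Measure X) := by
  rw [M.integral_law hX (compareQuery hX θ θ').measurable_toFun (compareQuery hX θ θ').abs_le_one,
    ← integral_const_mul]
  refine integral_congr_ae (Filter.Eventually.of_forall (fun x => ?_))
  simp only [compareQuery]
  ring

/-- If no query distinguishes the models of a finite prior from `P` by more than `S` in mean
square, some estimator has expected error `O(√d S)`.

The single-scale estimator handles all models `4 S`-close to `P` under its queries; models far from
`P` at scale `2ᵏ S` have prior mass at most `4⁻ᵏ` and are handled by the estimator of a coarser scale.
Estimators of consecutive scales are close to each other because most models are close to `P` at both
scales, and the errors form a geometric series. -/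
theorem exists_estimator_of_prior (hd : 1 ≤ d) (hX : X ⊆ Metric.closedBall 0 1)
    {m : ι → ℝ} (hm0 : ∀ i, 0 ≤ m i) (hm1 : ∑ i, m i = 1) (M : ι → LinModel X)
    (P : ProbabilityMeasure (X × Bool)) {S : ℝ} (hS : 0 < S)
    (hℓ : ∀ ℓ : Query (X × Bool), ∑ i, m i *
      queryDiv ℓ ((M i).law hX : Measure (X × Bool)) (P : Measure (X × Bool)) ^ 2 ≤ S ^ 2) :
    ∃ θ : Ball d, ∑ i, m i * (M i).lossL1 θ ≤ 12 * (decConst * Real.sqrt d) * S := by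
  classical
  have hd' : (1 : ℝ) ≤ d := by exact_mod_cast hd
  set L : ℝ := decConst * Real.sqrt d with hL
  have hL1 : 1 ≤ L := by
    have h1 := decConst_ge_one
    have h2 : 1 ≤ Real.sqrt d := Real.one_le_sqrt.mpr hd'
    nlinarith
  set ε : ℕ → ℝ := fun k => 4 * 2 ^ k * S with hε
  have hεpos : ∀ k, 0 < ε k := fun k => by simp only [hε]; positivity
  choose θ q hq using fun k => exists_estimator_of_query_close hd hX P (hεpos k)
  set G : ℕ → ι → ℝ := fun k i => ∫ ℓ, queryDiv ℓ ((M i).law hX : Measure (X × Bool))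
    (P : Measure (X × Bool)) ^ 2 ∂(q k : Measure (Query (X × Bool))) with hG
  have hG0 : ∀ k i, 0 ≤ G k i := fun k i => integral_nonneg (fun _ => sq_nonneg _)
  have hGS : ∀ k, ∑ i, m i * G k i ≤ S ^ 2 := by
    intro k
    simp only [hG]
    simp_rw [← integral_const_mul]
    rw [← integral_finsetSum _ (fun i _ => (integrable_queryDiv_sq _ _ _).const_mul _)]
    have h := integral_mono (μ := (q k : Measure (Query (X × Bool))))
      (integrable_finsetSum Finset.univ
        (fun i _ => (integrable_queryDiv_sq ((M i).law hX) P _).const_mul (m i)))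
      (integrable_const (S ^ 2)) (fun ℓ => hℓ ℓ)
    simpa using h
  -- the models far from `P` under the queries of scale `k`; Markov's inequality bounds their mass
  set bad : ℕ → Finset ι := fun k => Finset.univ.filter (fun i => ε k ^ 2 < G k i) with hbad
  have hbadm : ∀ k, ∑ i ∈ bad k, m i ≤ (1 / 4) ^ k / 16 := by
    intro k
    refine (sum_le_of_markov hm0 (hG0 k) (hGS k) (pow_pos (hεpos k) 2) (s := bad k)
      (fun i hi => (Finset.mem_filter.mp hi).2.le)).trans (le_of_eq ?_)
    simp only [hε]
    rw [mul_pow, mul_pow, ← pow_mul, mul_comm k 2, pow_mul, div_pow, one_pow]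
    field_simp
    norm_num
    ring
  have hgood : ∀ k i, i ∉ bad k → (M i).lossL1 (θ k) ≤ L * ε k := by
    intro k i hi
    refine hq k (M i) ?_
    simp only [hbad, Finset.mem_filter, Finset.mem_univ, true_and, not_lt] at hi
    exact hi
  -- the comparison of consecutive estimators
  set D : ℕ → ι → ℝ := fun k i => queryDiv (compareQuery hX (θ k) (θ (k + 1)))
    ((M i).law hX : Measure (X × Bool)) (P : Measure (X × Bool)) with hD
  have hD0 : ∀ k i, 0 ≤ D k i := fun k i => abs_nonneg _
  have hDS : ∀ k, ∑ i, m i * D k i ^ 2 ≤ S ^ 2 := fun k => hℓ _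
  set ρ : ℕ → ι → ℝ := fun k i => ∫ x, |inner ℝ (x : EuclideanSpace ℝ (Fin d))
    ((θ k : EuclideanSpace ℝ (Fin d)) - (θ (k + 1) : EuclideanSpace ℝ (Fin d)))|
    ∂((M i).cov : Measure X) with hρ
  have hcmp : ∀ k i, |ρ k i - 2 * ∫ z, (compareQuery hX (θ k) (θ (k + 1))).toFun z
      ∂(P : Measure (X × Bool))| = 2 * D k i := by
    intro k i
    simp only [hρ, hD, queryDiv]
    rw [← integral_compareQuery hX, ← mul_sub, abs_mul, abs_two]
  have htri : ∀ k i, (M i).lossL1 (θ k) ≤ ρ k i + (M i).lossL1 (θ (k + 1)) ∧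
      ρ k i ≤ (M i).lossL1 (θ k) + (M i).lossL1 (θ (k + 1)) := by
    intro k i
    have hi := fun v => integrable_abs_inner hX ((M i).cov : Measure X) v
    simp only [hρ, LinModel.lossL1]
    rw [← integral_add (hi _) (hi _), ← integral_add (hi _) (hi _)]
    constructor
    · refine integral_mono (hi _) ((hi _).add (hi _)) (fun x => ?_)
      simp only
      rw [← sub_add_sub_cancel (θ k : EuclideanSpace ℝ (Fin d))
        (θ (k + 1) : EuclideanSpace ℝ (Fin d)), inner_add_right]
      exact abs_add_le _ _
    · refine integral_mono (hi _) ((hi _).add (hi _)) (fun x => ?_)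
      simp only
      rw [← sub_sub_sub_cancel_right (θ k : EuclideanSpace ℝ (Fin d))
        (θ (k + 1) : EuclideanSpace ℝ (Fin d)) ((M i).param : EuclideanSpace ℝ (Fin d)),
        inner_sub_right]
      exact abs_sub _ _
  -- Under some model the distance of consecutive estimators is at most `3 L ε k`; the comparison query
  -- carries this over to `P`, and from `P` to every other model.
  have hρle : ∀ k i, ρ k i ≤ 5 * L * ε k + 2 * D k i := by
    intro k i
    set far : Finset ι := Finset.univ.filter (fun i => ε k ^ 2 < D k i ^ 2) with hfar
    have hfarm : ∑ i ∈ far, m i ≤ (1 / 4) ^ k / 16 := by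
      refine (sum_le_of_markov hm0 (fun i => sq_nonneg (D k i)) (hDS k) (pow_pos (hεpos k) 2)
        (s := far) (fun i hi => (Finset.mem_filter.mp hi).2.le)).trans (le_of_eq ?_)
      simp only [hε]
      rw [mul_pow, mul_pow, ← pow_mul, mul_comm k 2, pow_mul, div_pow, one_pow]
      field_simp
      norm_num
      ring
    obtain ⟨j, hj⟩ : ∃ j, j ∉ bad k ∪ bad (k + 1) ∪ far := by
      by_contra hcon
      push Not at hcon
      have h1 : (1 : ℝ) ≤ ∑ i ∈ bad k, m i + ∑ i ∈ bad (k + 1), m i + ∑ i ∈ far, m i := by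
        rw [← hm1]
        have hu : (Finset.univ : Finset ι) = bad k ∪ bad (k + 1) ∪ far := by
          ext j; simpa using hcon j
        rw [hu]
        exact (sum_union_le_add hm0 _ _).trans (add_le_add_left (sum_union_le_add hm0 _ _) _)
      have h2 : ((1 : ℝ) / 4) ^ k ≤ 1 := pow_le_one₀ (by norm_num) (by norm_num)
      have h3 : ((1 : ℝ) / 4) ^ (k + 1) ≤ 1 := pow_le_one₀ (by norm_num) (by norm_num)
      linarith [hbadm k, hbadm (k + 1)]
    simp only [Finset.mem_union, not_or] at hj
    obtain ⟨⟨hj1, hj2⟩, hj3⟩ := hj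
    have hDj : D k j ≤ ε k := by
      simp only [hfar, Finset.mem_filter, Finset.mem_univ, true_and, not_lt] at hj3
      exact le_of_sq_le_sq hj3 (hεpos k).le
    have e1 : ε (k + 1) = 2 * ε k := by simp only [hε]; ring
    have h1 := hgood k j hj1
    have h2 := hgood (k + 1) j hj2
    rw [e1] at h2
    have h3 := (htri k j).2
    have h4 := (abs_le.mp (hcmp k j).le).1
    have h5 := (abs_le.mp (hcmp k i).le).2
    have h6 : ε k ≤ L * ε k := le_mul_of_one_le_left (hεpos k).le hL1
    linarith
  -- the models not handled by the scales before `k`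
  set V : ℕ → Finset ι := fun k => Nat.casesOn k Finset.univ bad with hV
  have hV0 : V 0 = Finset.univ := rfl
  have hVs : ∀ k, V (k + 1) = bad k := fun k => rfl
  have hVm : ∀ k, ∑ i ∈ V k, m i ≤ (1 / 4) ^ k := by
    intro k
    cases k with
    | zero => rw [hV0, hm1]; simp
    | succ k =>
      rw [hVs, pow_succ]
      refine (hbadm k).trans ?_
      have : (0 : ℝ) ≤ (1 / 4) ^ k := by positivity
      linarith
  -- the part of the expected error that is left to scale `k`
  set a : ℕ → ℝ := fun k => ∑ i ∈ V k, m i * (M i).lossL1 (θ k) with ha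
  have hstep : ∀ k, a k ≤ 6 * L * S * (1 / 2) ^ k + a (k + 1) := by
    intro k
    have hr : (0 : ℝ) < (1 / 2) ^ k := by positivity
    have hr4 : ((1 : ℝ) / 4) ^ k = (1 / 2) ^ k * (1 / 2) ^ k := by
      rw [← mul_pow]; norm_num
    have hεr : ε k * (1 / 4) ^ k = 4 * S * (1 / 2) ^ k := by
      rw [hr4]
      simp only [hε]
      have : (2 : ℝ) ^ k * (1 / 2) ^ k = 1 := by rw [← mul_pow]; norm_num
      calc 4 * 2 ^ k * S * ((1 / 2) ^ k * (1 / 2) ^ k) =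
          4 * S * (1 / 2) ^ k * ((2 : ℝ) ^ k * (1 / 2) ^ k) := by ring
        _ = _ := by rw [this, mul_one]
    -- split into the models handled at scale `k` and the others
    have h1 : a k ≤ ∑ i ∈ V k, m i * (L * ε k) +
        ∑ i ∈ bad k, m i * (ρ k i + (M i).lossL1 (θ (k + 1))) := by
      have hnn : ∀ i, 0 ≤ m i * (ρ k i + (M i).lossL1 (θ (k + 1))) := fun i =>
        mul_nonneg (hm0 i) (((M i).lossL1_nonneg _).trans (htri k i).1)
      calc a k ≤ ∑ i ∈ V k, (m i * (L * ε k) +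
            if i ∈ bad k then m i * (ρ k i + (M i).lossL1 (θ (k + 1))) else 0) := by
            refine Finset.sum_le_sum (fun i _ => ?_)
            have hLε : 0 ≤ m i * (L * ε k) :=
              mul_nonneg (hm0 i) (mul_nonneg (by linarith) (hεpos k).le)
            split_ifs with hi
            · have := mul_le_mul_of_nonneg_left (htri k i).1 (hm0 i)
              linarith
            · have := mul_le_mul_of_nonneg_left (hgood k i hi) (hm0 i)
              linarith
        _ = ∑ i ∈ V k, m i * (L * ε k) +
            ∑ i ∈ V k, (if i ∈ bad k then m i * (ρ k i + (M i).lossL1 (θ (k + 1))) else 0) :=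
            Finset.sum_add_distrib
        _ ≤ _ := by
            gcongr
            rw [← Finset.sum_filter]
            exact Finset.sum_le_sum_of_subset_of_nonneg
              (fun i hi => (Finset.mem_filter.mp hi).2) (fun i _ _ => hnn i)
    have h2 : ∑ i ∈ V k, m i * (L * ε k) ≤ 4 * L * S * (1 / 2) ^ k := by
      rw [← Finset.sum_mul]
      calc (∑ i ∈ V k, m i) * (L * ε k) ≤ (1 / 4) ^ k * (L * ε k) := by
            exact mul_le_mul_of_nonneg_right (hVm k) (mul_nonneg (by linarith) (hεpos k).le)
        _ = L * (ε k * (1 / 4) ^ k) := by ring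
        _ = _ := by rw [hεr]; ring
    have h3 : ∑ i ∈ bad k, m i * (ρ k i + (M i).lossL1 (θ (k + 1))) ≤
        2 * L * S * (1 / 2) ^ k + a (k + 1) := by
      simp_rw [mul_add]
      rw [Finset.sum_add_distrib]
      refine add_le_add ?_ (le_of_eq rfl)
      -- the arithmetic–geometric mean inequality, with the ratio that balances the two terms
      have h4 : ∀ i, m i * ρ k i ≤ m i * (5 * L * ε k) +
          ((1 / 2) ^ k / (4 * S) * (m i * D k i ^ 2) + 4 * S / (1 / 2) ^ k * m i) := by
        intro i
        have h5 : 2 * D k i ≤ (1 / 2) ^ k / (4 * S) * D k i ^ 2 + 4 * S / (1 / 2) ^ k := by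
          have e : (1 / 2) ^ k / (4 * S) * D k i ^ 2 + 4 * S / (1 / 2) ^ k - 2 * D k i =
              ((1 / 2) ^ k * D k i - 4 * S) ^ 2 / ((1 / 2) ^ k * (4 * S)) := by
            field_simp; ring
          have : 0 ≤ ((1 / 2) ^ k * D k i - 4 * S) ^ 2 / ((1 / 2) ^ k * (4 * S)) := by positivity
          linarith
        have h6 := mul_le_mul_of_nonneg_left ((hρle k i).trans (add_le_add le_rfl h5)) (hm0 i)
        calc m i * ρ k i ≤ _ := h6
          _ = _ := by ring
      refine (Finset.sum_le_sum (fun i _ => h4 i)).trans ?_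
      rw [Finset.sum_add_distrib, Finset.sum_add_distrib, ← Finset.sum_mul, ← Finset.mul_sum,
        ← Finset.mul_sum]
      have h7 : (∑ i ∈ bad k, m i) * (5 * L * ε k) ≤ 5 / 4 * L * S * (1 / 2) ^ k := by
        calc (∑ i ∈ bad k, m i) * (5 * L * ε k) ≤ ((1 / 4) ^ k / 16) * (5 * L * ε k) := by
              exact mul_le_mul_of_nonneg_right (hbadm k)
                (mul_nonneg (by linarith) (hεpos k).le)
          _ = 5 / 16 * L * (ε k * (1 / 4) ^ k) := by ring
          _ = _ := by rw [hεr]; ring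
      have h8 : (1 / 2) ^ k / (4 * S) * ∑ i ∈ bad k, m i * D k i ^ 2 ≤ S / 4 * (1 / 2) ^ k := by
        calc _ ≤ (1 / 2) ^ k / (4 * S) * S ^ 2 := by
              gcongr
              exact (Finset.sum_le_univ_sum_of_nonneg
                (fun i => mul_nonneg (hm0 i) (sq_nonneg _))).trans (hDS k)
          _ = _ := by field_simp
      have h9 : 4 * S / (1 / 2) ^ k * ∑ i ∈ bad k, m i ≤ S / 4 * (1 / 2) ^ k := by
        calc _ ≤ 4 * S / (1 / 2) ^ k * ((1 / 4) ^ k / 16) := by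
              gcongr
              exact hbadm k
          _ = _ := by rw [hr4]; field_simp; norm_num
      have h10 : S * (1 / 2) ^ k ≤ L * S * (1 / 2) ^ k := by
        rw [mul_assoc]
        exact le_mul_of_one_le_left (by positivity) hL1
      have h11 : 0 ≤ L * S * (1 / 2) ^ k := by positivity
      linarith
    linarith
  have hchain : ∀ K, a 0 ≤ 12 * L * S * (1 - (1 / 2) ^ K) + a K := by
    intro K
    induction K with
    | zero => simp
    | succ K ih =>
      have := hstep K
      rw [pow_succ]
      linarith
  have haK : ∀ K, a K ≤ 2 * (1 / 4) ^ K := by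
    intro K
    calc a K ≤ ∑ i ∈ V K, m i * 2 := Finset.sum_le_sum
          (fun i _ => mul_le_mul_of_nonneg_left ((M i).lossL1_le_two hX _) (hm0 i))
      _ = (∑ i ∈ V K, m i) * 2 := by rw [Finset.sum_mul]
      _ ≤ _ := by linarith [hVm K]
  refine ⟨θ 0, ?_⟩
  have hlim : Filter.Tendsto (fun K : ℕ => 12 * L * S + 2 * (1 / 4 : ℝ) ^ K) Filter.atTop
      (nhds (12 * L * S + 2 * 0)) :=
    tendsto_const_nhds.add ((tendsto_pow_atTop_nhds_zero_of_lt_one (by norm_num)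
      (by norm_num)).const_mul 2)
  rw [mul_zero, add_zero] at hlim
  refine ge_of_tendsto' hlim (fun K => ?_)
  have h1 := hchain K
  have h2 := haK K
  have h3 : 0 ≤ 12 * L * S * (1 / 2) ^ K := by positivity
  have h4 : a 0 = ∑ i, m i * (M i).lossL1 (θ 0) := rfl
  rw [← h4]
  linarith

/-- For every finite prior there are an estimator and a single query whose separation of the models
pays for the expected error of the estimator: the query nearly maximizes the mean-square separation,
so that no other query does better up to `ε²`. -/
theorem exists_estimator_query_of_prior (hd : 1 ≤ d) (hX : X ⊆ Metric.closedBall 0 1)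
    {m : ι → ℝ} (hm0 : ∀ i, 0 ≤ m i) (hm1 : ∑ i, m i = 1) (M : ι → LinModel X)
    (P : ProbabilityMeasure (X × Bool)) {ε : ℝ} (hε : 0 < ε) :
    ∃ (θ : Ball d) (ℓ : Query (X × Bool)), ∑ i, m i * (M i).lossL1 θ ≤
      24 * (decConst * Real.sqrt d) * (ε + (∑ i, m i *
        queryDiv ℓ ((M i).law hX : Measure (X × Bool)) (P : Measure (X × Bool)) ^ 2) / ε) := by
  set g : Query (X × Bool) → ℝ := fun ℓ => ∑ i, m i *
    queryDiv ℓ ((M i).law hX : Measure (X × Bool)) (P : Measure (X × Bool)) ^ 2 with hg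
  have hg0 : ∀ ℓ, 0 ≤ g ℓ := fun ℓ => Finset.sum_nonneg
    (fun i _ => mul_nonneg (hm0 i) (sq_nonneg _))
  have hbdd : BddAbove (Set.range g) := by
    refine ⟨4, ?_⟩
    rintro _ ⟨ℓ, rfl⟩
    calc g ℓ ≤ ∑ i, m i * 4 := Finset.sum_le_sum
          (fun i _ => mul_le_mul_of_nonneg_left (queryDiv_sq_le ℓ _ _) (hm0 i))
      _ = 4 := by rw [← Finset.sum_mul, hm1, one_mul]
  have : Nonempty (Query (X × Bool)) := ⟨⟨fun _ => 0, measurable_const, fun _ => by simp⟩⟩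
  obtain ⟨ℓ, hℓ⟩ := exists_lt_of_lt_ciSup (show iSup g - ε ^ 2 < iSup g by
    have : 0 < ε ^ 2 := by positivity
    linarith)
  have hsup0 : 0 ≤ iSup g := (hg0 ℓ).trans (le_ciSup hbdd ℓ)
  have hSpos : 0 < iSup g + ε ^ 2 := by positivity
  obtain ⟨θ, hθ⟩ := exists_estimator_of_prior hd hX hm0 hm1 M P (Real.sqrt_pos.mpr hSpos)
    (fun ℓ' => by
      rw [Real.sq_sqrt hSpos.le]
      have := le_ciSup hbdd ℓ'
      have h2 : 0 ≤ ε ^ 2 := by positivity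
      exact this.trans (by linarith))
  refine ⟨θ, ℓ, hθ.trans ?_⟩
  have hC : 0 ≤ 12 * (decConst * Real.sqrt d) := by
    have := decConst_pos; positivity
  have hs : Real.sqrt (iSup g + ε ^ 2) ≤ 2 * (ε + g ℓ / ε) := by
    refine Real.sqrt_le_iff.mpr ⟨by have := hg0 ℓ; positivity, ?_⟩
    have h1 : (2 * (ε + g ℓ / ε)) ^ 2 = 4 * ε ^ 2 + 8 * g ℓ + 4 * (g ℓ / ε) ^ 2 := by
      field_simp; ring
    rw [h1]
    have h2 : 0 ≤ (g ℓ / ε) ^ 2 := sq_nonneg _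
    have h3 := hg0 ℓ
    have h4 : 0 ≤ ε ^ 2 := by positivity
    linarith
  calc _ ≤ 12 * (decConst * Real.sqrt d) * (2 * (ε + g ℓ / ε)) :=
        mul_le_mul_of_nonneg_left hs hC
    _ = _ := by ring

end Prior

/-! ### Hellinger-type information gain -/

section Gain

variable {ι : Type*} [Fintype ι] {m w g : ι → ℝ}

/-- The Bhattacharyya coefficients between the weights `w` and the tilted weights `m (1 ± g)` fall
short of `1` by the variance of `g`: Cauchy–Schwarz bounds the square of their sum of squares `Y`
by `Y (1 + ∑ m √(1 - g²))`. -/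
theorem sum_sqrt_tilted_sq_le (hm0 : ∀ i, 0 ≤ m i) (hm1 : ∑ i, m i = 1) (hw0 : ∀ i, 0 ≤ w i)
    (hw1 : ∑ i, w i = 1) (hg : ∀ i, |g i| ≤ 1) (hmg : ∑ i, m i * g i = 0) :
    ((∑ i, Real.sqrt (m i * (1 + g i) * w i)) ^ 2 +
      (∑ i, Real.sqrt (m i * (1 - g i) * w i)) ^ 2) / 2 ≤ 1 - (∑ i, m i * g i ^ 2) / 4 := by
  have hgp : ∀ i, 0 ≤ 1 + g i := fun i => by linarith [(abs_le.mp (hg i)).1]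
  have hgm : ∀ i, 0 ≤ 1 - g i := fun i => by linarith [(abs_le.mp (hg i)).2]
  set a := ∑ i, Real.sqrt (m i * (1 + g i) * w i) with ha
  set b := ∑ i, Real.sqrt (m i * (1 - g i) * w i) with hb
  have ha0 : 0 ≤ a := Finset.sum_nonneg (fun i _ => Real.sqrt_nonneg _)
  have hb0 : 0 ≤ b := Finset.sum_nonneg (fun i _ => Real.sqrt_nonneg _)
  set β := ∑ i, m i * Real.sqrt (1 - g i ^ 2) with hβ
  have hβle : β ≤ 1 - (∑ i, m i * g i ^ 2) / 2 := by
    have h : β ≤ ∑ i, m i * (1 - g i ^ 2 / 2) := by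
      refine Finset.sum_le_sum (fun i _ => mul_le_mul_of_nonneg_left ?_ (hm0 i))
      have h1 : g i ^ 2 ≤ 1 := by rw [← sq_abs]; exact pow_le_one₀ (abs_nonneg _) (hg i)
      refine Real.sqrt_le_iff.mpr ⟨by linarith, ?_⟩
      nlinarith [sq_nonneg (g i ^ 2)]
    refine h.trans (le_of_eq ?_)
    simp_rw [mul_sub, mul_one]
    rw [Finset.sum_sub_distrib, hm1, Finset.sum_div]
    congr 1
    exact Finset.sum_congr rfl (fun i _ => by ring)
  set f : ι → ℝ := fun i => Real.sqrt (m i) *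
    (a * Real.sqrt (1 + g i) + b * Real.sqrt (1 - g i)) with hf
  -- the vector `f` is chosen so that its product with `√w` is `a² + b²`
  have hCS := Finset.sum_mul_sq_le_sq_mul_sq Finset.univ (fun i => Real.sqrt (w i)) f
  have h1 : ∑ i, Real.sqrt (w i) * f i = a ^ 2 + b ^ 2 := by
    have e : a ^ 2 + b ^ 2 = a * ∑ i, Real.sqrt (m i * (1 + g i) * w i) +
        b * ∑ i, Real.sqrt (m i * (1 - g i) * w i) := by rw [← ha, ← hb]; ring
    rw [e, Finset.mul_sum, Finset.mul_sum, ← Finset.sum_add_distrib]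
    refine Finset.sum_congr rfl (fun i _ => ?_)
    rw [Real.sqrt_mul (mul_nonneg (hm0 i) (hgp i)), Real.sqrt_mul (hm0 i),
      Real.sqrt_mul (mul_nonneg (hm0 i) (hgm i)), Real.sqrt_mul (hm0 i)]
    simp only [hf]
    ring
  have h2 : ∑ i, Real.sqrt (w i) ^ 2 = 1 := by
    rw [← hw1]
    exact Finset.sum_congr rfl (fun i _ => Real.sq_sqrt (hw0 i))
  have h3 : ∑ i, f i ^ 2 = a ^ 2 + b ^ 2 + 2 * a * b * β := by
    have h4 : ∀ i, f i ^ 2 = a ^ 2 * m i + b ^ 2 * m i + (a ^ 2 - b ^ 2) * (m i * g i) +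
        2 * a * b * (m i * Real.sqrt (1 - g i ^ 2)) := by
      intro i
      have e1 : Real.sqrt (1 + g i) * Real.sqrt (1 - g i) = Real.sqrt (1 - g i ^ 2) := by
        rw [← Real.sqrt_mul (hgp i)]; congr 1; ring
      have e2 := Real.sq_sqrt (hgp i)
      have e3 := Real.sq_sqrt (hgm i)
      have e4 := Real.sq_sqrt (hm0 i)
      rw [← e1]
      simp only [hf]
      calc _ = Real.sqrt (m i) ^ 2 * (a ^ 2 * Real.sqrt (1 + g i) ^ 2 +
            b ^ 2 * Real.sqrt (1 - g i) ^ 2 +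
            2 * a * b * (Real.sqrt (1 + g i) * Real.sqrt (1 - g i))) := by ring
        _ = _ := by rw [e2, e3, e4]; ring
    simp_rw [h4]
    rw [Finset.sum_add_distrib, Finset.sum_add_distrib, Finset.sum_add_distrib, ← Finset.mul_sum,
      ← Finset.mul_sum, ← Finset.mul_sum, ← Finset.mul_sum, hm1, hmg]
    ring
  rw [h1, h2, h3, one_mul] at hCS
  have hβ0 : 0 ≤ β := Finset.sum_nonneg (fun i _ => mul_nonneg (hm0 i) (Real.sqrt_nonneg _))
  set Y := a ^ 2 + b ^ 2 with hY
  have hY0 : 0 ≤ Y := by positivity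
  have h5 : 2 * a * b * β ≤ Y * β := by
    refine mul_le_mul_of_nonneg_right ?_ hβ0
    nlinarith [sq_nonneg (a - b)]
  have h6 : Y ≤ 1 + β := by
    rcases hY0.eq_or_lt with h0 | h0
    · linarith
    · have : Y * Y ≤ Y * (1 + β) := by nlinarith
      exact le_of_mul_le_mul_left this h0
  linarith

/-- The log-likelihood weights `½ log (m (1 ± g) / w)` turn the exponential-weights gain into the
Bhattacharyya coefficients between the posterior and the reference distribution. -/
theorem exists_weight_gain (hm0 : ∀ i, 0 < m i) (hm1 : ∑ i, m i = 1) (hw0 : ∀ i, 0 < w i)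
    (hw1 : ∑ i, w i = 1) {c : ℝ} (hc : c < 1) (hg : ∀ i, |g i| ≤ c)
    (hmg : ∑ i, m i * g i = 0) {κ : ℝ} (hκ : 0 < κ) (hκm : ∀ i, κ ≤ m i) (hκw : ∀ i, κ ≤ w i) :
    ∃ s : ι → Bool → ℝ, (∀ i o, |s i o| ≤ |Real.log (κ * (1 - c))| + |Real.log (2 / κ)|) ∧
      (∑ i, m i * g i ^ 2) / 4 ≤ ∑ i, m i *
        ((1 + g i) / 2 * ∑ j, w j * (1 - Real.exp (s j true - s i true)) +
          (1 - g i) / 2 * ∑ j, w j * (1 - Real.exp (s j false - s i false))) := by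
  have hgp : ∀ i, 1 - c ≤ 1 + g i := fun i => by linarith [(abs_le.mp (hg i)).1]
  have hgm : ∀ i, 1 - c ≤ 1 - g i := fun i => by linarith [(abs_le.mp (hg i)).2]
  have hg1 : ∀ i, |g i| ≤ 1 := fun i => (hg i).trans hc.le
  have hm1' : ∀ i, m i ≤ 1 := fun i => by
    rw [← hm1]; exact Finset.single_le_sum (fun j _ => (hm0 j).le) (Finset.mem_univ i)
  have hw1' : ∀ i, w i ≤ 1 := fun i => by
    rw [← hw1]; exact Finset.single_le_sum (fun j _ => (hw0 j).le) (Finset.mem_univ i)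
  set u : ι → Bool → ℝ := fun i o => if o then 1 + g i else 1 - g i with hu
  have hu0 : ∀ i o, 1 - c ≤ u i o := fun i o => by cases o <;> simp [hu, hgp, hgm]
  have hu2 : ∀ i o, u i o ≤ 2 := fun i o => by
    have h := abs_le.mp (hg1 i)
    cases o
    · simp only [hu, Bool.false_eq_true, if_false]; linarith
    · simp only [hu, if_true]; linarith
  have hupos : ∀ i o, 0 < u i o := fun i o => lt_of_lt_of_le (by linarith) (hu0 i o)
  refine ⟨fun i o => Real.log (m i * u i o / w i) / 2, fun i o => ?_, ?_⟩
  · have hpos : 0 < m i * u i o / w i := div_pos (mul_pos (hm0 i) (hupos i o)) (hw0 i)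
    have h1 : κ * (1 - c) ≤ m i * u i o / w i := by
      rw [le_div_iff₀ (hw0 i)]
      calc κ * (1 - c) * w i ≤ κ * (1 - c) * 1 :=
            mul_le_mul_of_nonneg_left (hw1' i) (mul_nonneg hκ.le (by linarith))
        _ ≤ m i * u i o := by
            rw [mul_one]; exact mul_le_mul (hκm i) (hu0 i o) (by linarith) (hm0 i).le
    have h2 : m i * u i o / w i ≤ 2 / κ := by
      refine div_le_div₀ (by norm_num) ?_ hκ (hκw i)
      nlinarith [hm1' i, hu2 i o, hm0 i, hupos i o]
    have h3 := Real.log_le_log (mul_pos hκ (by linarith)) h1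
    have h4 := Real.log_le_log hpos h2
    have h5 : |Real.log (m i * u i o / w i)| ≤ |Real.log (κ * (1 - c))| + |Real.log (2 / κ)| := by
      rw [abs_le]
      have := neg_abs_le (Real.log (κ * (1 - c)))
      have := le_abs_self (Real.log (2 / κ))
      have := abs_nonneg (Real.log (κ * (1 - c)))
      have := abs_nonneg (Real.log (2 / κ))
      constructor <;> linarith
    rw [abs_div, abs_two]
    linarith [abs_nonneg (Real.log (m i * u i o / w i))]
  -- `w_j e^{s_j - s_i} · m_i u_i` is the product of the Bhattacharyya terms of `i` and `j`
  · have hexp : ∀ i j o, w j * Real.exp (Real.log (m j * u j o / w j) / 2 -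
        Real.log (m i * u i o / w i) / 2) * (m i * u i o) =
          Real.sqrt (m j * u j o * w j) * Real.sqrt (m i * u i o * w i) := by
      intro i j o
      have hr : ∀ k, 0 < m k * u k o / w k := fun k => div_pos (mul_pos (hm0 k) (hupos k o)) (hw0 k)
      have hs : ∀ k, Real.exp (Real.log (m k * u k o / w k) / 2) =
          Real.sqrt (m k * u k o * w k) / w k := by
        intro k
        rw [Real.exp_half, Real.exp_log (hr k), eq_div_iff (hw0 k).ne']
        nth_rw 2 [← Real.sqrt_sq (hw0 k).le]
        rw [← Real.sqrt_mul (hr k).le]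
        congr 1
        have := (hw0 k).ne'
        field_simp
      have hi : 0 < m i * u i o * w i := mul_pos (mul_pos (hm0 i) (hupos i o)) (hw0 i)
      have hsq := Real.mul_self_sqrt hi.le
      have hne := (Real.sqrt_pos.mpr hi).ne'
      rw [Real.exp_sub, hs, hs]
      have h1 := (hw0 i).ne'
      have h2 := (hw0 j).ne'
      field_simp
      rw [sq, hsq]
      ring
    have hsum : ∀ o, ∑ i, m i * u i o * ∑ j, w j * (1 - Real.exp
        (Real.log (m j * u j o / w j) / 2 - Real.log (m i * u i o / w i) / 2)) =
        ∑ i, m i * u i o - (∑ i, Real.sqrt (m i * u i o * w i)) ^ 2 := by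
      intro o
      rw [sq, Finset.sum_mul_sum, ← Finset.sum_sub_distrib]
      refine Finset.sum_congr rfl (fun i _ => ?_)
      simp_rw [mul_sub, mul_one]
      rw [Finset.sum_sub_distrib, hw1, mul_sub, mul_one, Finset.mul_sum]
      congr 1
      refine Finset.sum_congr rfl (fun j _ => ?_)
      rw [mul_comm, hexp, mul_comm]
    have h1 := hsum true
    have h2 := hsum false
    have h3 := sum_sqrt_tilted_sq_le (fun i => (hm0 i).le) hm1 (fun i => (hw0 i).le) hw1 hg1 hmg
    have e1 : ∑ i, m i * (1 + g i) = 1 := by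
      simp_rw [mul_add, mul_one]; rw [Finset.sum_add_distrib, hm1, hmg, add_zero]
    have e2 : ∑ i, m i * (1 - g i) = 1 := by
      simp_rw [mul_sub, mul_one]; rw [Finset.sum_sub_distrib, hm1, hmg, sub_zero]
    simp only [hu, if_true, Bool.false_eq_true, if_false] at h1 h2 ⊢
    rw [e1] at h1
    rw [e2] at h2
    have h4 : ∀ A B : ι → ℝ, ∑ i, m i * ((1 + g i) / 2 * A i + (1 - g i) / 2 * B i) =
        (∑ i, m i * (1 + g i) * A i + ∑ i, m i * (1 - g i) * B i) / 2 := by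
      intro A B
      rw [← Finset.sum_add_distrib, Finset.sum_div]
      exact Finset.sum_congr rfl (fun i _ => by ring)
    rw [h4, h1, h2]
    linarith

end Gain

/-! ### A minimax theorem against finitely many strategies -/

/-- If every mixed strategy of a finite adversary admits a reply of value at most `V`, some mixture
of replies has value less than `V'` against every pure strategy, for any `V' > V`: otherwise the
mixtures could be separated from the open convex set `{f | f < V'}` by a functional, whose
normalization would be a mixed strategy without a good reply. -/
theorem exists_mem_convexHull_lt {A : Type*} [Fintype A] {K : Set (A → ℝ)} (hK : K.Nonempty)
    {V V' : ℝ} (hV : V < V')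
    (h : ∀ μ : A → ℝ, (∀ a, 0 ≤ μ a) → ∑ a, μ a = 1 → ∃ k ∈ K, ∑ a, μ a * k a ≤ V) :
    ∃ k ∈ convexHull ℝ K, ∀ a, k a < V' := by
  classical
  by_contra hcon
  push Not at hcon
  set U : Set (A → ℝ) := Set.univ.pi (fun _ => Set.Iio V') with hU
  have hUc : Convex ℝ U := convex_pi (fun _ _ => convex_Iio V')
  have hUo : IsOpen U := isOpen_set_pi Set.finite_univ (fun _ _ => isOpen_Iio)
  have hdisj : Disjoint U (convexHull ℝ K) := by
    rw [Set.disjoint_left]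
    intro k hk hkK
    obtain ⟨a, ha⟩ := hcon k hkK
    exact absurd (hk a (Set.mem_univ a)) (not_lt.mpr ha)
  obtain ⟨f, r, hfU, hfK⟩ := geometric_hahn_banach_open hUc hUo (convex_convexHull ℝ K) hdisj
  set ν : A → ℝ := fun a => f (Pi.single a 1) with hν
  have hfν : ∀ k, f k = ∑ a, ν a * k a := by
    intro k
    conv_lhs => rw [← Finset.univ_sum_single k]
    rw [map_sum]
    refine Finset.sum_congr rfl (fun a _ => ?_)
    have : (Pi.single a (k a) : A → ℝ) = k a • (Pi.single a (1 : ℝ) : A → ℝ) := by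
      rw [← Pi.single_smul, smul_eq_mul, mul_one]
    rw [this, map_smul, smul_eq_mul, mul_comm]
  -- the open set is unbounded below in every coordinate, so the functional is nonnegative
  have hν0 : ∀ a, 0 ≤ ν a := by
    intro a
    by_contra hneg
    push Not at hneg
    set base : A → ℝ := fun _ => V' - 1 with hbase
    obtain ⟨n, hn⟩ := exists_nat_gt ((r - f base) / (-ν a))
    have hmem : base - (n : ℝ) • (Pi.single a (1 : ℝ) : A → ℝ) ∈ U := by
      intro b _
      have h1 : (0 : ℝ) ≤ (Pi.single a (1 : ℝ) : A → ℝ) b := by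
        rw [Pi.single_apply]; split_ifs <;> norm_num
      have h2 : (0 : ℝ) ≤ (n : ℝ) * (Pi.single a (1 : ℝ) : A → ℝ) b := by positivity
      simp only [Set.mem_Iio, Pi.sub_apply, Pi.smul_apply, smul_eq_mul, hbase]
      linarith
    have h3 := hfU _ hmem
    rw [map_sub, map_smul, smul_eq_mul] at h3
    rw [div_lt_iff₀ (by linarith)] at hn
    linarith
  -- constant vectors below `V'` lie in the open set, which rules out a zero functional
  have hVmem : ∀ t < V', t * ∑ a, ν a < r := by
    intro t ht
    have h1 := hfU (fun _ => t) (fun a _ => ht)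
    rw [hfν, ← Finset.sum_mul, mul_comm] at h1
    exact h1
  have hνpos : 0 < ∑ a, ν a := by
    refine lt_of_le_of_ne (Finset.sum_nonneg (fun a _ => hν0 a)) (fun h0 => ?_)
    have hz : ∀ a, ν a = 0 := fun a =>
      (Finset.sum_eq_zero_iff_of_nonneg (fun a _ => hν0 a)).mp h0.symm a (Finset.mem_univ a)
    obtain ⟨k, hk⟩ := hK
    have h1 := hfK k (subset_convexHull ℝ K hk)
    have h2 := hVmem V hV
    rw [hfν] at h1
    simp only [hz, zero_mul, Finset.sum_const_zero, mul_zero] at h1 h2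
    linarith
  obtain ⟨k, hk, hkV⟩ := h (fun a => ν a / ∑ b, ν b) (fun a => div_nonneg (hν0 a) hνpos.le)
    (by rw [← Finset.sum_div, div_self hνpos.ne'])
  have h1 := hfK k (subset_convexHull ℝ K hk)
  rw [hfν] at h1
  have h2 : ∑ a, ν a * k a ≤ V * ∑ a, ν a := by
    have e : ∑ a, (ν a / ∑ b, ν b) * k a = (∑ a, ν a * k a) / ∑ b, ν b := by
      rw [Finset.sum_div]
      exact Finset.sum_congr rfl (fun a _ => by ring)
    rw [e, div_le_iff₀ hνpos] at hkV
    exact hkV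
  have h3 := hVmem V hV
  linarith

/-! ### Finite mixtures and binary channels -/

/-- Finite mixtures of probability measures, through their integrals. -/
theorem exists_finite_mixture {Ω ι : Type*} [MeasurableSpace Ω] [Fintype ι] {m : ι → ℝ}
    (hm0 : ∀ i, 0 ≤ m i) (hm1 : ∑ i, m i = 1) (ν : ι → ProbabilityMeasure Ω) :
    ∃ P : ProbabilityMeasure Ω, ∀ f : Ω → ℝ, (∀ i, Integrable f (ν i : Measure Ω)) →
      ∫ x, f x ∂(P : Measure Ω) = ∑ i, m i * ∫ x, f x ∂(ν i : Measure Ω) := by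
  refine ⟨⟨∑ i, ENNReal.ofReal (m i) • (ν i : Measure Ω), ⟨?_⟩⟩, fun f hf => ?_⟩
  · rw [Measure.coe_finsetSum, Finset.sum_apply]
    simp only [Measure.smul_apply, measure_univ, smul_eq_mul, mul_one]
    rw [← ENNReal.ofReal_sum_of_nonneg (fun i _ => hm0 i), hm1, ENNReal.ofReal_one]
  · simp only [ProbabilityMeasure.coe_mk]
    rw [integral_finsetSum_measure
      (fun i _ => (hf i).smul_measure ENNReal.ofReal_ne_top)]
    refine Finset.sum_congr rfl (fun i _ => ?_)
    rw [integral_smul_measure, ENNReal.toReal_ofReal (hm0 i), smul_eq_mul]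

section BinaryChannel

variable {Z : Type} [MeasurableSpace Z]

theorem measurable_rad {g : Z → ℝ} (hg : Measurable g) : Measurable (fun z => rad (g z)) := by
  refine Measure.measurable_of_measurable_coe _ (fun E hE => ?_)
  simp only [rad, Measure.add_apply, Measure.smul_apply, smul_eq_mul]
  exact ((((measurable_const.add hg).div_const 2).ennreal_ofReal).mul_const _).add
    ((((measurable_const.sub hg).div_const 2).ennreal_ofReal).mul_const _)

/-- The channel `z ↦ Rad(g z)` for `g` with values in `[-c, c]`, which is `α`-DP as soon as
`1 + c ≤ e^α (1 - c)`. -/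
noncomputable def binaryChannel (α : ℝ) {g : Z → ℝ} (hg : Measurable g) {c : ℝ} (hc : c ≤ 1)
    (hgc : ∀ z, |g z| ≤ c) (hα : 1 + c ≤ Real.exp α * (1 - c)) : Channel α Z Bool where
  kernel := ⟨fun z => rad (g z), measurable_rad hg⟩
  isMarkov := ⟨fun z => isProbabilityMeasure_rad ((hgc z).trans hc)⟩
  private_le z z' E hE := by
    show rad (g z) E ≤ ENNReal.ofReal (Real.exp α) * rad (g z') E
    obtain ⟨h1, h2⟩ := abs_le.mp (hgc z)
    obtain ⟨h3, h4⟩ := abs_le.mp (hgc z')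
    have he := (Real.exp_pos α).le
    simp only [rad, Measure.add_apply, Measure.smul_apply, smul_eq_mul]
    rw [mul_add, ← mul_assoc, ← mul_assoc, ← ENNReal.ofReal_mul he, ← ENNReal.ofReal_mul he]
    gcongr
    · have : Real.exp α * (1 - c) ≤ Real.exp α * (1 + g z') :=
        mul_le_mul_of_nonneg_left (by linarith) he
      linarith
    · have : Real.exp α * (1 - c) ≤ Real.exp α * (1 - g z') :=
        mul_le_mul_of_nonneg_left (by linarith) he
      linarith

theorem integral_binaryChannel_push {α : ℝ} {g : Z → ℝ} (hg : Measurable g) {c : ℝ} (hc : c ≤ 1)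
    (hgc : ∀ z, |g z| ≤ c) (hα : 1 + c ≤ Real.exp α * (1 - c)) (P : ProbabilityMeasure Z)
    (f : Bool → ℝ) :
    ∫ o, f o ∂((binaryChannel α hg hc hgc hα).push P) =
      (1 + ∫ z, g z ∂(P : Measure Z)) / 2 * f true +
        (1 - ∫ z, g z ∂(P : Measure Z)) / 2 * f false := by
  have hgi : Integrable g (P : Measure Z) := integrable_of_bounded hg hgc
  have := (binaryChannel α hg hc hgc hα).isMarkov
  have hpush : (binaryChannel α hg hc hgc hα).push P =
      ((P : Measure Z) ⊗ₘ (binaryChannel α hg hc hgc hα).kernel).snd :=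
    (Measure.snd_compProd _ _).symm
  have hf : Measurable f := measurable_from_top
  have hb : ∀ b, |f b| ≤ |f true| + |f false| := fun b => by
    cases b
    · exact le_add_of_nonneg_left (abs_nonneg _)
    · exact le_add_of_nonneg_right (abs_nonneg _)
  rw [hpush, Measure.snd, integral_map measurable_snd.aemeasurable hf.aestronglyMeasurable,
    Measure.integral_compProd (integrable_of_bounded
      (f := fun x : Z × Bool => f x.2) (hf.comp measurable_snd) (fun x => hb x.2))]
  have h1 : ∀ z, ∫ o, f o ∂((binaryChannel α hg hc hgc hα).kernel z) =
      (1 + g z) / 2 * f true + (1 - g z) / 2 * f false := fun z =>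
    integral_rad ((hgc z).trans hc) f
  simp_rw [h1]
  have i1 : Integrable (fun z => (1 + g z) / 2 * f true) (P : Measure Z) :=
    (((integrable_const 1).add hgi).div_const 2).mul_const _
  have i2 : Integrable (fun z => (1 - g z) / 2 * f false) (P : Measure Z) :=
    (((integrable_const 1).sub hgi).div_const 2).mul_const _
  rw [integral_add i1 i2, integral_mul_const, integral_mul_const, integral_div, integral_div,
    integral_add (integrable_const _) hgi, integral_sub (integrable_const _) hgi]
  simp

end BinaryChannel

/-! ### The value of exploration-by-optimization -/

section PureStrategies

variable {d : ℕ} {X : Set (EuclideanSpace ℝ (Fin d))} {Θ : Finset (Ball d)}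

/-- The expected exponential-weights gain when a binary observation has mean `a`, the parameter is
`ψ` and the weights are `s`. -/
noncomputable def binaryGain (w : Θ → ℝ) (s : Θ → Bool → ℝ) (a : ℝ) (ψ : Θ) : ℝ :=
  (1 + a) / 2 * ∑ j, w j * (1 - Real.exp (s j true - s ψ true)) +
    (1 - a) / 2 * ∑ j, w j * (1 - Real.exp (s j false - s ψ false))

/-- The objective at a point mass at `x`, for the decision `θ`, the channel `z ↦ Rad(g z)` and the
weights `s`. -/
noncomputable def pointObj (w : Θ → ℝ) (γ : ℝ) (θ : Ball d) (g : X × Bool → ℝ) (s : Θ → Bool → ℝ)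
    (x : X) (ψ : Θ) : ℝ :=
  |inner ℝ (x : EuclideanSpace ℝ (Fin d)) ((θ : EuclideanSpace ℝ (Fin d)) - (ψ : Ball d))| -
    γ * binaryGain w s
      ((1 + inner ℝ (x : EuclideanSpace ℝ (Fin d)) ((ψ : Ball d) : EuclideanSpace ℝ (Fin d))) / 2
          * g (x, true) +
        (1 - inner ℝ (x : EuclideanSpace ℝ (Fin d)) ((ψ : Ball d) : EuclideanSpace ℝ (Fin d))) / 2
          * g (x, false)) ψ

theorem binaryGain_le_one {w : Θ → ℝ} (hw0 : ∀ ψ, 0 ≤ w ψ) (hw1 : ∑ ψ, w ψ = 1)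
    (s : Θ → Bool → ℝ) {a : ℝ} (ha : |a| ≤ 1) (ψ : Θ) : binaryGain w s a ψ ≤ 1 := by
  obtain ⟨h1, h2⟩ := abs_le.mp ha
  have h : ∀ o, ∑ j, w j * (1 - Real.exp (s j o - s ψ o)) ≤ 1 := fun o => by
    rw [← hw1]
    refine Finset.sum_le_sum (fun j _ => ?_)
    nlinarith [hw0 j, Real.exp_pos (s j o - s ψ o)]
  have h3 := mul_le_mul_of_nonneg_left (h true) (show 0 ≤ (1 + a) / 2 by linarith)
  have h4 := mul_le_mul_of_nonneg_left (h false) (show 0 ≤ (1 - a) / 2 by linarith)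
  unfold binaryGain
  linarith

theorem binaryGain_sub_le {w : Θ → ℝ} (hw0 : ∀ ψ, 0 ≤ w ψ) (hw1 : ∑ ψ, w ψ = 1)
    {s : Θ → Bool → ℝ} {B : ℝ} (hs : ∀ ψ o, |s ψ o| ≤ B) (a b : ℝ) (ψ : Θ) :
    binaryGain w s a ψ - binaryGain w s b ψ ≤ |a - b| * Real.exp (2 * B) := by
  have hB : 0 ≤ B := (abs_nonneg _).trans (hs ψ true)
  have h : ∀ o, |∑ j, w j * (1 - Real.exp (s j o - s ψ o))| ≤ Real.exp (2 * B) := fun o => by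
    refine (Finset.abs_sum_le_sum_abs _ _).trans ?_
    calc ∑ j, |w j * (1 - Real.exp (s j o - s ψ o))| ≤ ∑ j, w j * Real.exp (2 * B) := by
          refine Finset.sum_le_sum (fun j _ => ?_)
          rw [abs_mul, abs_of_nonneg (hw0 j)]
          refine mul_le_mul_of_nonneg_left ?_ (hw0 j)
          have h1 := (abs_le.mp (hs j o)).2
          have h2 := (abs_le.mp (hs ψ o)).1
          have h3 : Real.exp (s j o - s ψ o) ≤ Real.exp (2 * B) :=
            Real.exp_le_exp.mpr (by linarith)
          have h4 : 1 ≤ Real.exp (2 * B) := Real.one_le_exp (by linarith)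
          have h5 := Real.exp_pos (s j o - s ψ o)
          rw [abs_le]
          constructor <;> linarith
      _ = Real.exp (2 * B) := by rw [← Finset.sum_mul, hw1, one_mul]
  have e : binaryGain w s a ψ - binaryGain w s b ψ =
      (a - b) * ((∑ j, w j * (1 - Real.exp (s j true - s ψ true)) -
        ∑ j, w j * (1 - Real.exp (s j false - s ψ false))) / 2) := by
    unfold binaryGain; ring
  rw [e]
  refine (le_abs_self _).trans ?_
  rw [abs_mul]
  refine mul_le_mul_of_nonneg_left ?_ (abs_nonneg _)
  have h1 := abs_le.mp (h true)
  have h2 := abs_le.mp (h false)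
  rw [abs_le]
  constructor <;> linarith

theorem integral_binaryGain {Ω : Type*} [MeasurableSpace Ω] (P : Measure Ω)
    [IsProbabilityMeasure P] (w : Θ → ℝ) (s : Θ → Bool → ℝ) {a : Ω → ℝ} (ha : Integrable a P)
    (ψ : Θ) : Integrable (fun x => binaryGain w s (a x) ψ) P ∧
      ∫ x, binaryGain w s (a x) ψ ∂P = binaryGain w s (∫ x, a x ∂P) ψ := by
  unfold binaryGain
  have i1 : Integrable (fun x => (1 + a x) / 2 *
      ∑ j, w j * (1 - Real.exp (s j true - s ψ true))) P :=
    (((integrable_const 1).add ha).div_const 2).mul_const _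
  have i2 : Integrable (fun x => (1 - a x) / 2 *
      ∑ j, w j * (1 - Real.exp (s j false - s ψ false))) P :=
    (((integrable_const 1).sub ha).div_const 2).mul_const _
  refine ⟨i1.add i2, ?_⟩
  rw [integral_add i1 i2, integral_mul_const, integral_mul_const, integral_div, integral_div,
    integral_add (integrable_const _) ha, integral_sub (integrable_const _) ha]
  simp

/-- The objective is affine in the covariate distribution. -/
theorem integral_pointObj (hX : X ⊆ Metric.closedBall 0 1) (w : Θ → ℝ) (γ : ℝ) (θ : Ball d)
    {g : X × Bool → ℝ} (hg : Measurable g) {c : ℝ} (hgc : ∀ z, |g z| ≤ c) (s : Θ → Bool → ℝ)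
    (M : LinModel X) (ψ : Θ) (hM : M.param = ψ) :
    Integrable (fun x => pointObj w γ θ g s x ψ) (M.cov : Measure X) ∧
      ∫ x, pointObj w γ θ g s x ψ ∂(M.cov : Measure X) = M.lossL1 θ -
        γ * binaryGain w s (∫ z, g z ∂(M.law hX : Measure (X × Bool))) ψ := by
  rw [M.integral_law hX hg hgc, LinModel.lossL1, hM]
  have hmi : Measurable (fun x : X => inner ℝ (x : EuclideanSpace ℝ (Fin d))
      ((ψ : Ball d) : EuclideanSpace ℝ (Fin d))) := measurable_inner_covariate _
  have ha : Integrable (fun x : X =>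
      (1 + inner ℝ (x : EuclideanSpace ℝ (Fin d)) ((ψ : Ball d) : EuclideanSpace ℝ (Fin d))) / 2
          * g (x, true) +
        (1 - inner ℝ (x : EuclideanSpace ℝ (Fin d)) ((ψ : Ball d) : EuclideanSpace ℝ (Fin d))) / 2
          * g (x, false)) (M.cov : Measure X) := by
    refine integrable_of_bounded (C := c) ?_ (fun x => ?_)
    · exact (((measurable_const.add hmi).div_const 2).mul
        (hg.comp (measurable_id.prodMk measurable_const))).add
        (((measurable_const.sub hmi).div_const 2).mul
          (hg.comp (measurable_id.prodMk measurable_const)))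
    · have h1 := abs_le.mp (abs_inner_param_le hX x ψ)
      have h2 := abs_le.mp (hgc (x, true))
      have h3 := abs_le.mp (hgc (x, false))
      rw [abs_le]
      constructor <;> nlinarith
  obtain ⟨i1, h1⟩ := integral_binaryGain (M.cov : Measure X) w s ha ψ
  have i0 := integrable_abs_inner hX (M.cov : Measure X)
    ((θ : EuclideanSpace ℝ (Fin d)) - (ψ : Ball d))
  unfold pointObj
  refine ⟨i0.sub (i1.const_mul γ), ?_⟩
  rw [integral_sub i0 (i1.const_mul γ), integral_const_mul, h1]

theorem neg_le_pointObj (hX : X ⊆ Metric.closedBall 0 1) {w : Θ → ℝ} (hw0 : ∀ ψ, 0 ≤ w ψ)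
    (hw1 : ∑ ψ, w ψ = 1) {γ : ℝ} (hγ : 0 ≤ γ) (θ : Ball d) {g : X × Bool → ℝ}
    (hgc : ∀ z, |g z| ≤ 1) (s : Θ → Bool → ℝ) (x : X) (ψ : Θ) :
    -γ ≤ pointObj w γ θ g s x ψ := by
  have h1 := abs_le.mp (abs_inner_param_le hX x ψ)
  have h2 := abs_le.mp (hgc (x, true))
  have h3 := abs_le.mp (hgc (x, false))
  have h4 := mul_le_mul_of_nonneg_left (binaryGain_le_one hw0 hw1 s (a :=
      (1 + inner ℝ (x : EuclideanSpace ℝ (Fin d)) ((ψ : Ball d) : EuclideanSpace ℝ (Fin d))) / 2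
          * g (x, true) +
        (1 - inner ℝ (x : EuclideanSpace ℝ (Fin d)) ((ψ : Ball d) : EuclideanSpace ℝ (Fin d))) / 2
          * g (x, false)) (by rw [abs_le]; constructor <;> nlinarith) ψ) hγ
  unfold pointObj
  linarith [abs_nonneg (inner ℝ (x : EuclideanSpace ℝ (Fin d))
    ((θ : EuclideanSpace ℝ (Fin d)) - (ψ : Ball d)))]

/-- Rounding the covariate seen by the channel changes the objective only slightly. -/
theorem pointObj_round_le {w : Θ → ℝ} (hw0 : ∀ ψ, 0 ≤ w ψ)
    (hw1 : ∑ ψ, w ψ = 1) {γ : ℝ} (hγ : 0 ≤ γ) (θ : Ball d) {g : X × Bool → ℝ}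
    (hgc : ∀ z, |g z| ≤ 1) {s : Θ → Bool → ℝ} {B : ℝ} (hs : ∀ ψ o, |s ψ o| ≤ B)
    {r : X → X} {ρ : ℝ}
    (hr : ∀ x : X, ‖(x : EuclideanSpace ℝ (Fin d)) - (r x : EuclideanSpace ℝ (Fin d))‖ ≤ ρ)
    (x : X) (ψ : Θ) :
    pointObj w γ θ (fun z => g (r z.1, z.2)) s x ψ ≤
      pointObj w γ θ g s (r x) ψ + ρ * (2 + γ * Real.exp (2 * B)) := by
  have hin : ∀ v : EuclideanSpace ℝ (Fin d), |inner ℝ (x : EuclideanSpace ℝ (Fin d)) v -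
      inner ℝ (r x : EuclideanSpace ℝ (Fin d)) v| ≤ ρ * ‖v‖ := fun v => by
    rw [← inner_sub_left]
    exact (abs_real_inner_le_norm _ _).trans
      (mul_le_mul_of_nonneg_right (hr x) (norm_nonneg _))
  have hρ : 0 ≤ ρ := (norm_nonneg _).trans (hr x)
  have h1 : |inner ℝ (x : EuclideanSpace ℝ (Fin d)) ((θ : EuclideanSpace ℝ (Fin d)) - (ψ : Ball d))|
      ≤ |inner ℝ (r x : EuclideanSpace ℝ (Fin d))
        ((θ : EuclideanSpace ℝ (Fin d)) - (ψ : Ball d))| + ρ * 2 := by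
    have h2 := (abs_sub_abs_le_abs_sub _ _).trans (hin
      ((θ : EuclideanSpace ℝ (Fin d)) - (ψ : Ball d)))
    have h3 := mul_le_mul_of_nonneg_left (θ.norm_sub_le (ψ : Ball d)) hρ
    linarith
  have h4 := (hin ((ψ : Ball d) : EuclideanSpace ℝ (Fin d))).trans
    (mul_le_of_le_one_right hρ (ψ : Ball d).norm_le)
  set a := inner ℝ (x : EuclideanSpace ℝ (Fin d)) ((ψ : Ball d) : EuclideanSpace ℝ (Fin d))
  set b := inner ℝ (r x : EuclideanSpace ℝ (Fin d)) ((ψ : Ball d) : EuclideanSpace ℝ (Fin d))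
  have h5 : |((1 + b) / 2 * g (r x, true) + (1 - b) / 2 * g (r x, false)) -
      ((1 + a) / 2 * g (r x, true) + (1 - a) / 2 * g (r x, false))| ≤ ρ := by
    rw [show ((1 + b) / 2 * g (r x, true) + (1 - b) / 2 * g (r x, false)) -
      ((1 + a) / 2 * g (r x, true) + (1 - a) / 2 * g (r x, false)) =
      (a - b) * ((g (r x, false) - g (r x, true)) / 2) by ring, abs_mul]
    have h6 : |(g (r x, false) - g (r x, true)) / 2| ≤ 1 := by
      have h2 := abs_le.mp (hgc (r x, true))
      have h3 := abs_le.mp (hgc (r x, false))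
      rw [abs_le]
      constructor <;> linarith
    calc _ ≤ ρ * 1 := mul_le_mul h4 h6 (abs_nonneg _) hρ
      _ = ρ := mul_one ρ
  have h7 := mul_le_mul_of_nonneg_left ((binaryGain_sub_le hw0 hw1 hs _ _ ψ).trans
    (mul_le_mul_of_nonneg_right h5 (Real.exp_pos (2 * B)).le)) hγ
  unfold pointObj
  linarith

theorem exists_finite_rounding (hX : X ⊆ Metric.closedBall 0 1) {ρ : ℝ} (hρ : 0 < ρ) :
    ∃ (n : ℕ) (u : Fin n → X) (r : X → Fin n), Measurable r ∧
      ∀ x : X, ‖(x : EuclideanSpace ℝ (Fin d)) - (u (r x) : EuclideanSpace ℝ (Fin d))‖ ≤ ρ := by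
  classical
  obtain ⟨t, htX, htf, ht⟩ := Metric.finite_approx_of_totallyBounded
    ((isCompact_closedBall (0 : EuclideanSpace ℝ (Fin d)) 1).totallyBounded.subset hX) ρ hρ
  have := htf.fintype
  set n := Fintype.card t
  let e : t ≃ Fin n := Fintype.equivFin t
  let u : Fin n → X := fun i => ⟨(e.symm i : EuclideanSpace ℝ (Fin d)), htX (e.symm i).2⟩
  let p : X → ℕ → Prop := fun x k => ∃ h : k < n, dist x (u ⟨k, h⟩) ≤ ρ
  have hp : ∀ x, ∃ k, p x k := by
    intro x
    obtain ⟨y, hy⟩ := Set.mem_iUnion.mp (ht x.2)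
    obtain ⟨hyt, hxy⟩ := Set.mem_iUnion.mp hy
    refine ⟨e ⟨y, hyt⟩, (e ⟨y, hyt⟩).2, ?_⟩
    have : u ⟨(e ⟨y, hyt⟩ : ℕ), (e ⟨y, hyt⟩).2⟩ = ⟨y, htX hyt⟩ := by
      simp [u]
    rw [this, Subtype.dist_eq]
    exact (Metric.mem_ball.mp hxy).le
  have hm : ∀ k, MeasurableSet {x | p x k} := by
    intro k
    by_cases hk : k < n
    · have : {x | p x k} = {x | dist x (u ⟨k, hk⟩) ≤ ρ} := by
        ext x; simp [p, hk]
      rw [this]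
      exact measurableSet_le (measurable_id.dist measurable_const) measurable_const
    · have : {x | p x k} = ∅ := by
        ext x; simp [p, hk]
      rw [this]
      exact MeasurableSet.empty
  refine ⟨n, u, fun x => ⟨Nat.find (hp x), (Nat.find_spec (hp x)).1⟩, ?_, fun x => ?_⟩
  · refine measurable_to_countable' (fun i => ?_)
    have h := measurable_find hp hm (measurableSet_singleton (i : ℕ))
    convert h using 1
    ext x
    simp [Fin.ext_iff]
  · have h := (Nat.find_spec (hp x)).2
    rwa [Subtype.dist_eq, dist_eq_norm] at h

end PureStrategies

section Value

variable {d : ℕ} {X : Set (EuclideanSpace ℝ (Fin d))} {Θ : Finset (Ball d)}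

/-- The constant in the bound `6 · exoConst · d / (γ c²)` on the value of exploration-by-optimization.
It is `4 K² / d` for the constant `K = 24 · decConst · √d` in the bound on the expected error under a
finite prior. -/
noncomputable def exoConst : ℝ := (24 * decConst) ^ 2 * 4

theorem exoConst_pos : 0 < exoConst := by
  have := decConst_pos
  unfold exoConst
  positivity

/-- Against a prior over the parameters, the learner has a reply for which the information gain pays
for the estimation error: it observes a privatized version of the most informative query. -/
theorem exists_reply (hd : 1 ≤ d) (hX : X ⊆ Metric.closedBall 0 1) {w m : Θ → ℝ}
    (hw0 : ∀ ψ, 0 < w ψ) (hw1 : ∑ ψ, w ψ = 1) (hm0 : ∀ ψ, 0 < m ψ) (hm1 : ∑ ψ, m ψ = 1)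
    {γ : ℝ} (hγ : 0 < γ) {c : ℝ} (hc0 : 0 < c) (hc : c < 1)
    {κ : ℝ} (hκ : 0 < κ) (hκm : ∀ ψ, κ ≤ m ψ) (hκw : ∀ ψ, κ ≤ w ψ) (M : Θ → LinModel X) :
    ∃ (θ : Ball d) (g : X × Bool → ℝ) (s : Θ → Bool → ℝ), Measurable g ∧ (∀ z, |g z| ≤ c) ∧
      (∀ ψ o, |s ψ o| ≤ |Real.log (κ * (1 - c))| + |Real.log (2 / κ)|) ∧
      ∑ ψ, m ψ * ((M ψ).lossL1 θ - γ * binaryGain w s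
        (∫ z, g z ∂((M ψ).law hX : Measure (X × Bool))) ψ) ≤ exoConst * d / (γ * c ^ 2) := by
  obtain ⟨P, hP⟩ := exists_finite_mixture (fun ψ => (hm0 ψ).le) hm1 (fun ψ => (M ψ).law hX)
  set K : ℝ := 24 * (decConst * Real.sqrt d) with hK
  have hd' : (1 : ℝ) ≤ d := by exact_mod_cast hd
  have hK0 : 0 < K := by
    have h1 := decConst_pos
    have h2 : 0 < Real.sqrt d := Real.sqrt_pos.mpr (by linarith)
    positivity
  -- the level `ε` at which the term `K D / ε` of the error equals the guaranteed gain `γ c² D / 4`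
  obtain ⟨θ, ℓ, h⟩ := exists_estimator_query_of_prior hd hX (fun ψ => (hm0 ψ).le) hm1 M P
    (show 0 < 4 * K / (γ * c ^ 2) by positivity)
  set b : ℝ := ∫ z, ℓ.toFun z ∂(P : Measure (X × Bool)) with hb
  set e : Θ → ℝ := fun ψ => ∫ z, ℓ.toFun z ∂((M ψ).law hX : Measure (X × Bool)) with he
  have hmean : ∀ Q : ProbabilityMeasure (X × Bool), ∫ z, ℓ.toFun z ∂(Q : Measure (X × Bool)) ∈
      Set.Icc (0 : ℝ) 1 := by
    intro Q
    refine ⟨integral_nonneg (fun z => (ℓ.mem_unit z).1), ?_⟩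
    have := ℓ.abs_integral_le_one (Q : Measure (X × Bool))
    exact (abs_le.mp this).2
  have hgmean : ∀ ψ, ∫ z, c * (ℓ.toFun z - b) ∂((M ψ).law hX : Measure (X × Bool)) =
      c * (e ψ - b) := by
    intro ψ
    rw [integral_const_mul, integral_sub (ℓ.integrable _) (integrable_const _)]
    simp [he]
  have hbe : b = ∑ ψ, m ψ * e ψ := hP _ (fun ψ => ℓ.integrable _)
  have hsum0 : ∑ ψ, m ψ * (c * (e ψ - b)) = 0 := by
    have : ∀ ψ, m ψ * (c * (e ψ - b)) = c * (m ψ * e ψ) - c * b * m ψ := fun ψ => by ring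
    simp_rw [this]
    rw [Finset.sum_sub_distrib, ← Finset.mul_sum, ← Finset.mul_sum, hm1, ← hbe]
    ring
  have hebc : ∀ x ∈ Set.Icc (0 : ℝ) 1, |c * (x - b)| ≤ c := by
    intro x hx
    have hb' := hmean P
    rw [abs_mul, abs_of_pos hc0]
    refine mul_le_of_le_one_right hc0.le (abs_le.mpr ⟨?_, ?_⟩)
    · linarith [hx.1, hb'.2]
    · linarith [hx.2, hb'.1]
  obtain ⟨s, hs, hgain⟩ := exists_weight_gain hm0 hm1 hw0 hw1 hc
    (fun ψ => hebc (e ψ) (hmean _)) hsum0 hκ hκm hκw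
  refine ⟨θ, fun z => c * (ℓ.toFun z - b), s, (ℓ.measurable_toFun.sub_const b).const_mul c,
    fun z => hebc _ (ℓ.mem_unit z), hs, ?_⟩
  simp_rw [hgmean, mul_sub (m _)]
  rw [Finset.sum_sub_distrib]
  have h1 : ∑ ψ, m ψ * (γ * binaryGain w s (c * (e ψ - b)) ψ) =
      γ * ∑ ψ, m ψ * binaryGain w s (c * (e ψ - b)) ψ := by
    rw [Finset.mul_sum]
    exact Finset.sum_congr rfl (fun ψ _ => by ring)
  have h2 : ∑ ψ, m ψ * (c * (e ψ - b)) ^ 2 = c ^ 2 * ∑ ψ, m ψ * queryDiv ℓ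
      ((M ψ).law hX : Measure (X × Bool)) (P : Measure (X × Bool)) ^ 2 := by
    rw [Finset.mul_sum]
    refine Finset.sum_congr rfl (fun ψ _ => ?_)
    simp only [queryDiv, sq_abs]
    ring
  rw [h2] at hgain
  set D := ∑ ψ, m ψ * queryDiv ℓ
    ((M ψ).law hX : Measure (X × Bool)) (P : Measure (X × Bool)) ^ 2 with hD
  have h3 : K * (4 * K / (γ * c ^ 2) + D / (4 * K / (γ * c ^ 2))) =
      4 * K ^ 2 / (γ * c ^ 2) + γ * (c ^ 2 * D / 4) := by
    field_simp
  have h4 : 4 * K ^ 2 = exoConst * d := by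
    rw [hK, exoConst, mul_pow, mul_pow, mul_pow, Real.sq_sqrt (by linarith)]
    ring
  rw [h3, h4] at h
  have h5 := mul_le_mul_of_nonneg_left hgain hγ.le
  rw [h1]
  unfold binaryGain
  linarith

/-- Mixtures of point masses, as covariate distributions of a model with given parameter. -/
theorem exists_model_of_weights {ι : Type} [Fintype ι] (x : ι → X) {a : ι → ℝ}
    (ha0 : ∀ i, 0 ≤ a i) (ha1 : 0 < ∑ i, a i) (ψ : Ball d) :
    ∃ M : LinModel X, M.param = ψ ∧ ∀ f : X → ℝ, Measurable f →
      (∑ i, a i) * ∫ y, f y ∂(M.cov : Measure X) = ∑ i, a i * f (x i) := by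
  obtain ⟨P, hP⟩ := exists_finite_mixture (m := fun i => a i / ∑ j, a j)
    (fun i => div_nonneg (ha0 i) ha1.le) (by rw [← Finset.sum_div, div_self ha1.ne'])
    (fun i => ⟨Measure.dirac (x i), inferInstance⟩)
  refine ⟨⟨P, ψ⟩, rfl, fun f hf => ?_⟩
  rw [hP f (fun i => integrable_dirac (by simp))]
  rw [Finset.mul_sum]
  refine Finset.sum_congr rfl (fun i _ => ?_)
  simp only [ProbabilityMeasure.coe_mk, integral_dirac]
  field_simp

theorem measurable_pointObj (w : Θ → ℝ) (γ : ℝ) (θ : Ball d)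
    {g : X × Bool → ℝ} (hg : Measurable g) (s : Θ → Bool → ℝ) (ψ : Θ) :
    Measurable (fun x : X => pointObj w γ θ g s x ψ) := by
  have h1 : Measurable (fun x : X => g (x, true)) := hg.comp (measurable_id.prodMk measurable_const)
  have h2 : Measurable (fun x : X => g (x, false)) :=
    hg.comp (measurable_id.prodMk measurable_const)
  have h3 := fun v => measurable_inner_covariate (X := X) v
  unfold pointObj binaryGain
  fun_prop

/-- Replies to mixed strategies of an adversary that picks one of finitely many covariates and a
parameter. Mixing with the uniform distribution keeps the weights bounded by a constant that does not
depend on the covariates. -/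
theorem exists_reply_finite (hd : 1 ≤ d) (hX : X ⊆ Metric.closedBall 0 1) {w : Θ → ℝ}
    (hw0 : ∀ ψ, 0 < w ψ) (hw1 : ∑ ψ, w ψ = 1)
    {γ : ℝ} (hγ : 0 < γ) {c : ℝ} (hc0 : 0 < c) (hc : c < 1) :
    ∃ B : ℝ, ∀ (ι : Type) [Fintype ι] [Nonempty ι] (x : ι → X) (μ : ι × Θ → ℝ),
      (∀ a, 0 ≤ μ a) → ∑ a, μ a = 1 →
      ∃ (θ : Ball d) (g : X × Bool → ℝ) (s : Θ → Bool → ℝ), Measurable g ∧ (∀ z, |g z| ≤ c) ∧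
      (∀ ψ o, |s ψ o| ≤ B) ∧
      ∑ a, μ a * pointObj w γ θ g s (x a.1) a.2 ≤ 4 * (exoConst * d / (γ * c ^ 2)) := by
  have hΘ : Nonempty Θ := by
    by_contra h
    rw [not_nonempty_iff] at h
    simp at hw1
  have hd' : (1 : ℝ) ≤ d := by exact_mod_cast hd
  set V := exoConst * d / (γ * c ^ 2) with hV
  have hV0 : 0 < V := by have := exoConst_pos; positivity
  set τ : ℝ := min (1 / 2) (V / γ) with hτ
  have hτ0 : 0 < τ := lt_min (by norm_num) (by positivity)
  have hτ1 : τ ≤ 1 / 2 := min_le_left _ _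
  have hτγ : τ * γ ≤ V := by
    have : τ ≤ V / γ := min_le_right _ _
    rwa [le_div_iff₀ hγ] at this
  have hcard : (0 : ℝ) < Fintype.card Θ := by exact_mod_cast Fintype.card_pos
  obtain ⟨ψ₀, hψ₀⟩ := Finite.exists_min w
  set κ : ℝ := min (τ / Fintype.card Θ) (w ψ₀) with hκ
  have hκ0 : 0 < κ := lt_min (by positivity) (hw0 _)
  refine ⟨|Real.log (κ * (1 - c))| + |Real.log (2 / κ)|, fun ι _ _ x μ hμ0 hμ1 => ?_⟩
  have hcardι : (0 : ℝ) < Fintype.card ι := by exact_mod_cast Fintype.card_pos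
  set u : ℝ := τ / (Fintype.card ι * Fintype.card Θ) with hu
  have hu0 : 0 < u := by positivity
  set μ' : ι × Θ → ℝ := fun a => (1 - τ) * μ a + u with hμ'
  have hμ'0 : ∀ a, 0 ≤ μ' a := fun a => by
    have := mul_nonneg (show 0 ≤ 1 - τ by linarith) (hμ0 a)
    simp only [hμ']; linarith
  set m : Θ → ℝ := fun ψ => ∑ i, μ' (i, ψ) with hm
  have hmκ : ∀ ψ, κ ≤ m ψ := by
    intro ψ
    calc κ ≤ τ / Fintype.card Θ := min_le_left _ _
      _ = ∑ _i : ι, u := by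
          rw [Finset.sum_const, Finset.card_univ, nsmul_eq_mul, hu]; field_simp
      _ ≤ m ψ := Finset.sum_le_sum (fun i _ => by
          have := mul_nonneg (show 0 ≤ 1 - τ by linarith) (hμ0 (i, ψ))
          simp only [hμ']; linarith)
  have hm0 : ∀ ψ, 0 < m ψ := fun ψ => hκ0.trans_le (hmκ ψ)
  have hm1 : ∑ ψ, m ψ = 1 := by
    simp only [hm]
    rw [← Fintype.sum_prod_type_right]
    simp only [hμ']
    rw [Finset.sum_add_distrib, ← Finset.mul_sum, hμ1, Finset.sum_const, Finset.card_univ,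
      Fintype.card_prod, nsmul_eq_mul, hu]
    push_cast
    field_simp
    ring
  choose M hMp hMint using fun ψ : Θ => exists_model_of_weights x
    (a := fun i => μ' (i, ψ)) (fun i => hμ'0 _) (hm0 ψ) (ψ : Ball d)
  obtain ⟨θ, g, s, hg, hgc, hs, h⟩ := exists_reply hd hX hw0 hw1 hm0 hm1 hγ hc0 hc hκ0 hmκ
    (fun ψ => (min_le_right _ _).trans (hψ₀ ψ)) M
  refine ⟨θ, g, s, hg, hgc, hs, ?_⟩
  have h1 : ∑ a, μ' a * pointObj w γ θ g s (x a.1) a.2 ≤ V := by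
    rw [Fintype.sum_prod_type_right]
    refine le_trans (le_of_eq (Finset.sum_congr rfl (fun ψ _ => ?_))) h
    rw [← (integral_pointObj hX w γ θ hg hgc s (M ψ) ψ (hMp ψ)).2]
    exact (hMint ψ _ (measurable_pointObj w γ θ hg s ψ)).symm
  have h2 : (1 - τ) * ∑ a, μ a * pointObj w γ θ g s (x a.1) a.2 - τ * γ ≤
      ∑ a, μ' a * pointObj w γ θ g s (x a.1) a.2 := by
    have h3 : τ * γ = ∑ _a : ι × Θ, u * γ := by
      rw [Finset.sum_const, Finset.card_univ, Fintype.card_prod, nsmul_eq_mul, hu]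
      push_cast
      field_simp
    rw [h3, Finset.mul_sum, ← Finset.sum_sub_distrib]
    refine Finset.sum_le_sum (fun a _ => ?_)
    have h4 := mul_le_mul_of_nonneg_left (neg_le_pointObj hX (fun ψ => (hw0 ψ).le) hw1 hγ.le θ
      (fun z => (hgc z).trans hc.le) s (x a.1) a.2) hu0.le
    simp only [hμ']
    linarith
  set S := ∑ a, μ a * pointObj w γ θ g s (x a.1) a.2 with hS
  have h5 : (1 - τ) * S ≤ 2 * V := by linarith
  by_contra hcon
  push Not at hcon
  nlinarith

/-- The learner has a finite mixture of pure strategies that is good against all covariates and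
parameters: the minimax theorem applies to a finite net of covariates, and composing the channels
with the rounding to the net extends the mixture to all of them. -/
theorem exists_finite_strategy (hd : 1 ≤ d) (hX : X ⊆ Metric.closedBall 0 1) [hne : Nonempty X]
    {w : Θ → ℝ} (hw0 : ∀ ψ, 0 < w ψ) (hw1 : ∑ ψ, w ψ = 1)
    {γ : ℝ} (hγ : 0 < γ) {c : ℝ} (hc0 : 0 < c) (hc : c < 1) :
    ∃ (J : Type) (_ : Fintype J) (l : J → ℝ) (θ : J → Ball d) (g : J → X × Bool → ℝ)
      (s : J → Θ → Bool → ℝ), (∀ j, 0 ≤ l j) ∧ ∑ j, l j = 1 ∧ (∀ j, Measurable (g j)) ∧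
      (∀ j z, |g j z| ≤ c) ∧ (∃ B, ∀ j ψ o, |s j ψ o| ≤ B) ∧
      ∀ x ψ, ∑ j, l j * pointObj w γ (θ j) (g j) (s j) x ψ ≤
        6 * (exoConst * d / (γ * c ^ 2)) := by
  have hd' : (1 : ℝ) ≤ d := by exact_mod_cast hd
  obtain ⟨B, hB⟩ := exists_reply_finite hd hX hw0 hw1 hγ hc0 hc
  set V := exoConst * d / (γ * c ^ 2) with hV
  have hV0 : 0 < V := by have := exoConst_pos; positivity
  have hE : 0 < 2 + γ * Real.exp (2 * B) := by positivity
  obtain ⟨n, u, r, hr, hru⟩ := exists_finite_rounding hX (show 0 < V / (2 + γ * Real.exp (2 * B)) by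
    positivity)
  have hn : Nonempty (Fin n) := hne.map r
  set Kset : Set (Fin n × Θ → ℝ) := {k | ∃ (θ : Ball d) (g : X × Bool → ℝ) (s : Θ → Bool → ℝ),
    Measurable g ∧ (∀ z, |g z| ≤ c) ∧ (∀ ψ o, |s ψ o| ≤ B) ∧
      k = fun a => pointObj w γ θ g s (u a.1) a.2} with hKset
  have hreply : ∀ μ : Fin n × Θ → ℝ, (∀ a, 0 ≤ μ a) → ∑ a, μ a = 1 →
      ∃ k ∈ Kset, ∑ a, μ a * k a ≤ 4 * V := by
    intro μ hμ0 hμ1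
    obtain ⟨θ, g, s, hg, hgc, hs, h⟩ := hB (Fin n) u μ hμ0 hμ1
    exact ⟨_, ⟨θ, g, s, hg, hgc, hs, rfl⟩, h⟩
  have hΘ : Nonempty Θ := by
    by_contra h
    rw [not_nonempty_iff] at h
    simp at hw1
  have hKne : Kset.Nonempty := by
    classical
    obtain ⟨a⟩ : Nonempty (Fin n × Θ) := inferInstance
    obtain ⟨k, hk, -⟩ := hreply (Pi.single a 1)
      (fun b => by rw [Pi.single_apply]; split_ifs <;> norm_num) (by simp)
    exact ⟨k, hk⟩
  obtain ⟨k, hk, hkV⟩ := exists_mem_convexHull_lt hKne (show 4 * V < 5 * V by linarith) hreply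
  obtain ⟨J, hJ, l, k', hl0, hl1, hk', rfl⟩ := mem_convexHull_iff_exists_fintype.mp hk
  choose θ g s hg hgc hs hk'' using hk'
  refine ⟨J, hJ, l, θ, fun j z => g j (u (r z.1), z.2), s, hl0, hl1, fun j => ?_,
    fun j z => hgc j _, ⟨B, hs⟩, fun x ψ => ?_⟩
  · have hur : Measurable (fun x : X => u (r x)) := (measurable_of_countable u).comp hr
    exact (hg j).comp ((hur.comp measurable_fst).prodMk measurable_snd)
  · have h1 : ∑ j, l j * pointObj w γ (θ j) (g j) (s j) (u (r x)) ψ < 5 * V := by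
      have := hkV (r x, ψ)
      simpa [hk''] using this
    have h2 : ∀ j, l j * pointObj w γ (θ j) (fun z => g j (u (r z.1), z.2)) (s j) x ψ ≤
        l j * pointObj w γ (θ j) (g j) (s j) (u (r x)) ψ + l j * V := by
      intro j
      rw [← mul_add]
      refine mul_le_mul_of_nonneg_left ?_ (hl0 j)
      refine (pointObj_round_le (fun ψ => (hw0 ψ).le) hw1 hγ.le (θ j)
        (fun z => (hgc j z).trans hc.le) (hs j) (r := fun x => u (r x)) hru x ψ).trans ?_
      rw [div_mul_cancel₀ _ hE.ne']
    refine (Finset.sum_le_sum (fun j _ => h2 j)).trans ?_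
    rw [Finset.sum_add_distrib, ← Finset.sum_mul, hl1]
    linarith

theorem infinite_ball (hd : 1 ≤ d) : Infinite (Ball d) := by
  have i0 : Fin d := ⟨0, hd⟩
  refine Infinite.of_injective (fun n : ℕ => (⟨EuclideanSpace.single i0 (1 / ((n : ℝ) + 1)), ?_⟩ :
    Ball d)) ?_
  · rw [mem_closedBall_zero_iff, PiLp.norm_single, Real.norm_of_nonneg (by positivity),
      div_le_one (by positivity)]
    linarith [show (0 : ℝ) ≤ n by positivity]
  · intro a b hab
    have h := congrArg (fun v : Ball d => (v : EuclideanSpace ℝ (Fin d)) i0) hab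
    simp only [PiLp.single_apply, if_true] at h
    have h1 : ((a : ℝ) + 1) = b + 1 := by
      have := congrArg (fun t : ℝ => 1 / t) h
      simpa using this
    exact_mod_cast (add_right_cancel h1)

theorem measurable_integral_push {α : ℝ} {Z : Type} [MeasurableSpace Z] {D : Type}
    [MeasurableSpace D] (P : ProbabilityMeasure Z) {f : D × Channel α Z Bool → Bool → ℝ}
    (hf : Measurable (Function.uncurry f)) :
    Measurable (fun π : D × Channel α Z Bool => ∫ o, f π o ∂(π.2.push P)) :=
  (StronglyMeasurable.integral_kernel_prod_right
    (κ := (obsKernel α Bool P).comap (fun x : D × Channel α Z Bool => x.2) measurable_snd)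
    hf.stronglyMeasurable).measurable

/-- The value of exploration-by-optimization is `O(d / (γ c²))` when binary channels with
bias `c` are `α`-DP. -/
theorem exoVal_le (hd : 1 ≤ d) (hX : X ⊆ Metric.closedBall 0 1) [Nonempty X] {α : ℝ}
    {w : Θ → ℝ} (hw0 : ∀ ψ, 0 < w ψ) (hw1 : ∑ ψ, w ψ = 1)
    {γ : ℝ} (hγ : 0 < γ) {c : ℝ} (hc0 : 0 < c) (hc : c < 1)
    (hα : 1 + c ≤ Real.exp α * (1 - c)) :
    exoVal hX α w γ ≤ ((6 * (exoConst * d / (γ * c ^ 2)) : ℝ) : EReal) := by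
  classical
  obtain ⟨J, hJ, l, θ, g, s, hl0, hl1, hg, hgc, ⟨B, hB⟩, h⟩ :=
    exists_finite_strategy hd hX hw0 hw1 hγ hc0 hc
  have := infinite_ball hd
  -- the decision component of a probe labels the pure strategy it comes from
  set lab : J → Ball d := fun j => Infinite.natEmbedding (Ball d) (Fintype.equivFin J j) with hlab
  have hlabinj : Function.Injective lab := fun i j hij =>
    (Fintype.equivFin J).injective (Fin.ext ((Infinite.natEmbedding (Ball d)).injective hij))
  set Q : J → Channel α (X × Bool) Bool := fun j => binaryChannel α (hg j) hc.le (hgc j) hα with hQ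
  set ξ : Θ → Probe X α → Bool → ℝ := fun ψ π o =>
    ∑ j, if π.1 = lab j then s j ψ o else 0 with hξ
  have hξlab : ∀ j ψ o, ξ ψ (lab j, Q j) o = s j ψ o := by
    intro j ψ o
    simp only [hξ]
    rw [Finset.sum_eq_single j (fun i _ hij => if_neg (fun h => hij (hlabinj h).symm))
      (fun h => absurd (Finset.mem_univ j) h), if_pos rfl]
  have hξm : ∀ ψ, Measurable (fun x : Probe X α × Bool => ξ ψ x.1 x.2) := by
    intro ψ
    simp only [hξ]
    refine Finset.measurable_sum _ (fun j _ => Measurable.ite ?_ ?_ measurable_const)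
    · exact measurableSet_eq_fun (measurable_fst.comp measurable_fst) measurable_const
    · exact (measurable_of_countable (s j ψ)).comp measurable_snd
  have hξw : IsWeight ξ := by
    refine ⟨hξm, ∑ j : J, |B|, fun ψ π o => ?_⟩
    refine (Finset.abs_sum_le_sum_abs _ _).trans (Finset.sum_le_sum (fun j _ => ?_))
    split_ifs
    · exact (hB j ψ o).trans (le_abs_self B)
    · simp
  obtain ⟨p, hp⟩ := exists_finite_mixture hl0 hl1
    (fun j => (⟨Measure.dirac (θ j), inferInstance⟩ : ProbabilityMeasure (Ball d)))
  obtain ⟨q, hq⟩ := exists_finite_mixture hl0 hl1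
    (fun j => (⟨Measure.dirac (lab j, Q j), inferInstance⟩ : ProbabilityMeasure (Probe X α)))
  refine iInf_le_of_le p (iInf_le_of_le q (iInf_le_of_le ξ (iInf_le_of_le hξw ?_)))
  refine iSup_le (fun ψ => iSup_le (fun M => iSup_le (fun hM => ?_)))
  rw [EReal.coe_le_coe_iff]
  have hp1 : ∫ a, M.lossL1 a ∂(p : Measure (Ball d)) = ∑ j, l j * M.lossL1 (θ j) := by
    rw [hp _ (fun j => integrable_dirac (by simp))]
    simp
  have hF : Measurable (fun π : Probe X α => ∫ o, ∑ ψ' : Θ, w ψ' *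
      (1 - Real.exp (ξ ψ' π o - ξ ψ π o)) ∂(π.2.push (M.law hX))) := by
    refine measurable_integral_push (M.law hX)
      (f := fun π o => ∑ ψ' : Θ, w ψ' * (1 - Real.exp (ξ ψ' π o - ξ ψ π o))) ?_
    refine Finset.measurable_sum _ (fun ψ' _ => measurable_const.mul (measurable_const.sub ?_))
    exact ((hξm ψ').sub (hξm ψ)).exp
  have hq1 : ∫ π : Probe X α, ∫ o, ∑ ψ' : Θ, w ψ' *
      (1 - Real.exp (ξ ψ' π o - ξ ψ π o)) ∂(π.2.push (M.law hX)) ∂(q : Measure (Probe X α)) =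
      ∑ j, l j * binaryGain w (s j) (∫ z, g j z ∂(M.law hX : Measure (X × Bool))) ψ := by
    rw [hq _ (fun j => integrable_dirac' hF.stronglyMeasurable (by simp))]
    refine Finset.sum_congr rfl (fun j _ => ?_)
    simp only [ProbabilityMeasure.coe_mk]
    rw [integral_dirac' _ _ hF.stronglyMeasurable]
    simp only [hξlab]
    rw [integral_binaryChannel_push (hg j) hc.le (hgc j) hα]
    rfl
  have hall : exoObj hX w γ p q ξ M ψ =
      ∑ j, l j * ∫ x, pointObj w γ (θ j) (g j) (s j) x ψ ∂(M.cov : Measure X) := by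
    unfold exoObj
    rw [hp1, hq1, Finset.mul_sum, ← Finset.sum_sub_distrib]
    refine Finset.sum_congr rfl (fun j _ => ?_)
    rw [(integral_pointObj hX w γ (θ j) (hg j) (hgc j) (s j) M ψ hM).2]
    ring
  have hi : ∀ j, Integrable (fun x => l j * pointObj w γ (θ j) (g j) (s j) x ψ)
      (M.cov : Measure X) := fun j =>
    (integral_pointObj hX w γ (θ j) (hg j) (hgc j) (s j) M ψ hM).1.const_mul _
  rw [hall]
  simp_rw [← integral_const_mul]
  rw [← integral_finsetSum _ (fun j _ => hi j)]
  have := integral_mono (μ := (M.cov : Measure X)) (integrable_finsetSum _ (fun j _ => hi j))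
    (integrable_const (6 * (exoConst * d / (γ * c ^ 2)))) (fun x => h x ψ)
  simpa using this

end Value

/-! ### Existence of measurable near-optimal runs -/

section Existence

variable {d : ℕ} {X : Set (EuclideanSpace ℝ (Fin d))} {Θ : Finset (Ball d)} {α : ℝ}

/-- The expected gain of the weights `ξ` at `ψ` relative to `ψ'`. -/
noncomputable def exoGain (hX : X ⊆ Metric.closedBall 0 1) (q : Measure (Probe X α))
    (ξ : Θ → Probe X α → Bool → ℝ) (M : LinModel X) (ψ ψ' : Θ) : ℝ :=
  ∫ π, ∫ o, (1 - Real.exp (ξ ψ' π o - ξ ψ π o)) ∂(π.2.push (M.law hX)) ∂q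

theorem abs_one_sub_exp_le {ξ : Θ → Probe X α → Bool → ℝ} {A : ℝ}
    (hA : ∀ ψ π o, |ξ ψ π o| ≤ A) (ψ ψ' : Θ) (π : Probe X α) (o : Bool) :
    |1 - Real.exp (ξ ψ' π o - ξ ψ π o)| ≤ Real.exp (2 * A) := by
  have h1 := (abs_le.mp (hA ψ' π o)).2
  have h2 := (abs_le.mp (hA ψ π o)).1
  have h3 : Real.exp (ξ ψ' π o - ξ ψ π o) ≤ Real.exp (2 * A) := Real.exp_le_exp.mpr (by linarith)
  have hA0 : 0 ≤ A := (abs_nonneg _).trans (hA ψ π o)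
  have h4 : 1 ≤ Real.exp (2 * A) := Real.one_le_exp (by linarith)
  have h5 := Real.exp_pos (ξ ψ' π o - ξ ψ π o)
  rw [abs_le]
  constructor <;> linarith

theorem measurable_one_sub_exp {ξ : Θ → Probe X α → Bool → ℝ} (hξ : IsWeight ξ) (ψ ψ' : Θ) :
    Measurable (fun x : Probe X α × Bool => 1 - Real.exp (ξ ψ' x.1 x.2 - ξ ψ x.1 x.2)) :=
  measurable_const.sub ((hξ.1 ψ').sub (hξ.1 ψ)).exp

theorem abs_integral_push_le (hX : X ⊆ Metric.closedBall 0 1) {ξ : Θ → Probe X α → Bool → ℝ}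
    {A : ℝ} (hA : ∀ ψ π o, |ξ ψ π o| ≤ A) (M : LinModel X) (ψ ψ' : Θ) (π : Probe X α) :
    |∫ o, (1 - Real.exp (ξ ψ' π o - ξ ψ π o)) ∂(π.2.push (M.law hX))| ≤ Real.exp (2 * A) := by
  have h := norm_integral_le_of_norm_le_const (μ := π.2.push (M.law hX))
    (f := fun o => 1 - Real.exp (ξ ψ' π o - ξ ψ π o))
    (Filter.Eventually.of_forall (fun o => abs_one_sub_exp_le hA ψ ψ' π o))
  rwa [probReal_univ, mul_one] at h

theorem exoObj_eq (hX : X ⊆ Metric.closedBall 0 1) (w : Θ → ℝ) (γ : ℝ) (p : Measure (Ball d))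
    (q : Measure (Probe X α)) [IsProbabilityMeasure q] {ξ : Θ → Probe X α → Bool → ℝ}
    (hξ : IsWeight ξ) (M : LinModel X) (ψ : Θ) :
    exoObj hX w γ p q ξ M ψ =
      ∫ a, M.lossL1 a ∂p - γ * ∑ ψ', w ψ' * exoGain hX q ξ M ψ ψ' := by
  obtain ⟨hm, A, hA⟩ := hξ
  have h1 : ∀ π : Probe X α, ∫ o, ∑ ψ', w ψ' * (1 - Real.exp (ξ ψ' π o - ξ ψ π o))
      ∂(π.2.push (M.law hX)) =
      ∑ ψ', w ψ' * ∫ o, (1 - Real.exp (ξ ψ' π o - ξ ψ π o)) ∂(π.2.push (M.law hX)) := by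
    intro π
    rw [integral_finsetSum _ (fun _ _ => Integrable.of_finite)]
    simp_rw [integral_const_mul]
  have hi : ∀ ψ', Integrable (fun π : Probe X α => ∫ o, (1 - Real.exp (ξ ψ' π o - ξ ψ π o))
      ∂(π.2.push (M.law hX))) q := fun ψ' =>
    integrable_of_bounded (measurable_integral_push (M.law hX)
      (f := fun π o => 1 - Real.exp (ξ ψ' π o - ξ ψ π o)) (measurable_one_sub_exp ⟨hm, A, hA⟩ ψ ψ'))
      (abs_integral_push_le hX hA M ψ ψ')
  unfold exoObj exoGain
  simp_rw [h1]
  rw [integral_finsetSum _ (fun ψ' _ => (hi ψ').const_mul _)]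
  simp_rw [integral_const_mul]

theorem abs_exoGain_le (hX : X ⊆ Metric.closedBall 0 1)
    (q : Measure (Probe X α)) [IsProbabilityMeasure q] {ξ : Θ → Probe X α → Bool → ℝ}
    {A : ℝ} (hA : ∀ ψ π o, |ξ ψ π o| ≤ A) (M : LinModel X) (ψ ψ' : Θ) :
    |exoGain hX q ξ M ψ ψ'| ≤ Real.exp (2 * A) := by
  have h := norm_integral_le_of_norm_le_const (μ := q)
    (f := fun π => ∫ o, (1 - Real.exp (ξ ψ' π o - ξ ψ π o)) ∂(π.2.push (M.law hX)))
    (Filter.Eventually.of_forall (fun π => abs_integral_push_le hX hA M ψ ψ' π))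
  rwa [probReal_univ, mul_one] at h

theorem exoGain_le_one (hX : X ⊆ Metric.closedBall 0 1)
    (q : Measure (Probe X α)) [IsProbabilityMeasure q] {ξ : Θ → Probe X α → Bool → ℝ}
    (hξ : IsWeight ξ) (M : LinModel X) (ψ ψ' : Θ) :
    exoGain hX q ξ M ψ ψ' ≤ 1 := by
  obtain ⟨hm, A, hA⟩ := hξ
  have h1 : ∀ π : Probe X α, ∫ o, (1 - Real.exp (ξ ψ' π o - ξ ψ π o))
      ∂(π.2.push (M.law hX)) ≤ 1 := by
    intro π
    have := integral_mono (μ := π.2.push (M.law hX)) Integrable.of_finite (integrable_const 1)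
      (fun o => (by linarith [Real.exp_pos (ξ ψ' π o - ξ ψ π o)] :
        1 - Real.exp (ξ ψ' π o - ξ ψ π o) ≤ 1))
    rwa [integral_const, probReal_univ, one_smul] at this
  have hi : Integrable (fun π : Probe X α => ∫ o, (1 - Real.exp (ξ ψ' π o - ξ ψ π o))
      ∂(π.2.push (M.law hX))) q :=
    integrable_of_bounded (measurable_integral_push (M.law hX)
      (f := fun π o => 1 - Real.exp (ξ ψ' π o - ξ ψ π o)) (measurable_one_sub_exp ⟨hm, A, hA⟩ ψ ψ'))
      (abs_integral_push_le hX hA M ψ ψ')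
  have := integral_mono hi (integrable_const 1) h1
  simpa [exoGain] using this

variable (X α Θ) in
/-- A feasible point of the exploration-by-optimization problem. -/
structure ExoStrategy where
  p : ProbabilityMeasure (Ball d)
  q : ProbabilityMeasure (Probe X α)
  ξ : Θ → Probe X α → Bool → ℝ
  isWeight : IsWeight ξ

/-- The worst-case objective of a strategy. -/
noncomputable def ExoStrategy.sup (hX : X ⊆ Metric.closedBall 0 1) (γ : ℝ)
    (S : ExoStrategy X Θ α) (w : Θ → ℝ) : EReal :=
  exoSup hX w γ (S.p : Measure (Ball d)) (S.q : Measure (Probe X α)) S.ξ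

theorem exoVal_eq_iInf (hX : X ⊆ Metric.closedBall 0 1) (γ : ℝ) (w : Θ → ℝ) :
    exoVal hX α w γ = ⨅ S : ExoStrategy X Θ α, S.sup hX γ w := by
  apply le_antisymm
  · exact le_iInf (fun S => iInf_le_of_le S.p (iInf_le_of_le S.q (iInf_le_of_le S.ξ
      (iInf_le_of_le S.isWeight le_rfl))))
  · exact le_iInf (fun p => le_iInf (fun q => le_iInf (fun ξ => le_iInf (fun hξ =>
      iInf_le_of_le (⟨p, q, ξ, hξ⟩ : ExoStrategy X Θ α) le_rfl))))

theorem nonempty_exoStrategy (hα : 0 < α) : Nonempty (ExoStrategy X Θ α) := by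
  refine ⟨⟨⟨Measure.dirac ⟨0, by simp⟩, inferInstance⟩, ⟨Measure.dirac (⟨0, by simp⟩,
    binaryChannel α (g := fun _ => 0) measurable_const (c := 0) (by norm_num) (by simp)
      (by simpa using hα.le)), inferInstance⟩, fun _ _ _ => 0, fun _ => measurable_const, 0,
    by simp⟩⟩

/-- The worst-case objective of a strategy is upper semicontinuous in the reference
distribution, because the weights are bounded. -/
theorem ExoStrategy.isOpen_sup_lt (hX : X ⊆ Metric.closedBall 0 1) (γ : ℝ)
    (S : ExoStrategy X Θ α) (r : EReal) : IsOpen {w : Θ → ℝ | S.sup hX γ w < r} := by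
  obtain ⟨hm, A, hA⟩ := S.isWeight
  rw [isOpen_iff_mem_nhds]
  intro w hw
  obtain ⟨r₁, hr1, hr1'⟩ := EReal.lt_iff_exists_real_btwn.mp hw
  obtain ⟨r₂, hr2, hr2'⟩ := EReal.lt_iff_exists_real_btwn.mp hr1'
  have hr12 : r₁ < r₂ := EReal.coe_lt_coe_iff.mp hr2
  have hcont : ContinuousAt (fun w' : Θ → ℝ => |γ| * ∑ ψ, |w ψ - w' ψ| * Real.exp (2 * A)) w := by
    refine Continuous.continuousAt ?_
    fun_prop
  have hev := hcont.eventually_lt_const (u := r₂ - r₁) (by simpa using hr12)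
  filter_upwards [hev] with w' hw'
  refine lt_of_le_of_lt ?_ hr2'
  refine iSup_le (fun ψ => iSup_le (fun M => iSup_le (fun hM => ?_)))
  have h1 : ((exoObj hX w γ (S.p : Measure (Ball d)) (S.q : Measure (Probe X α)) S.ξ M ψ : ℝ) :
      EReal) < r₁ := by
    refine lt_of_le_of_lt ?_ hr1
    exact le_iSup_of_le ψ (le_iSup_of_le M (le_iSup_of_le hM le_rfl))
  rw [EReal.coe_lt_coe_iff] at h1
  rw [EReal.coe_le_coe_iff]
  rw [exoObj_eq hX _ _ _ _ S.isWeight] at h1 ⊢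
  have h2 : γ * ∑ ψ', w ψ' * exoGain hX (S.q : Measure (Probe X α)) S.ξ M ψ ψ' -
      γ * ∑ ψ', w' ψ' * exoGain hX (S.q : Measure (Probe X α)) S.ξ M ψ ψ' ≤
      |γ| * ∑ ψ, |w ψ - w' ψ| * Real.exp (2 * A) := by
    rw [← mul_sub, ← Finset.sum_sub_distrib]
    refine (le_abs_self _).trans ?_
    rw [abs_mul]
    refine mul_le_mul_of_nonneg_left ?_ (abs_nonneg _)
    refine (Finset.abs_sum_le_sum_abs _ _).trans (Finset.sum_le_sum (fun ψ' _ => ?_))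
    rw [← sub_mul, abs_mul]
    exact mul_le_mul_of_nonneg_left (abs_exoGain_le hX _ hA M ψ ψ') (abs_nonneg _)
  linarith

theorem measurable_of_isOpen_lt {W : Type*} [TopologicalSpace W] [MeasurableSpace W] [BorelSpace W]
    {F : W → EReal} (hF : ∀ r, IsOpen {w | F w < r}) : Measurable F :=
  measurable_of_Iio (fun r => (hF r).measurableSet)

/-- The objective is bounded below on the simplex as soon as there is a model. -/
theorem neg_le_exoVal (hX : X ⊆ Metric.closedBall 0 1) [hne : Nonempty X] {γ : ℝ} (hγ : 0 < γ)
    {w : Θ → ℝ} (hw0 : ∀ ψ, 0 < w ψ) (hw1 : ∑ ψ, w ψ = 1) :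
    ((-γ : ℝ) : EReal) ≤ exoVal hX α w γ := by
  have hΘ : Nonempty Θ := by
    by_contra h
    rw [not_nonempty_iff] at h
    simp at hw1
  obtain ⟨ψ⟩ := hΘ
  obtain ⟨x⟩ := hne
  rw [exoVal_eq_iInf]
  refine le_iInf (fun S => ?_)
  unfold ExoStrategy.sup exoSup
  refine le_iSup_of_le ψ (le_iSup_of_le (⟨⟨Measure.dirac x, inferInstance⟩, ψ⟩ : LinModel X)
    (le_iSup_of_le rfl ?_))
  rw [EReal.coe_le_coe_iff, exoObj_eq hX _ _ _ _ S.isWeight]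
  have h1 : 0 ≤ ∫ a, (⟨⟨Measure.dirac x, inferInstance⟩, ψ⟩ : LinModel X).lossL1 a
      ∂(S.p : Measure (Ball d)) := integral_nonneg (fun a => LinModel.lossL1_nonneg _ a)
  have h2 : ∑ ψ', w ψ' * exoGain hX (S.q : Measure (Probe X α)) S.ξ
      (⟨⟨Measure.dirac x, inferInstance⟩, ψ⟩ : LinModel X) ψ ψ' ≤ 1 := by
    exact (Finset.sum_le_sum (fun ψ' _ => mul_le_of_le_one_right (hw0 ψ').le
      (exoGain_le_one hX _ S.isWeight _ ψ ψ'))).trans hw1.le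
  nlinarith

/-- Without covariates there are no models, and the worst case is a supremum over the empty set. -/
theorem exoSup_eq_bot (hX : X ⊆ Metric.closedBall 0 1) [IsEmpty X] (w : Θ → ℝ) (γ : ℝ)
    (p : Measure (Ball d)) (q : Measure (Probe X α)) (ξ : Θ → Probe X α → Bool → ℝ) :
    exoSup hX w γ p q ξ = ⊥ := by
  refine eq_bot_iff.mpr (iSup_le (fun ψ => iSup_le (fun M => ?_)))
  exact (M.cov.nonempty.elim (fun x => (IsEmpty.false x).elim) : False).elim

/-- Countably many strategies suffice: for each rational level, the open sets on which a strategy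
beats the level have a countable subcover. -/
theorem exists_countable_strategies (hX : X ⊆ Metric.closedBall 0 1) (hα : 0 < α) {γ : ℝ}
    (hγ : 0 < γ) {η : ℝ} (hη : 0 < η) :
    ∃ S : ℕ → ExoStrategy X Θ α, ∀ w : Θ → ℝ, (∀ ψ, 0 < w ψ) → ∑ ψ, w ψ = 1 →
      ∃ n, (S n).sup hX γ w ≤ exoVal hX α w γ + η := by
  have hS := nonempty_exoStrategy (X := X) (Θ := Θ) hα
  rcases isEmpty_or_nonempty X with hemp | hne
  · obtain ⟨S⟩ := hS
    exact ⟨fun _ => S, fun w _ _ => ⟨0, by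
      rw [ExoStrategy.sup, exoSup_eq_bot]; exact bot_le⟩⟩
  · choose T hTc hT using fun r : ℚ => TopologicalSpace.isOpen_iUnion_countable
      (fun S : ExoStrategy X Θ α => {w : Θ → ℝ | S.sup hX γ w < ((r : ℝ) : EReal)})
      (fun S => S.isOpen_sup_lt hX γ _)
    obtain ⟨S₀⟩ := hS
    have hc : (insert S₀ (⋃ r, T r)).Countable :=
      (Set.countable_iUnion (fun r => hTc r)).insert S₀
    obtain ⟨S, hSr⟩ := hc.exists_eq_range (Set.insert_nonempty _ _)
    refine ⟨S, fun w hw0 hw1 => ?_⟩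
    have hlow := neg_le_exoVal (α := α) hX hγ hw0 hw1
    rcases eq_or_ne (exoVal hX α w γ) ⊤ with htop | htop
    · exact ⟨0, by rw [htop, EReal.top_add_coe]; exact le_top⟩
    · have hbot : exoVal hX α w γ ≠ ⊥ := fun h => by
        rw [h] at hlow
        exact absurd hlow (by simp)
      lift exoVal hX α w γ to ℝ using ⟨htop, hbot⟩ with v hv
      obtain ⟨r, hr1, hr2⟩ := exists_rat_btwn (show v < v + η by linarith)
      have h1 : ∃ S : ExoStrategy X Θ α, S.sup hX γ w < ((r : ℝ) : EReal) := by
        have : (⨅ S : ExoStrategy X Θ α, S.sup hX γ w) < ((r : ℝ) : EReal) := by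
          rw [← exoVal_eq_iInf, ← hv]
          exact_mod_cast hr1
        exact iInf_lt_iff.mp this
      have h2 : w ∈ ⋃ S ∈ T r, {w : Θ → ℝ | S.sup hX γ w < ((r : ℝ) : EReal)} := by
        rw [hT r]
        obtain ⟨S', hS'⟩ := h1
        exact Set.mem_iUnion.mpr ⟨S', hS'⟩
      obtain ⟨S', hS'⟩ := Set.mem_iUnion.mp h2
      obtain ⟨hS'T, hS'w⟩ := Set.mem_iUnion.mp hS'
      have h3 : S' ∈ Set.range S := by
        rw [← hSr]
        exact Set.mem_insert_of_mem _ (Set.mem_iUnion.mpr ⟨r, hS'T⟩)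
      obtain ⟨n, rfl⟩ := h3
      refine ⟨n, (lt_of_lt_of_le hS'w ?_).le⟩
      rw [← EReal.coe_add]
      exact_mod_cast hr2.le

theorem measurableSet_pos_simplex : MeasurableSet {w : Θ → ℝ | (∀ ψ, 0 < w ψ) ∧ ∑ ψ, w ψ = 1} := by
  refine MeasurableSet.inter ?_ ?_
  · have : {w : Θ → ℝ | ∀ ψ, 0 < w ψ} = ⋂ ψ, {w | 0 < w ψ} := by ext; simp
    show MeasurableSet {w : Θ → ℝ | ∀ ψ, 0 < w ψ}
    rw [this]
    exact MeasurableSet.iInter (fun ψ => measurableSet_lt measurable_const (measurable_pi_apply ψ))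
  · exact measurableSet_eq_fun (Finset.measurable_sum _ (fun ψ _ => measurable_pi_apply ψ))
      measurable_const

/-- A measurable choice of a near-optimal strategy from a countable family. -/
theorem exists_measurable_selection (hX : X ⊆ Metric.closedBall 0 1) (hα : 0 < α) {γ : ℝ}
    (hγ : 0 < γ) {η : ℝ} (hη : 0 < η) :
    ∃ (S : ℕ → ExoStrategy X Θ α) (sel : (Θ → ℝ) → ℕ), Measurable sel ∧
      ∀ w : Θ → ℝ, (∀ ψ, 0 < w ψ) → ∑ ψ, w ψ = 1 →
      (S (sel w)).sup hX γ w ≤ exoVal hX α w γ + η := by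
  classical
  obtain ⟨S, hS⟩ := exists_countable_strategies (Θ := Θ) hX hα hγ hη
  have hval : Measurable (fun w : Θ → ℝ => exoVal hX α w γ) := by
    refine measurable_of_isOpen_lt (fun r => ?_)
    have : {w : Θ → ℝ | exoVal hX α w γ < r} =
        ⋃ S : ExoStrategy X Θ α, {w | S.sup hX γ w < r} := by
      ext w
      simp [exoVal_eq_iInf, iInf_lt_iff]
    rw [this]
    exact isOpen_iUnion (fun S => S.isOpen_sup_lt hX γ r)
  have hadd : Measurable (fun x : EReal => x + (η : EReal)) :=
    Monotone.measurable (fun a b hab => add_le_add_left hab _)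
  -- the least index of a near-optimal strategy; off the simplex, where nothing is claimed, any index
  let p : (Θ → ℝ) → ℕ → Prop := fun w n =>
    (S n).sup hX γ w ≤ exoVal hX α w γ + η ∨ ¬ ((∀ ψ, 0 < w ψ) ∧ ∑ ψ, w ψ = 1)
  have hp : ∀ w, ∃ n, p w n := by
    intro w
    by_cases hw : (∀ ψ, 0 < w ψ) ∧ ∑ ψ, w ψ = 1
    · obtain ⟨n, hn⟩ := hS w hw.1 hw.2
      exact ⟨n, Or.inl hn⟩
    · exact ⟨0, Or.inr hw⟩
  have hm : ∀ n, MeasurableSet {w | p w n} := fun n =>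
    (measurableSet_le (measurable_of_isOpen_lt (fun r => (S n).isOpen_sup_lt hX γ r))
      (hadd.comp hval)).union measurableSet_pos_simplex.compl
  refine ⟨S, fun w => Nat.find (hp w), measurable_find hp hm, fun w hw0 hw1 => ?_⟩
  exact (Nat.find_spec (hp w)).resolve_right (fun h => h ⟨hw0, hw1⟩)

theorem expWeights_pos (hΘ : Θ.Nonempty)
    (ξ : (t : ℕ) → BinHist X α t → Θ → Probe X α → Bool → ℝ) :
    ∀ (t : ℕ) (h : BinHist X α t) (ψ : Θ), 0 < expWeights Θ ξ t h ψ
  | 0, _, _ => by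
    have : (0 : ℝ) < Θ.card := by exact_mod_cast hΘ.card_pos
    simp only [expWeights]
    positivity
  | t + 1, h, ψ => by
    have ih := expWeights_pos hΘ ξ t (Fin.init h)
    have : Nonempty Θ := hΘ.to_subtype
    simp only [expWeights]
    exact div_pos (mul_pos (ih ψ) (Real.exp_pos _))
      (Finset.sum_pos (fun ψ' _ => mul_pos (ih ψ') (Real.exp_pos _)) Finset.univ_nonempty)

theorem sum_expWeights (hΘ : Θ.Nonempty)
    (ξ : (t : ℕ) → BinHist X α t → Θ → Probe X α → Bool → ℝ) (t : ℕ) (h : BinHist X α t) :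
    ∑ ψ, expWeights Θ ξ t h ψ = 1 := by
  have : Nonempty Θ := hΘ.to_subtype
  cases t with
  | zero =>
    have : (0 : ℝ) < Θ.card := by exact_mod_cast hΘ.card_pos
    simp only [expWeights, Finset.sum_const, Finset.card_univ, Fintype.card_coe, nsmul_eq_mul]
    field_simp
  | succ t =>
    simp only [expWeights]
    rw [← Finset.sum_div, div_self]
    exact (Finset.sum_pos (fun ψ' _ => mul_pos (expWeights_pos hΘ ξ t _ ψ') (Real.exp_pos _))
      Finset.univ_nonempty).ne'

/-- The reference distributions of the run that plays the strategy with index `sel w` at the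
reference distribution `w`. -/
noncomputable def selWeights (S : ℕ → ExoStrategy X Θ α) (sel : (Θ → ℝ) → ℕ) :
    (t : ℕ) → BinHist X α t → Θ → ℝ
  | 0, _ => fun _ => 1 / (Θ.card : ℝ)
  | t + 1, h => fun ψ =>
      let u : Θ → ℝ := fun ψ' => selWeights S sel t (Fin.init h) ψ' *
        Real.exp ((S (sel (selWeights S sel t (Fin.init h)))).ξ ψ' (h (Fin.last t)).1
          (h (Fin.last t)).2)
      u ψ / ∑ ψ' : Θ, u ψ'

/-- `selWeights` resolves the circularity of a run, whose weights depend on its strategies and whose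
strategies depend on its weights. -/
theorem expWeights_eq_selWeights (S : ℕ → ExoStrategy X Θ α) (sel : (Θ → ℝ) → ℕ) :
    ∀ (t : ℕ) (h : BinHist X α t),
      expWeights Θ (fun t h => (S (sel (selWeights S sel t h))).ξ) t h = selWeights S sel t h
  | 0, _ => rfl
  | t + 1, h => by
    simp only [expWeights, selWeights]
    rw [expWeights_eq_selWeights S sel t (Fin.init h)]

theorem ExoStrategy.measurable_ξ (S : ℕ → ExoStrategy X Θ α) (ψ : Θ) :
    Measurable (fun x : ℕ × (Probe X α × Bool) => (S x.1).ξ ψ x.2.1 x.2.2) :=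
  measurable_from_prod_countable_right (fun n => (S n).isWeight.1 ψ)

theorem measurable_selWeights (S : ℕ → ExoStrategy X Θ α) {sel : (Θ → ℝ) → ℕ}
    (hsel : Measurable sel) : ∀ t : ℕ, Measurable (selWeights S sel t)
  | 0 => measurable_const
  | t + 1 => by
    have ih := (measurable_selWeights S hsel t).comp (measurable_init t)
    have hu : ∀ ψ' : Θ, Measurable (fun h : BinHist X α (t + 1) =>
        selWeights S sel t (Fin.init h) ψ' *
        Real.exp ((S (sel (selWeights S sel t (Fin.init h)))).ξ ψ' (h (Fin.last t)).1
          (h (Fin.last t)).2)) := fun ψ' =>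
      ((measurable_pi_apply ψ').comp ih).mul
        (((ExoStrategy.measurable_ξ S ψ').comp
          ((hsel.comp ih).prodMk (measurable_pi_apply (Fin.last t)))).exp)
    exact measurable_pi_lambda _ (fun ψ => (hu ψ).div (Finset.measurable_sum _ (fun ψ' _ => hu ψ')))

/-- Near-optimal runs exist: in each round the measurable selection is applied to the current reference
distribution. -/
theorem nonempty_LDPExO (hX : X ⊆ Metric.closedBall 0 1) (hα : 0 < α) (hΘ : Θ.Nonempty) {γ : ℝ}
    (hγ : 0 < γ) {η : ℝ} (hη : 0 < η) : Nonempty (LDPExO hX α Θ γ η) := by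
  obtain ⟨S, sel, hsel, hopt⟩ := exists_measurable_selection (Θ := Θ) hX hα hγ hη
  have hmeas : ∀ t : ℕ, Measurable (fun h : BinHist X α t => sel (selWeights S sel t h)) :=
    fun t => hsel.comp (measurable_selWeights S hsel t)
  let pk : Kernel ℕ (Ball d) := ⟨fun n => ((S n).p : Measure (Ball d)), measurable_from_nat⟩
  let qk : Kernel ℕ (Probe X α) := ⟨fun n => ((S n).q : Measure (Probe X α)), measurable_from_nat⟩
  have hpk : IsMarkovKernel pk := ⟨fun n => (S n).p.2⟩
  have hqk : IsMarkovKernel qk := ⟨fun n => (S n).q.2⟩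
  refine ⟨{ q := fun t => qk.comap _ (hmeas t)
            isMarkov := fun t => inferInstance
            p := fun t => pk.comap _ (hmeas t)
            isMarkov_p := fun t => inferInstance
            ξ := fun t h => (S (sel (selWeights S sel t h))).ξ
            measurable_ξ := fun t ψ => ?_
            bounded_ξ := fun t h => (S _).isWeight.2
            optimal := fun t h => ?_ }⟩
  · exact (ExoStrategy.measurable_ξ S ψ).comp
      (((hmeas t).comp measurable_fst).prodMk measurable_snd)
  · have h0 := expWeights_pos hΘ (fun t h => (S (sel (selWeights S sel t h))).ξ) t h
    have h1 := sum_expWeights hΘ (fun t h => (S (sel (selWeights S sel t h))).ξ) t h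
    have h2 := hopt _ h0 h1
    rw [expWeights_eq_selWeights] at h2 ⊢
    exact h2

end Existence

/-! ### Nets of the ball and perturbation of the parameter -/

section Perturbation

variable {d : ℕ} {X : Set (EuclideanSpace ℝ (Fin d))}

/-- Volume bound for separated subsets of the unit ball. -/
theorem card_le_of_separated {r : ℝ} (hr : 0 < r) (s : Finset (Ball d))
    (hs : ∀ a ∈ s, ∀ b ∈ s, a ≠ b → r ≤ dist a b) : (s.card : ℝ) ≤ (1 + 2 / r) ^ d := by
  set μ : Measure (EuclideanSpace ℝ (Fin d)) := volume
  have hr2 : 0 < r / 2 := by positivity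
  have hρ : 0 < 1 + r / 2 := by positivity
  have hdisj : Set.Pairwise (s : Set (Ball d)) (Function.onFun Disjoint
      fun c : Ball d => Metric.ball (c : EuclideanSpace ℝ (Fin d)) (r / 2)) := by
    intro a ha b hb hab
    refine Metric.ball_disjoint_ball ?_
    have := hs a ha b hb hab
    rw [Subtype.dist_eq] at this
    linarith
  have hsub : (⋃ c ∈ s, Metric.ball (c : EuclideanSpace ℝ (Fin d)) (r / 2)) ⊆
      Metric.ball 0 (1 + r / 2) := by
    refine Set.iUnion₂_subset (fun c _ => Metric.ball_subset_ball' ?_)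
    rw [dist_zero_right]
    linarith [c.norm_le]
  have h1 : (s.card : ℝ≥0∞) * ENNReal.ofReal ((r / 2) ^ d) * μ (Metric.ball 0 1) ≤
      ENNReal.ofReal ((1 + r / 2) ^ d) * μ (Metric.ball 0 1) := by
    calc _ = μ (⋃ c ∈ s, Metric.ball (c : EuclideanSpace ℝ (Fin d)) (r / 2)) := by
          rw [measure_biUnion_finset hdisj fun c _ => Metric.isOpen_ball.measurableSet]
          simp only [μ.addHaar_ball_of_pos _ hr2, finrank_euclideanSpace_fin, Finset.sum_const,
            nsmul_eq_mul, mul_assoc]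
      _ ≤ μ (Metric.ball 0 (1 + r / 2)) := measure_mono hsub
      _ = _ := by rw [μ.addHaar_ball_of_pos _ hρ, finrank_euclideanSpace_fin]
  have h2 : (s.card : ℝ≥0∞) * ENNReal.ofReal ((r / 2) ^ d) ≤ ENNReal.ofReal ((1 + r / 2) ^ d) :=
    (ENNReal.mul_le_mul_iff_left (Metric.measure_ball_pos _ _ zero_lt_one).ne'
      measure_ball_lt_top.ne).1 h1
  have h3 := ENNReal.toReal_le_of_le_ofReal (pow_nonneg hρ.le _) h2
  rw [ENNReal.toReal_mul, ENNReal.toReal_natCast, ENNReal.toReal_ofReal (by positivity)] at h3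
  rw [← le_div_iff₀ (by positivity), ← div_pow] at h3
  refine h3.trans (le_of_eq ?_)
  congr 1
  field_simp
  ring

/-- A maximal separated set is a net. -/
theorem exists_net {r : ℝ} (hr : 0 < r) :
    ∃ Θ : Finset (Ball d), Θ.Nonempty ∧ (Θ.card : ℝ) ≤ (1 + 2 / r) ^ d ∧
      ∀ θ : Ball d, ∃ ψ ∈ Θ, dist θ ψ ≤ r := by
  classical
  set p : ℕ → Prop := fun n => ∃ s : Finset (Ball d), s.card = n ∧
    ∀ a ∈ s, ∀ b ∈ s, a ≠ b → r ≤ dist a b with hp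
  set N := ⌊(1 + 2 / r) ^ d⌋₊ with hN
  have hbound : ∀ n, p n → n ≤ N := by
    rintro n ⟨s, rfl, hs⟩
    exact Nat.le_floor (card_le_of_separated hr s hs)
  have h0 : p 0 := ⟨∅, rfl, by simp⟩
  obtain ⟨Θ, hcard, hsep⟩ := Nat.findGreatest_spec (Nat.zero_le N) h0
  have hcov : ∀ θ : Ball d, ∃ ψ ∈ Θ, dist θ ψ ≤ r := by
    intro θ
    by_contra hcon
    push Not at hcon
    have hθ : θ ∉ Θ := fun h => by
      have := hcon θ h
      rw [dist_self] at this
      linarith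
    have h1 : p (Θ.card + 1) := by
      refine ⟨insert θ Θ, Finset.card_insert_of_notMem hθ, fun a ha b hb hab => ?_⟩
      rcases Finset.mem_insert.mp ha with rfl | ha' <;> rcases Finset.mem_insert.mp hb with rfl | hb'
      · exact absurd rfl hab
      · exact (hcon b hb').le
      · rw [dist_comm]; exact (hcon a ha').le
      · exact hsep a ha' b hb' hab
    have h2 := Nat.le_findGreatest (hbound _ h1) h1
    omega
  refine ⟨Θ, ?_, card_le_of_separated hr Θ hsep, hcov⟩
  obtain ⟨ψ, hψ, -⟩ := hcov ⟨0, by simp⟩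
  exact ⟨ψ, hψ⟩

theorem LinModel.lintegral_law_le (hX : X ⊆ Metric.closedBall 0 1) (M : LinModel X) (ψ : Ball d)
    {r : ℝ} (hr : dist M.param ψ ≤ r) {f : X × Bool → ℝ≥0∞} (hf : Measurable f)
    (hf1 : ∀ z, f z ≤ 1) :
    ∫⁻ z, f z ∂(M.law hX : Measure (X × Bool)) ≤
      ∫⁻ z, f z ∂((LinModel.mk M.cov ψ).law hX : Measure (X × Bool)) + ENNReal.ofReal r := by
  rw [LinModel.lintegral_law hX _ hf, LinModel.lintegral_law hX _ hf]
  have hr0 : 0 ≤ r := dist_nonneg.trans hr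
  have h : ∀ x : X, ∫⁻ b, f (x, b) ∂(rad (inner ℝ (x : EuclideanSpace ℝ (Fin d))
        (M.param : EuclideanSpace ℝ (Fin d)))) ≤
      ∫⁻ b, f (x, b) ∂(rad (inner ℝ (x : EuclideanSpace ℝ (Fin d))
        (ψ : EuclideanSpace ℝ (Fin d)))) + ENNReal.ofReal r := by
    intro x
    have h1 : |inner ℝ (x : EuclideanSpace ℝ (Fin d)) (M.param : EuclideanSpace ℝ (Fin d)) -
        inner ℝ (x : EuclideanSpace ℝ (Fin d)) (ψ : EuclideanSpace ℝ (Fin d))| ≤ r := by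
      rw [← inner_sub_right]
      refine (abs_inner_covariate_le hX x _).trans ?_
      rwa [Subtype.dist_eq, dist_eq_norm] at hr
    obtain ⟨h2, h3⟩ := abs_le.mp h1
    have h4 := abs_le.mp (abs_inner_param_le hX x ψ)
    rw [lintegral_rad, lintegral_rad]
    have h5 : ENNReal.ofReal ((1 + inner ℝ (x : EuclideanSpace ℝ (Fin d))
        (M.param : EuclideanSpace ℝ (Fin d))) / 2) ≤ ENNReal.ofReal ((1 + inner ℝ
          (x : EuclideanSpace ℝ (Fin d)) (ψ : EuclideanSpace ℝ (Fin d))) / 2) +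
          ENNReal.ofReal (r / 2) := by
      rw [← ENNReal.ofReal_add (by linarith) (by linarith)]
      exact ENNReal.ofReal_le_ofReal (by linarith)
    have h6 : ENNReal.ofReal ((1 - inner ℝ (x : EuclideanSpace ℝ (Fin d))
        (M.param : EuclideanSpace ℝ (Fin d))) / 2) ≤ ENNReal.ofReal ((1 - inner ℝ
          (x : EuclideanSpace ℝ (Fin d)) (ψ : EuclideanSpace ℝ (Fin d))) / 2) +
          ENNReal.ofReal (r / 2) := by
      rw [← ENNReal.ofReal_add (by linarith) (by linarith)]
      exact ENNReal.ofReal_le_ofReal (by linarith)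
    have h7 : ENNReal.ofReal r = ENNReal.ofReal (r / 2) + ENNReal.ofReal (r / 2) := by
      rw [← ENNReal.ofReal_add (by linarith) (by linarith)]
      congr 1; ring
    calc _ ≤ _ := add_le_add (mul_le_mul' h5 le_rfl) (mul_le_mul' h6 le_rfl)
      _ ≤ _ := by
        rw [add_mul, add_mul, h7, add_add_add_comm]
        exact add_le_add le_rfl (add_le_add (mul_le_of_le_one_right' (hf1 _))
          (mul_le_of_le_one_right' (hf1 _)))
  refine (lintegral_mono h).trans (le_of_eq ?_)
  rw [lintegral_add_right _ measurable_const]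
  simp

/-- Perturbing the parameter by `r` changes the law of a history of `t` rounds by at most `t r` in total
variation. -/
theorem LinModel.lintegral_histLaw_le {α : ℝ} {O D : Type} [MeasurableSpace O] [MeasurableSpace D]
    (hX : X ⊆ Metric.closedBall 0 1) (M : LinModel X) (ψ : Ball d)
    {r : ℝ} (hr : dist M.param ψ ≤ r) (A : Exploration α (X × Bool) O D) (t : ℕ) :
    ∀ f : Hist α (X × Bool) O D t → ℝ≥0∞, Measurable f → (∀ h, f h ≤ 1) →
    ∫⁻ h, f h ∂(A.histLaw (M.law hX) t) ≤
      ∫⁻ h, f h ∂(A.histLaw ((LinModel.mk M.cov ψ).law hX) t) + t * ENNReal.ofReal r := by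
  induction t with
  | zero => intro f _ _; simp [Exploration.histLaw]
  | succ t ih =>
    intro f hf hf1
    have := A.isMarkov t
    have := A.isProbabilityMeasure_histLaw (M.law hX) t
    rw [A.lintegral_histLaw_succ _ t hf, A.lintegral_histLaw_succ _ t hf]
    have hpush : ∀ (Q : Channel α (X × Bool) O) (g : O → ℝ≥0∞), Measurable g → (∀ o, g o ≤ 1) →
        ∫⁻ o, g o ∂(Q.push (M.law hX)) ≤
          ∫⁻ o, g o ∂(Q.push ((LinModel.mk M.cov ψ).law hX)) + ENNReal.ofReal r := by
      intro Q g hg hg1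
      rw [lintegral_push Q _ hg, lintegral_push Q _ hg]
      have := Q.isMarkov
      refine M.lintegral_law_le hX ψ hr (hg.lintegral_kernel) (fun z => ?_)
      calc ∫⁻ o, g o ∂(Q.kernel z) ≤ ∫⁻ _, 1 ∂(Q.kernel z) := lintegral_mono hg1
        _ = 1 := by simp
    have hg : Measurable (fun x : Hist α (X × Bool) O D t × ((D × Channel α (X × Bool) O) × O) =>
        f (Fin.snoc x.1 x.2 : Hist α (X × Bool) O D (t + 1))) := hf.comp (measurable_snoc t)
    have hstep : ∀ h : Hist α (X × Bool) O D t,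
        ∫⁻ a, ∫⁻ o, f (Fin.snoc h (a, o) : Hist α (X × Bool) O D (t + 1))
          ∂(a.2.push (M.law hX)) ∂(A.q t h) ≤
        ∫⁻ a, ∫⁻ o, f (Fin.snoc h (a, o) : Hist α (X × Bool) O D (t + 1))
          ∂(a.2.push ((LinModel.mk M.cov ψ).law hX)) ∂(A.q t h) + ENNReal.ofReal r := by
      intro h
      have hm1 : Measurable (fun y : (D × Channel α (X × Bool) O) × O =>
          f (Fin.snoc h y : Hist α (X × Bool) O D (t + 1))) :=
        hg.comp measurable_prodMk_left
      have hm2 : ∀ a : D × Channel α (X × Bool) O, Measurable (fun o : O =>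
          f (Fin.snoc h (a, o) : Hist α (X × Bool) O D (t + 1))) := fun a =>
        hm1.comp measurable_prodMk_left
      calc _ ≤ ∫⁻ a, (∫⁻ o, f (Fin.snoc h (a, o) : Hist α (X × Bool) O D (t + 1))
            ∂(a.2.push ((LinModel.mk M.cov ψ).law hX)) + ENNReal.ofReal r) ∂(A.q t h) :=
            lintegral_mono (fun a => hpush a.2 _ (hm2 a) (fun o => hf1 _))
        _ = _ := by
            rw [lintegral_add_right _ measurable_const]
            simp
    refine (lintegral_mono hstep).trans ?_
    rw [lintegral_add_right _ measurable_const, lintegral_const, measure_univ, mul_one]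
    have hone : ∀ h : Hist α (X × Bool) O D t,
        ∫⁻ a, ∫⁻ o, f (Fin.snoc h (a, o) : Hist α (X × Bool) O D (t + 1))
          ∂(a.2.push ((LinModel.mk M.cov ψ).law hX)) ∂(A.q t h) ≤ 1 := by
      intro h
      calc _ ≤ ∫⁻ a, ∫⁻ _, 1 ∂(a.2.push ((LinModel.mk M.cov ψ).law hX)) ∂(A.q t h) :=
            lintegral_mono (fun a => lintegral_mono (fun o => hf1 _))
        _ = 1 := by simp
    refine (add_le_add_left (ih _ (A.measurable_lintegral_step _ t hf) hone) _).trans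
      (le_of_eq ?_)
    push_cast
    ring

/-- The `L₁` error is a convex function of the estimator: randomizing an estimator is no better than
averaging it. -/
theorem LinModel.lossL1_average_le (hX : X ⊆ Metric.closedBall 0 1) (M : LinModel X) {T : ℕ}
    (hT : 1 ≤ T) (p : Fin T → Measure (Ball d)) [∀ t, IsProbabilityMeasure (p t)] (θ : Ball d)
    (hθ : (θ : EuclideanSpace ℝ (Fin d)) =
      (1 / (T : ℝ)) • ∑ t, ∫ a, (a : EuclideanSpace ℝ (Fin d)) ∂(p t)) :
    M.lossL1 θ ≤ (1 / (T : ℝ)) * ∑ t, ∫ a, M.lossL1 a ∂(p t) := by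
  set F : EuclideanSpace ℝ (Fin d) → ℝ := fun v => ∫ x, |inner ℝ (x : EuclideanSpace ℝ (Fin d))
    (v - (M.param : EuclideanSpace ℝ (Fin d)))| ∂(M.cov : Measure X) with hF
  have hi := fun v => integrable_abs_inner hX (M.cov : Measure X) v
  have hconv : ConvexOn ℝ Set.univ F := by
    refine ⟨convex_univ, fun u _ v _ a b ha hb hab => ?_⟩
    simp only [hF, smul_eq_mul]
    rw [← integral_const_mul, ← integral_const_mul,
      ← integral_add ((hi _).const_mul _) ((hi _).const_mul _)]
    refine integral_mono (hi _) (((hi _).const_mul _).add ((hi _).const_mul _)) (fun x => ?_)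
    simp only
    have e : a • u + b • v - (M.param : EuclideanSpace ℝ (Fin d)) =
        a • (u - (M.param : EuclideanSpace ℝ (Fin d))) +
          b • (v - (M.param : EuclideanSpace ℝ (Fin d))) := by
      rw [smul_sub, smul_sub, sub_add_sub_comm, ← add_smul, hab, one_smul]
    rw [e, inner_add_right, inner_smul_right, inner_smul_right]
    refine (abs_add_le _ _).trans (le_of_eq ?_)
    rw [abs_mul, abs_mul, abs_of_nonneg ha, abs_of_nonneg hb]
  have hcont : Continuous F := by
    refine LipschitzWith.continuous (K := 1) (LipschitzWith.of_dist_le_mul (fun u v => ?_))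
    rw [Real.dist_eq, NNReal.coe_one, one_mul, dist_eq_norm]
    simp only [hF]
    rw [← integral_sub (hi _) (hi _), ← Real.norm_eq_abs]
    refine (norm_integral_le_of_norm_le_const (C := ‖u - v‖)
      (Filter.Eventually.of_forall (fun x => ?_))).trans (by rw [probReal_univ, mul_one])
    refine (abs_abs_sub_abs_le_abs_sub _ _).trans ?_
    rw [← inner_sub_right, sub_sub_sub_cancel_right]
    exact abs_inner_covariate_le hX x _
  have hT0 : (0 : ℝ) < T := by exact_mod_cast hT
  have hJ : ∀ t, F (∫ a, (a : EuclideanSpace ℝ (Fin d)) ∂(p t)) ≤ ∫ a, M.lossL1 a ∂(p t) := by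
    intro t
    refine hconv.map_integral_le hcont.continuousOn isClosed_univ
      (Filter.Eventually.of_forall (fun _ => Set.mem_univ _)) ?_ ?_
    · exact Integrable.of_bound measurable_subtype_coe.aestronglyMeasurable 1
        (Filter.Eventually.of_forall (fun a : Ball d => a.norm_le))
    · exact integrable_of_bounded (f := fun a => M.lossL1 a) (M.measurable_lossL1 hX) (C := 2)
        (fun a => by
        rw [abs_of_nonneg (M.lossL1_nonneg a)]; exact M.lossL1_le_two hX a)
  have hmain : F θ ≤ ∑ t : Fin T, (1 / (T : ℝ)) * F (∫ a, (a : EuclideanSpace ℝ (Fin d)) ∂(p t)) := by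
    rw [hθ, Finset.smul_sum]
    have := hconv.map_sum_le (t := Finset.univ) (w := fun _ : Fin T => 1 / (T : ℝ))
      (p := fun t => ∫ a, (a : EuclideanSpace ℝ (Fin d)) ∂(p t)) (fun _ _ => by positivity)
      (by rw [Finset.sum_const, Finset.card_univ, Fintype.card_fin, nsmul_eq_mul]; field_simp)
      (fun _ _ => Set.mem_univ _)
    simpa using this
  refine hmain.trans ?_
  rw [← Finset.mul_sum]
  exact mul_le_mul_of_nonneg_left (Finset.sum_le_sum (fun t _ => hJ t)) (by positivity)

end Perturbation

/-! ### The regret of exploration-by-optimization -/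

section Regret

variable {d : ℕ} {X : Set (EuclideanSpace ℝ (Fin d))} {hX : X ⊆ Metric.closedBall 0 1}
  {α γ η : ℝ} {Θ : Finset (Ball d)}

/-- The expected loss of `p^t` after the history `h`. -/
noncomputable def LDPExO.roundLoss (R : LDPExO hX α Θ γ η) (M : LinModel X) (t : ℕ)
    (h : BinHist X α t) : ℝ :=
  ∫ a, M.lossL1 a ∂(R.p t h)

/-- The cumulative normalized excess of the losses over `V + η`. -/
noncomputable def LDPExO.excess (R : LDPExO hX α Θ γ η) (M : LinModel X) (V : ℝ) (t : ℕ)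
    (h : BinHist X α t) : ℝ :=
  ∑ s : Fin t, (R.roundLoss M s (fun i => h (Fin.castLE s.isLt.le i)) - V - η) / γ

theorem LDPExO.excess_snoc (R : LDPExO hX α Θ γ η) (M : LinModel X) (V : ℝ) (t : ℕ)
    (h : BinHist X α t) (b : Probe X α × Bool) :
    R.excess M V (t + 1) (Fin.snoc h b : BinHist X α (t + 1)) =
      R.excess M V t h + (R.roundLoss M t h - V - η) / γ := by
  unfold LDPExO.excess
  rw [Fin.sum_univ_castSucc]
  congr 1
  · refine Finset.sum_congr rfl (fun s _ => ?_)
    have : (fun i : Fin s => (Fin.snoc h b : BinHist X α (t + 1))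
        (Fin.castLE (Fin.castSucc s).isLt.le i)) = fun i => h (Fin.castLE s.isLt.le i) := by
      funext i
      exact Fin.snoc_castSucc (α := fun _ => Probe X α × Bool) b h (Fin.castLE s.isLt.le i)
    simp only [Fin.val_castSucc]
    rw [← this]
  · have : (fun i : Fin t => (Fin.snoc h b : BinHist X α (t + 1))
        (Fin.castLE (Fin.last t).isLt.le i)) = h := by
      funext i
      exact Fin.snoc_castSucc (α := fun _ => Probe X α × Bool) b h i
    exact congrArg (fun g => (R.roundLoss M t g - V - η) / γ) this

theorem LDPExO.measurable_excess (R : LDPExO hX α Θ γ η) (M : LinModel X) (V : ℝ) (t : ℕ) :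
    Measurable (R.excess M V t) := by
  unfold LDPExO.excess
  refine Finset.measurable_sum _ (fun s _ => ?_)
  have h1 : Measurable (R.roundLoss M s) :=
    ((M.measurable_lossL1 hX).stronglyMeasurable.integral_kernel (κ := R.p s)).measurable
  have h2 : Measurable (fun (h : BinHist X α t) => (fun i : Fin s => h (Fin.castLE s.isLt.le i))) :=
    measurable_pi_lambda _ (fun i => measurable_pi_apply _)
  exact (((h1.comp h2).sub_const V).sub_const η).div_const γ

theorem LDPExO.measurable_expWeights (R : LDPExO hX α Θ γ η) :
    ∀ t : ℕ, Measurable (expWeights Θ R.ξ t)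
  | 0 => measurable_const
  | t + 1 => by
    have ih := (R.measurable_expWeights t).comp (measurable_init t)
    have hu : ∀ ψ' : Θ, Measurable (fun h : BinHist X α (t + 1) =>
        expWeights Θ R.ξ t (Fin.init h) ψ' *
        Real.exp (R.ξ t (Fin.init h) ψ' (h (Fin.last t)).1 (h (Fin.last t)).2)) := fun ψ' =>
      ((measurable_pi_apply ψ').comp ih).mul
        (((R.measurable_ξ t ψ').comp
          ((measurable_init t).prodMk (measurable_pi_apply (Fin.last t)))).exp)
    exact measurable_pi_lambda _ (fun ψ => (hu ψ).div (Finset.measurable_sum _ (fun ψ' _ => hu ψ')))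

theorem LDPExO.isWeight (R : LDPExO hX α Θ γ η) (t : ℕ) (h : BinHist X α t) :
    IsWeight (R.ξ t h) :=
  ⟨fun ψ => (R.measurable_ξ t ψ).comp (measurable_const.prodMk measurable_id), R.bounded_ξ t h⟩

/-- The factor by which the inverse weight of `ψ` grows in a round. -/
noncomputable def LDPExO.growth (R : LDPExO hX α Θ γ η) (ψ : Θ) (t : ℕ) (h : BinHist X α t)
    (b : Probe X α × Bool) : ℝ :=
  ∑ ψ', expWeights Θ R.ξ t h ψ' * Real.exp (R.ξ t h ψ' b.1 b.2 - R.ξ t h ψ b.1 b.2)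

theorem LDPExO.inv_expWeights_snoc (R : LDPExO hX α Θ γ η) (ψ : Θ) (t : ℕ) (h : BinHist X α t)
    (b : Probe X α × Bool) :
    (expWeights Θ R.ξ (t + 1) (Fin.snoc h b : BinHist X α (t + 1)) ψ)⁻¹ =
      (expWeights Θ R.ξ t h ψ)⁻¹ * R.growth ψ t h b := by
  simp only [expWeights, LDPExO.growth, Fin.init_snoc, Fin.snoc_last]
  rw [inv_div, Finset.mul_sum, Finset.sum_div]
  refine Finset.sum_congr rfl (fun ψ' _ => ?_)
  rw [Real.exp_sub]
  ring

/-- One round of the supermartingale: near-optimality of the round's choice bounds its expected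
growth by `1 - x ≤ e^{-x}`, where `x` is the excess of the round. -/
theorem LDPExO.exp_mul_lintegral_growth_le (hΘ : Θ.Nonempty) (hγ : 0 < γ)
    (R : LDPExO hX α Θ γ η) (M : LinModel X) (ψ : Θ) (hM : M.param = ψ) {V : ℝ}
    (hV : ∀ w : Θ → ℝ, (∀ ψ, 0 < w ψ) → ∑ ψ, w ψ = 1 → exoVal hX α w γ ≤ (V : EReal))
    (t : ℕ) (h : BinHist X α t) :
    ENNReal.ofReal (Real.exp ((R.roundLoss M t h - V - η) / γ)) *
      ∫⁻ a, ∫⁻ o, ENNReal.ofReal (R.growth ψ t h (a, o)) ∂(a.2.push (M.law hX)) ∂(R.q t h) ≤ 1 := by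
  have := R.isMarkov t
  have hξ := R.isWeight t h
  obtain ⟨A, hA⟩ := hξ.2
  have hw0 := expWeights_pos hΘ R.ξ t h
  have hw1 := sum_expWeights hΘ R.ξ t h
  set w := expWeights Θ R.ξ t h with hw
  have hG0 : ∀ b, 0 ≤ R.growth ψ t h b := fun b =>
    Finset.sum_nonneg (fun ψ' _ => mul_nonneg (hw0 ψ').le (Real.exp_pos _).le)
  have hGm : Measurable (R.growth ψ t h) := by
    unfold LDPExO.growth
    exact Finset.measurable_sum _ (fun ψ' _ => measurable_const.mul ((hξ.1 ψ').sub (hξ.1 ψ)).exp)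
  have hGb : ∀ b, R.growth ψ t h b ≤ Real.exp (2 * A) := by
    intro b
    calc R.growth ψ t h b ≤ ∑ ψ', w ψ' * Real.exp (2 * A) := by
          refine Finset.sum_le_sum (fun ψ' _ => mul_le_mul_of_nonneg_left ?_ (hw0 ψ').le)
          refine Real.exp_le_exp.mpr ?_
          linarith [(abs_le.mp (hA ψ' b.1 b.2)).2, (abs_le.mp (hA ψ b.1 b.2)).1]
      _ = Real.exp (2 * A) := by rw [← Finset.sum_mul, hw1, one_mul]
  have hin0 : ∀ a : Probe X α, 0 ≤ ∫ o, R.growth ψ t h (a, o) ∂(a.2.push (M.law hX)) :=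
    fun a => integral_nonneg (fun o => hG0 _)
  have hinm : Measurable (fun a : Probe X α =>
      ∫ o, R.growth ψ t h (a, o) ∂(a.2.push (M.law hX))) :=
    measurable_integral_push (M.law hX) (f := fun a o => R.growth ψ t h (a, o)) hGm
  have hinb : ∀ a : Probe X α, |∫ o, R.growth ψ t h (a, o) ∂(a.2.push (M.law hX))| ≤
      Real.exp (2 * A) := by
    intro a
    rw [abs_of_nonneg (hin0 a)]
    have := integral_mono (μ := a.2.push (M.law hX)) Integrable.of_finite
      (integrable_const (Real.exp (2 * A))) (fun o => hGb (a, o))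
    rwa [integral_const, probReal_univ, one_smul] at this
  have hini := integrable_of_bounded (μ := R.q t h) hinm hinb
  set E := ∫ a, ∫ o, R.growth ψ t h (a, o) ∂(a.2.push (M.law hX)) ∂(R.q t h) with hE
  have hlint : ∫⁻ a, ∫⁻ o, ENNReal.ofReal (R.growth ψ t h (a, o)) ∂(a.2.push (M.law hX))
      ∂(R.q t h) = ENNReal.ofReal E := by
    rw [hE, ofReal_integral_eq_lintegral_ofReal hini (Filter.Eventually.of_forall hin0)]
    refine lintegral_congr (fun a => ?_)
    rw [ofReal_integral_eq_lintegral_ofReal Integrable.of_finite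
      (Filter.Eventually.of_forall (fun o => hG0 (a, o)))]
  have hobj : exoObj hX w γ (R.p t h) (R.q t h) (R.ξ t h) M ψ =
      R.roundLoss M t h - γ * (1 - E) := by
    have h1 : ∀ a : Probe X α, ∫ o, ∑ ψ', w ψ' * (1 - Real.exp (R.ξ t h ψ' a o - R.ξ t h ψ a o))
        ∂(a.2.push (M.law hX)) = 1 - ∫ o, R.growth ψ t h (a, o) ∂(a.2.push (M.law hX)) := by
      intro a
      have h2 : ∀ o, ∑ ψ', w ψ' * (1 - Real.exp (R.ξ t h ψ' a o - R.ξ t h ψ a o)) =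
          1 - R.growth ψ t h (a, o) := by
        intro o
        simp_rw [mul_sub, mul_one]
        rw [Finset.sum_sub_distrib, hw1]
        rfl
      simp_rw [h2]
      rw [integral_sub (integrable_const _) Integrable.of_finite, integral_const, probReal_univ,
        one_smul]
    unfold exoObj
    simp_rw [h1]
    rw [integral_sub (integrable_const _) hini, integral_const, probReal_univ, one_smul]
    rfl
  have hle : exoObj hX w γ (R.p t h) (R.q t h) (R.ξ t h) M ψ ≤ V + η := by
    have h1 : ((exoObj hX w γ (R.p t h) (R.q t h) (R.ξ t h) M ψ : ℝ) : EReal) ≤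
        exoSup hX w γ (R.p t h) (R.q t h) (R.ξ t h) :=
      le_iSup_of_le ψ (le_iSup_of_le M (le_iSup_of_le hM le_rfl))
    have h2 := h1.trans ((R.optimal t h).trans (add_le_add_left (hV w hw0 hw1) (η : EReal)))
    exact_mod_cast h2
  rw [hobj] at hle
  rw [hlint, ← ENNReal.ofReal_mul (Real.exp_pos _).le, ← ENNReal.ofReal_one]
  refine ENNReal.ofReal_le_ofReal ?_
  set x := (R.roundLoss M t h - V - η) / γ with hx
  have hEx : E ≤ 1 - x := by
    have : γ * x = R.roundLoss M t h - V - η := by rw [hx]; field_simp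
    have h3 : γ * E ≤ γ * (1 - x) := by linarith
    exact le_of_mul_le_mul_left h3 hγ
  have h4 : 1 - x ≤ Real.exp (-x) := by linarith [Real.add_one_le_exp (-x)]
  calc Real.exp x * E ≤ Real.exp x * Real.exp (-x) :=
        mul_le_mul_of_nonneg_left (hEx.trans h4) (Real.exp_pos _).le
    _ = 1 := by rw [← Real.exp_add, add_neg_cancel, Real.exp_zero]

/-- The process `exp (excess) / w_t(ψ)` is a supermartingale that starts at `1 / w_1(ψ) = |Θ|`. -/
theorem LDPExO.lintegral_exp_excess_le (hΘ : Θ.Nonempty) (hγ : 0 < γ)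
    (R : LDPExO hX α Θ γ η) (M : LinModel X) (ψ : Θ) (hM : M.param = ψ) {V : ℝ}
    (hV : ∀ w : Θ → ℝ, (∀ ψ, 0 < w ψ) → ∑ ψ, w ψ = 1 → exoVal hX α w γ ≤ (V : EReal)) (t : ℕ) :
    ∫⁻ h, ENNReal.ofReal (Real.exp (R.excess M V t h) * (expWeights Θ R.ξ t h ψ)⁻¹)
      ∂(R.toExploration.histLaw (M.law hX) t) ≤ Θ.card := by
  have hmeas : ∀ t, Measurable (fun h : BinHist X α t =>
      ENNReal.ofReal (Real.exp (R.excess M V t h) * (expWeights Θ R.ξ t h ψ)⁻¹)) := fun t =>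
    ((R.measurable_excess M V t).exp.mul
      ((measurable_pi_apply ψ).comp (R.measurable_expWeights t)).inv).ennreal_ofReal
  induction t with
  | zero =>
    rw [Exploration.histLaw, lintegral_dirac' _ (hmeas 0)]
    simp [LDPExO.excess, expWeights]
  | succ t ih =>
    rw [R.toExploration.lintegral_histLaw_succ _ t (hmeas (t + 1))]
    refine le_trans (lintegral_mono (fun h => ?_)) ih
    have hw0 := expWeights_pos hΘ R.ξ t h
    have hpoint : ∀ b : Probe X α × Bool,
        ENNReal.ofReal (Real.exp (R.excess M V (t + 1) (Fin.snoc h b : BinHist X α (t + 1))) *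
          (expWeights Θ R.ξ (t + 1) (Fin.snoc h b : BinHist X α (t + 1)) ψ)⁻¹) =
        ENNReal.ofReal (Real.exp (R.excess M V t h) * (expWeights Θ R.ξ t h ψ)⁻¹) *
          ENNReal.ofReal (Real.exp ((R.roundLoss M t h - V - η) / γ)) *
          ENNReal.ofReal (R.growth ψ t h b) := by
      intro b
      have h1 : 0 ≤ Real.exp (R.excess M V t h) * (expWeights Θ R.ξ t h ψ)⁻¹ :=
        mul_nonneg (Real.exp_pos _).le (inv_nonneg.mpr (hw0 ψ).le)
      rw [R.excess_snoc, R.inv_expWeights_snoc, Real.exp_add, ← ENNReal.ofReal_mul h1,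
        ← ENNReal.ofReal_mul (mul_nonneg h1 (Real.exp_pos _).le)]
      congr 1
      ring
    simp_rw [hpoint]
    have hGm : Measurable (fun b : Probe X α × Bool => ENNReal.ofReal (R.growth ψ t h b)) := by
      have hξ := R.isWeight t h
      unfold LDPExO.growth
      exact (Finset.measurable_sum _
        (fun ψ' _ => measurable_const.mul ((hξ.1 ψ').sub (hξ.1 ψ)).exp)).ennreal_ofReal
    have hin : ∀ a : Probe X α, Measurable (fun o => ENNReal.ofReal (R.growth ψ t h (a, o))) :=
      fun a => hGm.comp measurable_prodMk_left
    have hout : Measurable (fun a : Probe X α =>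
        ∫⁻ o, ENNReal.ofReal (R.growth ψ t h (a, o)) ∂(a.2.push (M.law hX))) :=
      measurable_lintegral_push (M.law hX) measurable_snd
        (f := fun (a : Probe X α) o => ENNReal.ofReal (R.growth ψ t h (a, o))) hGm
    simp_rw [lintegral_const_mul _ (hin _)]
    rw [lintegral_const_mul _ hout, mul_assoc]
    exact mul_le_of_le_one_right' (R.exp_mul_lintegral_growth_le hΘ hγ M ψ hM hV t h)

/-- The cumulative excess is at most `log (|Θ| / δ)` with probability at least `1 - δ`. -/
theorem LDPExO.histLaw_excess_le (hΘ : Θ.Nonempty) (hγ : 0 < γ)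
    (R : LDPExO hX α Θ γ η) (M : LinModel X) (ψ : Θ) (hM : M.param = ψ) {V : ℝ}
    (hV : ∀ w : Θ → ℝ, (∀ ψ, 0 < w ψ) → ∑ ψ, w ψ = 1 → exoVal hX α w γ ≤ (V : EReal)) (t : ℕ)
    {δ : ℝ} (hδ : 0 < δ) :
    R.toExploration.histLaw (M.law hX) t {h | Real.log (Θ.card / δ) < R.excess M V t h} ≤
      ENNReal.ofReal δ := by
  have hc : (0 : ℝ) < Θ.card := by exact_mod_cast hΘ.card_pos
  have hsub : {h | Real.log (Θ.card / δ) < R.excess M V t h} ⊆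
      {h | ENNReal.ofReal (Θ.card / δ) ≤
        ENNReal.ofReal (Real.exp (R.excess M V t h) * (expWeights Θ R.ξ t h ψ)⁻¹)} := by
    intro h hh
    refine ENNReal.ofReal_le_ofReal ?_
    have h1 : (Θ.card : ℝ) / δ ≤ Real.exp (R.excess M V t h) := by
      rw [← Real.log_le_iff_le_exp (by positivity)]
      exact (le_of_lt hh)
    have hw0 := expWeights_pos hΘ R.ξ t h
    have hw1 : expWeights Θ R.ξ t h ψ ≤ 1 := by
      rw [← sum_expWeights hΘ R.ξ t h]
      exact Finset.single_le_sum (fun ψ' _ => (hw0 ψ').le) (Finset.mem_univ ψ)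
    have h2 : 1 ≤ (expWeights Θ R.ξ t h ψ)⁻¹ := (one_le_inv₀ (hw0 ψ)).mpr hw1
    calc (Θ.card : ℝ) / δ ≤ Real.exp (R.excess M V t h) * 1 := by rwa [mul_one]
      _ ≤ _ := mul_le_mul_of_nonneg_left h2 (Real.exp_pos _).le
  have hmeas : Measurable (fun h : BinHist X α t =>
      ENNReal.ofReal (Real.exp (R.excess M V t h) * (expWeights Θ R.ξ t h ψ)⁻¹)) :=
    ((R.measurable_excess M V t).exp.mul
      ((measurable_pi_apply ψ).comp (R.measurable_expWeights t)).inv).ennreal_ofReal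
  refine (measure_mono hsub).trans ?_
  refine (meas_ge_le_lintegral_div hmeas.aemeasurable
    (by rw [Ne, ENNReal.ofReal_eq_zero, not_le]; positivity) ENNReal.ofReal_ne_top).trans ?_
  refine (ENNReal.div_le_div_right (R.lintegral_exp_excess_le hΘ hγ M ψ hM hV t) _).trans ?_
  rw [← ENNReal.ofReal_natCast, ← ENNReal.ofReal_div_of_pos (by positivity)]
  refine ENNReal.ofReal_le_ofReal (le_of_eq ?_)
  field_simp

/-- The error guarantee of a run when the parameter of the model is within `r` of `Θ`. -/
theorem LDPExO.le_histLaw_lossL1 (hγ : 0 < γ)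
    (R : LDPExO hX α Θ γ η) (M : LinModel X) {r : ℝ} {ψ : Ball d} (hψ : ψ ∈ Θ)
    (hr : dist M.param ψ ≤ r) {V : ℝ}
    (hV : ∀ w : Θ → ℝ, (∀ ψ, 0 < w ψ) → ∑ ψ, w ψ = 1 → exoVal hX α w γ ≤ (V : EReal)) {T : ℕ}
    (hT : 1 ≤ T) {δ : ℝ} (hδ : 0 < δ) :
    ENNReal.ofReal (1 - (δ + T * r)) ≤ R.toExploration.histLaw (M.law hX) T
      {h | M.lossL1 (R.output T h) ≤ V + γ * Real.log (Θ.card / δ) / T + r + η} := by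
  have hΘ : Θ.Nonempty := ⟨ψ, hψ⟩
  have hr0 : 0 ≤ r := dist_nonneg.trans hr
  have hT0 : (0 : ℝ) < T := by exact_mod_cast hT
  set M' : LinModel X := ⟨M.cov, ψ⟩ with hM'
  set bad : Set (BinHist X α T) := {h | Real.log (Θ.card / δ) < R.excess M' V T h} with hbad
  have hbadm : MeasurableSet bad := measurableSet_lt measurable_const (R.measurable_excess M' V T)
  have h1 := R.histLaw_excess_le hΘ hγ M' ⟨ψ, hψ⟩ rfl hV T hδ
  have h2 : R.toExploration.histLaw (M.law hX) T bad ≤ ENNReal.ofReal (δ + T * r) := by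
    have h3 := M.lintegral_histLaw_le hX ψ hr R.toExploration T (bad.indicator 1)
      (measurable_one.indicator hbadm) (fun h => Set.indicator_le_self' (fun _ _ => zero_le) h)
    rw [lintegral_indicator_one hbadm, lintegral_indicator_one hbadm] at h3
    refine h3.trans ((add_le_add_left h1 _).trans (le_of_eq ?_))
    rw [ENNReal.ofReal_add hδ.le (by positivity), ENNReal.ofReal_mul hT0.le,
      ENNReal.ofReal_natCast]
  have hsub : badᶜ ⊆ {h | M.lossL1 (R.output T h) ≤
      V + γ * Real.log (Θ.card / δ) / T + r + η} := by
    intro h hh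
    simp only [hbad, Set.mem_compl_iff, Set.mem_ofPred_eq, not_lt] at hh
    have hpm : ∀ t : Fin T, IsProbabilityMeasure (R.p t (fun i => h (Fin.castLE t.isLt.le i))) :=
      fun t => (R.isMarkov_p t).isProbabilityMeasure _
    have h3 := M'.lossL1_average_le hX hT
      (fun t : Fin T => R.p t (fun i => h (Fin.castLE t.isLt.le i))) (R.output T h) rfl
    have h4 : ∑ t : Fin T, ∫ a, M'.lossL1 a ∂(R.p t (fun i => h (Fin.castLE t.isLt.le i))) =
        γ * R.excess M' V T h + T * (V + η) := by
      unfold LDPExO.excess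
      rw [Finset.mul_sum]
      have : (T : ℝ) * (V + η) = ∑ _t : Fin T, (V + η) := by
        rw [Finset.sum_const, Finset.card_univ, Fintype.card_fin, nsmul_eq_mul]
      rw [this, ← Finset.sum_add_distrib]
      refine Finset.sum_congr rfl (fun t _ => ?_)
      rw [mul_div_cancel₀ _ hγ.ne']
      simp only [LDPExO.roundLoss]
      ring
    have h5 : M'.lossL1 (R.output T h) ≤ V + γ * Real.log (Θ.card / δ) / T + η := by
      rw [h4] at h3
      have h6 := mul_le_mul_of_nonneg_left hh hγ.le
      have h7 : 1 / (T : ℝ) * (γ * R.excess M' V T h + T * (V + η)) ≤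
          1 / (T : ℝ) * (γ * Real.log (Θ.card / δ) + T * (V + η)) :=
        mul_le_mul_of_nonneg_left (by linarith) (by positivity)
      refine (h3.trans h7).trans (le_of_eq ?_)
      field_simp
      ring
    -- the losses of the two models differ by the distance of their parameters
    have h8 : M.lossL1 (R.output T h) ≤ M'.lossL1 (R.output T h) + r := by
      have hi := fun v => integrable_abs_inner hX (M.cov : Measure X) v
      have h9 : M.lossL1 (R.output T h) - M'.lossL1 (R.output T h) ≤ r := by
        simp only [LinModel.lossL1, hM']
        rw [← integral_sub (hi _) (hi _)]
        have h10 := integral_mono (μ := (M.cov : Measure X)) ((hi _).sub (hi _)) (integrable_const r)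
          (fun x => ((abs_sub_abs_le_abs_sub _ _).trans (by
            rw [← inner_sub_right, sub_sub_sub_cancel_left]
            refine (abs_inner_covariate_le hX x _).trans ?_
            rw [norm_sub_rev]
            rwa [Subtype.dist_eq, dist_eq_norm] at hr) :
            |inner ℝ (x : EuclideanSpace ℝ (Fin d)) ((R.output T h : EuclideanSpace ℝ (Fin d)) -
              (M.param : EuclideanSpace ℝ (Fin d)))| -
            |inner ℝ (x : EuclideanSpace ℝ (Fin d)) ((R.output T h : EuclideanSpace ℝ (Fin d)) -
              (ψ : EuclideanSpace ℝ (Fin d)))| ≤ r))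
        rwa [integral_const, probReal_univ, one_smul] at h10
      linarith
    show M.lossL1 (R.output T h) ≤ _
    linarith
  have := R.toExploration.isProbabilityMeasure_histLaw (M.law hX) T
  refine le_trans ?_ (measure_mono hsub)
  rw [prob_compl_eq_one_sub hbadm, ENNReal.ofReal_sub _ (by positivity), ENNReal.ofReal_one]
  exact tsub_le_tsub_left h2 _

end Regret

/-! ### The guarantee of LDP-ExO -/

section Guarantee

/-- The size of the net enters the guarantee through `log (|Θ| / δ) ≲ d log (e T) log (e / δ)`. -/
theorem log_card_div_le {d T : ℕ} (hd : 1 ≤ d) (hT : 1 ≤ T) {δ : ℝ} (hδ : 0 < δ) (hδ1 : δ < 1)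
    {N : ℝ} (hN0 : 0 < N) (hN : N ≤ (1 + 2 / (δ / (2 * T))) ^ d) :
    Real.log (N / (δ / 2)) ≤
      4 * d * (Real.log (Real.exp 1 * T) * Real.log (Real.exp 1 / δ)) := by
  have hd' : (1 : ℝ) ≤ d := by exact_mod_cast hd
  have hT' : (1 : ℝ) ≤ T := by exact_mod_cast hT
  have e1 : Real.log (Real.exp 1 * T) = 1 + Real.log T := by
    rw [Real.log_mul (Real.exp_pos 1).ne' (by linarith), Real.log_exp]
  have e2 : Real.log (Real.exp 1 / δ) = 1 + Real.log (1 / δ) := by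
    rw [Real.log_div (Real.exp_pos 1).ne' hδ.ne', Real.log_exp, one_div, Real.log_inv]
    ring
  have hlT : 0 ≤ Real.log T := Real.log_nonneg hT'
  have hlδ : 0 ≤ Real.log (1 / δ) := Real.log_nonneg (by rw [le_div_iff₀ hδ]; linarith)
  have hbase : 1 + 2 / (δ / (2 * T)) ≤ 5 * T * (1 / δ) := by
    have h : 2 / (δ / (2 * (T : ℝ))) = 4 * T * (1 / δ) := by field_simp; norm_num
    have h2 : 1 ≤ T * (1 / δ) := by
      rw [mul_one_div, le_div_iff₀ hδ]; linarith
    rw [h]; linarith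
  have h5 : Real.log 5 ≤ 2 := by
    rw [Real.log_le_iff_le_exp (by norm_num)]
    have h1 := Real.exp_one_gt_d9
    have h2 : Real.exp 2 = Real.exp 1 * Real.exp 1 := by rw [← Real.exp_add]; norm_num
    rw [h2]
    nlinarith
  have h2 : Real.log 2 ≤ 1 := by linarith [Real.log_two_lt_d9]
  have hlog : Real.log (5 * T * (1 / δ)) = Real.log 5 + Real.log T + Real.log (1 / δ) := by
    rw [Real.log_mul (by positivity) (by positivity), Real.log_mul (by norm_num) (by positivity)]
  have h3 : Real.log (N / (δ / 2)) ≤ d * Real.log (5 * T * (1 / δ)) +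
      (Real.log 2 + Real.log (1 / δ)) := by
    have e3 : N / (δ / 2) = N * (2 * (1 / δ)) := by field_simp
    rw [e3, Real.log_mul hN0.ne' (by positivity), Real.log_mul (by norm_num) (by positivity),
      ← Real.log_pow]
    refine add_le_add (Real.log_le_log hN0 (hN.trans ?_)) le_rfl
    exact pow_le_pow_left₀ (by positivity) hbase d
  rw [e1, e2]
  have h4 : 0 ≤ Real.log T * Real.log (1 / δ) := mul_nonneg hlT hlδ
  set a := Real.log T
  set b := Real.log (1 / δ)
  rw [hlog] at h3
  have h6 : (d : ℝ) * (Real.log 5 + a + b) + (Real.log 2 + b) ≤ d * (4 * (1 + a + b)) := by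
    have h7 : Real.log 2 + b ≤ d * (1 + b) := by nlinarith
    have h8 : (d : ℝ) * (Real.log 5 + a + b) ≤ d * (2 + a + b) :=
      mul_le_mul_of_nonneg_left (by linarith) (by linarith)
    have h9 : 0 ≤ (d : ℝ) * (1 + 3 * a + 2 * b) := by positivity
    linarith
  have h10 : (d : ℝ) * (4 * (1 + a + b)) ≤ d * (4 * ((1 + a) * (1 + b))) :=
    mul_le_mul_of_nonneg_left (by linarith) (by linarith)
  linarith

/-- Binary channels with bias at most `α / (2 + α)` are `α`-DP. -/
theorem bias_private {α : ℝ} (hα : 0 < α) :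
    1 + α / (2 + α) ≤ Real.exp α * (1 - α / (2 + α)) := by
  have h1 := Real.add_one_le_exp α
  have h2 : 1 - α / (2 + α) = 2 / (2 + α) := by field_simp; ring
  have h3 : 1 + α / (2 + α) = (α + 1) * (2 / (2 + α)) := by field_simp; ring
  rw [h2, h3]
  exact mul_le_mul_of_nonneg_right h1 (by positivity)

theorem exists_exo_guarantee {α₀ : ℝ} (hα₀ : 0 < α₀) : ∃ C : ℝ, 0 < C ∧
      ∀ (d : ℕ) (X : Set (EuclideanSpace ℝ (Fin d))) (hX : X ⊆ Metric.closedBall 0 1)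
        (α : ℝ), 0 < α → α ≤ α₀ → ∀ T : ℕ, 1 ≤ T → ∀ δ : ℝ, 0 < δ → δ < 1 →
        ∃ (Θ : Finset (Ball d)) (γ : ℝ), Θ.Nonempty ∧ 0 < γ ∧
          (∀ η : ℝ, 0 < η → Nonempty (LDPExO hX α Θ γ η)) ∧
          ∀ η : ℝ, 0 ≤ η → ∀ (R : LDPExO hX α Θ γ η) (M : LinModel X),
            ENNReal.ofReal (1 - δ) ≤ R.toExploration.histLaw (M.law hX) T
                {h | M.lossL1 (R.output T h) ≤
                  C * Real.sqrt (Real.log (Real.exp 1 * T)) *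
                    Real.sqrt ((d : ℝ) ^ 2 * Real.log (Real.exp 1 / δ) / (α ^ 2 * T)) + η} := by
  have hE := exoConst_pos
  refine ⟨6 * exoConst * (2 + α₀) ^ 2 + 4 + α₀, by positivity, ?_⟩
  intro d X hX α hα hαα₀ T hT δ hδ hδ1
  set C := 6 * exoConst * (2 + α₀) ^ 2 + 4 + α₀ with hC
  have hT' : (1 : ℝ) ≤ T := by exact_mod_cast hT
  rcases Nat.eq_zero_or_pos d with h0 | hd
  · subst h0
    refine ⟨{⟨0, by simp⟩}, 1, by simp, one_pos,
      fun η hη => nonempty_LDPExO hX hα (by simp) one_pos hη, fun η hη R M => ?_⟩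
    have : {h : BinHist X α T | M.lossL1 (R.output T h) ≤
        C * Real.sqrt (Real.log (Real.exp 1 * T)) *
          Real.sqrt (((0 : ℕ) : ℝ) ^ 2 * Real.log (Real.exp 1 / δ) / (α ^ 2 * T)) + η} =
        Set.univ := by
      ext h
      simp [LinModel.lossL1_of_dim_zero, hη]
    have hp := R.toExploration.isProbabilityMeasure_histLaw (M.law hX) T
    rw [this, measure_univ, ← ENNReal.ofReal_one]
    exact ENNReal.ofReal_le_ofReal (by linarith)
  · have hd' : (1 : ℝ) ≤ d := by exact_mod_cast hd
    set l1 := Real.log (Real.exp 1 * T) with hl1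
    set l2 := Real.log (Real.exp 1 / δ) with hl2
    have hl1' : 1 ≤ l1 := by
      rw [hl1, Real.log_mul (Real.exp_pos 1).ne' (by linarith), Real.log_exp]
      linarith [Real.log_nonneg hT']
    have hl2' : 1 ≤ l2 := by
      rw [hl2, Real.log_div (Real.exp_pos 1).ne' hδ.ne', Real.log_exp]
      linarith [Real.log_nonpos hδ.le hδ1.le]
    have hl : 1 ≤ l1 * l2 := by nlinarith
    set r : ℝ := δ / (2 * T) with hr
    have hr0 : 0 < r := by positivity
    obtain ⟨Θ, hΘ, hcard, hnet⟩ := exists_net (d := d) hr0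
    -- `γ = s / α` balances the value `O(d / (γ α²))` of the game and the cost
    -- `γ log (|Θ| / δ) / T` of the prior
    set s : ℝ := Real.sqrt (T / (l1 * l2)) with hs
    have hs0 : 0 < s := Real.sqrt_pos.mpr (by positivity)
    have hs2 : s ^ 2 = T / (l1 * l2) := Real.sq_sqrt (by positivity)
    refine ⟨Θ, s / α, hΘ, by positivity,
      fun η hη => nonempty_LDPExO hX hα hΘ (by positivity) hη, fun η hη R M => ?_⟩
    have hne : Nonempty X := M.cov.nonempty
    set c := α / (2 + α) with hc
    have hc0 : 0 < c := by positivity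
    have hc1 : c < 1 := by rw [hc, div_lt_one (by positivity)]; linarith
    obtain ⟨ψ, hψ, hdist⟩ := hnet M.param
    have hg := R.le_histLaw_lossL1 (by positivity) M hψ hdist
      (fun w hw0 hw1 => exoVal_le hd hX hw0 hw1 (by positivity) hc0 hc1 (bias_private hα)) hT
      (show 0 < δ / 2 by positivity)
    have hδT : δ / 2 + T * r = δ := by rw [hr]; field_simp; ring
    rw [hδT] at hg
    refine hg.trans (measure_mono (Set.ofPred_subset_ofPred.mpr
      (fun h hh => le_trans hh (add_le_add ?_ le_rfl))))
    -- the common scale of the three error terms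
    have hrate : Real.sqrt l1 * Real.sqrt ((d : ℝ) ^ 2 * l2 / (α ^ 2 * T)) = d / (α * s) := by
      rw [← Real.sqrt_mul (by linarith)]
      have : l1 * ((d : ℝ) ^ 2 * l2 / (α ^ 2 * T)) = (d / (α * s)) ^ 2 := by
        rw [div_pow, mul_pow, hs2]; field_simp
      rw [this, Real.sqrt_sq (by positivity)]
    rw [mul_assoc, hrate]
    set ρ := (d : ℝ) / (α * s) with hρ
    have hρ0 : 0 < ρ := by positivity
    have t1 : 6 * (exoConst * d / (s / α * c ^ 2)) ≤ 6 * exoConst * (2 + α₀) ^ 2 * ρ := by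
      have e : 6 * (exoConst * d / (s / α * c ^ 2)) = 6 * exoConst * (2 + α) ^ 2 * ρ := by
        rw [hc, hρ]; field_simp
      rw [e]
      have : (2 + α) ^ 2 ≤ (2 + α₀) ^ 2 := pow_le_pow_left₀ (by linarith) (by linarith) 2
      gcongr
    have t2 : s / α * Real.log (Θ.card / (δ / 2)) / T ≤ 4 * ρ := by
      have h1 := log_card_div_le hd hT hδ hδ1 (N := (Θ.card : ℝ))
        (by exact_mod_cast hΘ.card_pos) hcard
      have e : s / α * (4 * d * (l1 * l2)) / T = 4 * ρ := by
        have h2 : (T : ℝ) = s ^ 2 * (l1 * l2) := by rw [hs2]; field_simp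
        rw [hρ, h2]; field_simp
      rw [← e]
      gcongr
    have t3 : r ≤ α₀ * ρ := by
      have h1 : s ≤ T := by
        rw [hs, Real.sqrt_le_left (by linarith), div_le_iff₀ (by linarith)]
        nlinarith
      have h2 : r ≤ 1 / T := by
        rw [hr, div_le_div_iff₀ (by positivity) (by positivity)]
        nlinarith
      have h3 : (1 : ℝ) / T ≤ 1 / s := one_div_le_one_div_of_le hs0 h1
      have h4 : 1 / s ≤ α₀ * ρ := by
        rw [hρ, ← mul_div_assoc, div_le_div_iff₀ hs0 (by positivity)]
        have : α ≤ α₀ * d := hαα₀.trans (le_mul_of_one_le_right hα₀.le hd')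
        calc 1 * (α * s) = α * s := one_mul _
          _ ≤ α₀ * d * s := mul_le_mul_of_nonneg_right this hs0.le
      linarith
    rw [hC, add_mul, add_mul]
    linarith

end Guarantee

end LDPRegression

theorem mainTheorem12 :
    -- the private PAC-DEC bound
    (∃ C : ℝ, 0 < C ∧
      ∀ (d : ℕ) (X : Set (EuclideanSpace ℝ (Fin d))) (hX : X ⊆ Metric.closedBall 0 1)
        (ε : ℝ), 0 ≤ ε →
        LDPRegression.pdec (fun M : LDPRegression.LinModel X => M.law hX)
            (fun M θ => M.lossL1 θ) ε ≤
          ENNReal.ofReal (C * Real.sqrt d * ε)) ∧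
    -- the guarantee of LDP-ExO
    (∀ α₀ : ℝ, 0 < α₀ → ∃ C : ℝ, 0 < C ∧
      ∀ (d : ℕ) (X : Set (EuclideanSpace ℝ (Fin d))) (hX : X ⊆ Metric.closedBall 0 1)
        (α : ℝ), 0 < α → α ≤ α₀ → ∀ T : ℕ, 1 ≤ T → ∀ δ : ℝ, 0 < δ → δ < 1 →
        ∃ (Θ : Finset (LDPRegression.Ball d)) (γ : ℝ), Θ.Nonempty ∧ 0 < γ ∧
          (∀ η : ℝ, 0 < η → Nonempty (LDPRegression.LDPExO hX α Θ γ η)) ∧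
          ∀ η : ℝ, 0 ≤ η → ∀ (R : LDPRegression.LDPExO hX α Θ γ η)
            (M : LDPRegression.LinModel X),
            ENNReal.ofReal (1 - δ) ≤
              R.toExploration.histLaw (M.law hX) T
                {h | M.lossL1 (R.output T h) ≤
                  C * Real.sqrt (Real.log (Real.exp 1 * T)) *
                    Real.sqrt ((d : ℝ) ^ 2 * Real.log (Real.exp 1 / δ) / (α ^ 2 * T)) + η}) ∧
    -- the matching minimax lower bound
    (∀ α₀ : ℝ, 0 < α₀ → ∃ c : ℝ, 0 < c ∧
      ∀ d : ℕ, 1 ≤ d →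
        ∃ ν : MeasureTheory.ProbabilityMeasure
            (Metric.closedBall (0 : EuclideanSpace ℝ (Fin d)) 1),
          ∀ (α : ℝ), 0 < α → α ≤ α₀ → ∀ T : ℕ, 1 ≤ T →
          ∀ (O : Type) [MeasurableSpace O]
            (A : LDPRegression.Algorithm α
              (Metric.closedBall (0 : EuclideanSpace ℝ (Fin d)) 1 × Bool) O
              (LDPRegression.Ball d) T),
            ENNReal.ofReal (c * min (d / (α * Real.sqrt T)) (1 / Real.sqrt d)) ≤
              ⨆ θ : LDPRegression.Ball d,
                A.risk ((LDPRegression.LinModel.mk ν θ).law subset_rfl)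
                  (LDPRegression.LinModel.lossL1 (LDPRegression.LinModel.mk ν θ))) :=
  ⟨⟨LDPRegression.decConst, LDPRegression.decConst_pos,
    fun _ _ hX _ hε => LDPRegression.pdec_le hX hε⟩,
    fun _ hα₀ => LDPRegression.exists_exo_guarantee hα₀,
    fun _ hα₀ => LDPRegression.exists_minimax_lower_bound hα₀⟩
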